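/- Let $M$ be a (smooth, real) supermanifold of dimension $p|q$ (for $q=0$: an ordinary manifold), let $\tilde a\in\mathbb Z/2$ be the parity of the coordinate $x^a$, $\partial_a$ the left partial derivatives, and let repeated indices be summed over. For $w\in\mathbb R$ a density of weight $w$ is an object $\boldsymbol\psi=\psi\,(Dx)^w$, whose coefficient transforms by $\psi=|J|^w\psi'$, $J=Dx'/Dx$ being the Berezinian of $(\partial x'^b/\partial x^a)$. Operators on densities are linear and compatible with restriction to open subsets. Fix $\varepsilon\in\mathbb Z/2$; the coefficients below have parities $\varepsilon+\tilde a+\tilde b$ ($S^{ab}$), $\varepsilon+\tilde a$ ($T^a,\gamma^a,Q^a$) and $\varepsilon$ ($R,\theta,f$), and $S^{ab}=(-1)^{\tilde a\tilde b}S^{ba}$. A second-order operator (i.e. of order $\le 2$) of parity $\varepsilon$ on densities of weight $w$ is an operator that in all local coordinates has the form $L=\frac12S^{ab}\partial_b\partial_a+T^a\partial_a+R$. A long bracket of parity $\varepsilon$ (and weight $0$) is a bilinear operation, compatible with restriction, taking densities $\boldsymbol\psi,\boldsymbol\chi$ of arbitrary weights $w_1,w_2$ to a density $\{\boldsymbol\psi;\boldsymbol\chi\}$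 of weight $w_1+w_2$, which in local coordinates has the form (for homogeneous $\boldsymbol\psi$) $$\{\boldsymbol\psi;\boldsymbol\chi\}=\Bigl(S^{ab}\,\partial_b\psi\,\partial_a\chi\,(-1)^{\tilde a\tilde\psi}+\gamma^a\bigl(w_2\,\partial_a\psi\,\chi+(-1)^{\tilde a\tilde\psi}w_1\,\psi\,\partial_a\chi\bigr)+w_1w_2\,\theta\,\psi\chi\Bigr)(Dx)^{w_1+w_2},$$ with $S^{ab},\gamma^a,\theta$ independent of $w_1,w_2$. A canonical pencil of parity $\varepsilon$ is a family of operators $\Delta_w$ on densities of weight $w$, $w\in\mathbb R$, for which there is a long bracket such that in all local coordinates $$\Delta_w=\tfrac12\Bigl(S^{ab}\partial_b\partial_a+\bigl((-1)^{\tilde b(\varepsilon+1)}\partial_bS^{ba}+(2w-1)\gamma^a\bigr)\partial_a+w\,(-1)^{\tilde a(\varepsilon+1)}\partial_a\gamma^a+w(w-1)\,\theta\Bigr).$$ For a volume form $\boldsymbol\rho=\rho\,Dx$ (an even, nowhere vanishing density of weight $1$) and a vector field $Q=Q^a\partial_a$ of parity $\varepsilon$ put, on densities of weight $w$, $$\Delta^{LB}_w\psi=\tfrac12\,\rho^{w-1}\,(-1)^{\tilde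 a(\varepsilon+1)}\partial_a\bigl(\rho\,S^{ab}\partial_b(\rho^{-w}\psi)\bigr),\qquad \mathcal L_Q\psi=Q^a\partial_a\psi+w\,(-1)^{\tilde a(\varepsilon+1)}(\partial_aQ^a)\,\psi,$$ where the powers of $\rho$ are those of $|\rho|$. **Theorem.** Let $w_0\in\mathbb R$, $w_0\notin\{0,1,\frac12\}$, and let $L$ be a second-order operator of parity $\varepsilon$ on densities of weight $w_0$, with principal symbol $S^{ab}$. Then there is a unique canonical pencil $\Delta_w$ of parity $\varepsilon$ with $\Delta_{w_0}=L$. Moreover, for every volume form $\boldsymbol\rho$ on $M$ there are a unique vector field $Q$ and a unique scalar function $f$, both of parity $\varepsilon$, such that $$L=\Delta^{LB}_{w_0}+\mathcal L_Q+f,$$ where $\Delta^{LB}$ is formed with $\boldsymbol\rho$ and $S^{ab}$, and with these, for all $w\in\mathbb R$, $$\Delta_w=\Delta^{LB}_w+\frac{2w-1}{2w_0-1}\,\mathcal L_Q+\frac{w(w-1)}{w_0(w_0-1)}\,f .$$ -/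

import Mathlib

open scoped TensorProduct ContDiff
open TopologicalSpace

universe u v

noncomputable section

namespace SuperDensity

/-- The sign `(-1)^i` of a parity `i`. -/
def sgn (i : ZMod 2) : ℝ := if i = 0 then 1 else -1

/-- The index set of the coordinates in dimension `p|q`. -/
abbrev Idx (p q : ℕ) : Type := Fin p ⊕ Fin q

/-- The parity of a coordinate: the first `p` are even, the last `q` are odd. -/
def par {p q : ℕ} : Idx p q → ZMod 2 := Sum.elim (fun _ => 0) (fun _ => 1)

/-- The Grassmann algebra with `q` generators. -/
abbrev Gr (q : ℕ) : Type := ExteriorAlgebra ℝ (Fin q → ℝ)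

/-- The even (`i = 0`) and odd (`i = 1`) parts of the Grassmann algebra. -/
abbrev GrPart (q : ℕ) (i : ZMod 2) : Submodule ℝ (Gr q) :=
  CliffordAlgebra.evenOdd (0 : QuadraticForm ℝ (Fin q → ℝ)) i

/-! ### Smooth functions in coordinates -/

section Smooth

variable {X : Type u} [TopologicalSpace X] {p : ℕ}

/-- The real functions on the open set `U` that are smooth functions of the coordinates `x`. -/
def smoothFun (x : X → Fin p → ℝ) (U : Opens X) : Subalgebra ℝ (U → ℝ) where
  carrier := {f | ∃ g : (Fin p → ℝ) → ℝ,
    ContDiffOn ℝ ∞ g (x '' (U : Set X)) ∧ ∀ u : U, f u = g (x u)}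
  mul_mem' := by
    rintro _ _ ⟨g, hg, h⟩ ⟨g', hg', h'⟩
    exact ⟨fun y => g y * g' y, hg.mul hg', fun u => by simp [h, h']⟩
  add_mem' := by
    rintro _ _ ⟨g, hg, h⟩ ⟨g', hg', h'⟩
    exact ⟨fun y => g y + g' y, hg.add hg', fun u => by simp [h, h']⟩
  algebraMap_mem' := fun r => ⟨fun _ => r, contDiffOn_const, fun _ => rfl⟩

/-- Restriction of smooth functions to a smaller open set. -/
def smoothRes (x : X → Fin p → ℝ) {U V : Opens X} (h : U ≤ V) (f : smoothFun x V) :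
    smoothFun x U :=
  ⟨fun u => f.1 ⟨u.1, h u.2⟩, by
    obtain ⟨g, hg, hf⟩ := f.2
    exact ⟨g, hg.mono (Set.image_mono h), fun u => hf _⟩⟩

/-- A function as an element of `smoothFun x U`; the value is `0` if it is not smooth. -/
def toSmooth (x : X → Fin p → ℝ) (U : Opens X) (f : U → ℝ) : smoothFun x U :=
  open Classical in if h : f ∈ smoothFun x U then ⟨f, h⟩ else 0

/-- The coordinate function `x^a`. -/
def smoothCoord (x : X → Fin p → ℝ) (U : Opens X) (a : Fin p) : smoothFun x U :=
  ⟨fun u => x u a, fun y => y a, (contDiff_apply ℝ ℝ a).contDiffOn, fun _ => rfl⟩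

lemma smoothPd_aux (x : X → Fin p → ℝ) (U : Opens X) (hx : IsOpen (x '' (U : Set X)))
    {g g' : (Fin p → ℝ) → ℝ} (h : ∀ u : U, g (x u) = g' (x u)) (u : U) :
    fderiv ℝ g (x u) = fderiv ℝ g' (x u) := by
  apply Filter.EventuallyEq.fderiv_eq
  filter_upwards [hx.mem_nhds ⟨u.1, u.2, rfl⟩] with y hy
  obtain ⟨z, hz, rfl⟩ := hy
  exact h ⟨z, hz⟩

/-- The partial derivative `∂f/∂x^a` of a function that is smooth in the coordinates `x`. -/
def smoothPd (x : X → Fin p → ℝ) (U : Opens X) (hx : IsOpen (x '' (U : Set X))) (a : Fin p) :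
    smoothFun x U →ₗ[ℝ] smoothFun x U where
  toFun f := ⟨fun u => fderiv ℝ (Classical.choose f.2) (x u) (Pi.single a 1), by
    have hg := (Classical.choose_spec f.2).1
    exact ⟨fun y => fderiv ℝ (Classical.choose f.2) y (Pi.single a 1),
      (hg.fderiv_of_isOpen hx (m := ∞) le_rfl).clm_apply contDiffOn_const, fun _ => rfl⟩⟩
  map_add' f f' := by
    ext u
    have hd : ∀ f : smoothFun x U, DifferentiableAt ℝ (Classical.choose f.2) (x u) := fun f =>
      ((Classical.choose_spec f.2).1.contDiffAt (hx.mem_nhds ⟨u.1, u.2, rfl⟩)).differentiableAt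
        (by simp)
    have := smoothPd_aux x U hx (g := Classical.choose (f + f').2)
      (g' := Classical.choose f.2 + Classical.choose f'.2) (fun v => by
        rw [← (Classical.choose_spec (f + f').2).2 v, Pi.add_apply,
          ← (Classical.choose_spec f.2).2 v, ← (Classical.choose_spec f'.2).2 v]; rfl) u
    rw [fderiv_add (hd f) (hd f')] at this
    exact congrArg (fun l => l (Pi.single a 1)) this
  map_smul' r f := by
    ext u
    have hd : DifferentiableAt ℝ (Classical.choose f.2) (x u) :=
      ((Classical.choose_spec f.2).1.contDiffAt (hx.mem_nhds ⟨u.1, u.2, rfl⟩)).differentiableAt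
        (by simp)
    have := smoothPd_aux x U hx (g := Classical.choose (r • f).2)
      (g' := r • Classical.choose f.2) (fun v => by
        rw [← (Classical.choose_spec (r • f).2).2 v, Pi.smul_apply,
          ← (Classical.choose_spec f.2).2 v]; rfl) u
    rw [fderiv_const_smul hd] at this
    exact congrArg (fun l => l (Pi.single a 1)) this

end Smooth

/-! ### Sheaves of superalgebras, coordinate systems, supermanifolds -/

/-- A sheaf of supercommutative real algebras on `X`. -/
structure SuperSheaf (X : Type u) [TopologicalSpace X] where
  sec : Opens X → Type v
  [ring : ∀ U, Ring (sec U)]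
  [algebra : ∀ U, Algebra ℝ (sec U)]
  gr : ∀ U, ZMod 2 → Submodule ℝ (sec U)
  [graded : ∀ U, GradedAlgebra (gr U)]
  supercomm : ∀ U (i j : ZMod 2) (s t : sec U), s ∈ gr U i → t ∈ gr U j →
    s * t = sgn (i * j) • (t * s)
  res : ∀ {U V : Opens X}, U ≤ V → sec V →ₐ[ℝ] sec U
  res_gr : ∀ {U V : Opens X} (h : U ≤ V) (i : ZMod 2) (s : sec V), s ∈ gr V i → res h s ∈ gr U i
  res_refl : ∀ (U : Opens X) (s : sec U), res le_rfl s = s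
  res_res : ∀ {U V W : Opens X} (h : U ≤ V) (h' : V ≤ W) (s : sec W),
    res h (res h' s) = res (h.trans h') s
  glue : ∀ {ι : Type u} (U : ι → Opens X) (s : ∀ i, sec (U i)),
    (∀ i j, res (inf_le_left : U i ⊓ U j ≤ U i) (s i) =
      res (inf_le_right : U i ⊓ U j ≤ U j) (s j)) →
    ∃! t : sec (⨆ i, U i), ∀ i, res (le_iSup U i) t = s i

attribute [instance] SuperSheaf.ring SuperSheaf.algebra SuperSheaf.graded

section Berezinian

variable {X : Type u} [TopologicalSpace X] (O : SuperSheaf.{u, v} X) {p q : ℕ}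

/-- The even sections form a commutative ring. -/
instance evenCommRing (U : Opens X) : CommRing (O.gr U 0) :=
  { (inferInstance : Ring (O.gr U 0)) with
    mul_comm := fun a b => by
      apply Subtype.ext
      have := O.supercomm U 0 0 a b a.2 b.2
      simpa [sgn] using this }

/-- The even part of a section. -/
def evenPart {U : Opens X} (s : O.sec U) : O.gr U 0 := DirectSum.decompose (O.gr U) s 0

/-- The Berezinian `det (A - B D⁻¹ C) / det D` of the even invertible supermatrix with blocks
`A, B, C, D`. (The entries of `A`, `D` and `A - B D⁻¹ C` are even, so that taking their even
parts only serves to place them in a commutative ring.) -/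
def ber {U : Opens X} (A : Matrix (Idx p q) (Idx p q) (O.sec U)) : O.sec U :=
  let D : Matrix (Fin q) (Fin q) (O.gr U 0) := fun i j => evenPart O (A (.inr i) (.inr j))
  let H : Matrix (Fin p) (Fin p) (O.gr U 0) := fun i j => evenPart O
    (A (.inl i) (.inl j) -
      ∑ k, ∑ l, A (.inl i) (.inr k) * ((D⁻¹ k l : O.gr U 0) : O.sec U) * A (.inr l) (.inl j))
  ((H.det * Ring.inverse D.det : O.gr U 0) : O.sec U)

end Berezinian

/-- A system of coordinates of dimension `p|q` on the open set `V`: the even coordinates give an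
open embedding of `V` in `ℝ^p`, and over it there is an isomorphism of the sheaf of smooth
functions with values in the Grassmann algebra with the restriction of `O` to `V`.
(The values of `x` outside `V` play no role.) -/
structure Coord {X : Type u} [TopologicalSpace X] (O : SuperSheaf.{u, v} X) (p q : ℕ)
    (V : Opens X) where
  x : X → Fin p → ℝ
  isOpenEmbedding : Topology.IsOpenEmbedding (fun u : V => x u)
  iso : ∀ U : Opens X, U ≤ V → (smoothFun x U ⊗[ℝ] Gr q) ≃ₐ[ℝ] O.sec U
  iso_gr : ∀ (U : Opens X) (hU : U ≤ V) (i : ZMod 2) (f : smoothFun x U) (l : Gr q),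
    l ∈ GrPart q i → iso U hU (f ⊗ₜ[ℝ] l) ∈ O.gr U i
  iso_res : ∀ (U U' : Opens X) (hU : U ≤ V) (h : U' ≤ U) (f : smoothFun x U) (l : Gr q),
    O.res h (iso U hU (f ⊗ₜ[ℝ] l)) = iso U' (h.trans hU) (smoothRes x h f ⊗ₜ[ℝ] l)

/-- A supermanifold of dimension `p|q` with underlying space `X`. -/
structure Supermanifold (X : Type u) [TopologicalSpace X] (p q : ℕ) extends
    SuperSheaf.{u, v} X where
  exists_coord : ∀ x : X, ∃ V : Opens X, x ∈ V ∧ Nonempty (Coord toSuperSheaf p q V)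

namespace Coord

variable {X : Type u} [TopologicalSpace X] {O : SuperSheaf.{u, v} X} {p q : ℕ} {V : Opens X}

/-- The same coordinates on a smaller open set. -/
def restrict (c : Coord O p q V) {U : Opens X} (h : U ≤ V) : Coord O p q U where
  x := c.x
  isOpenEmbedding := c.isOpenEmbedding.comp (TopologicalSpace.Opens.isOpenEmbedding_of_le h)
  iso W hW := c.iso W (hW.trans h)
  iso_gr W hW := c.iso_gr W (hW.trans h)
  iso_res W W' hW := c.iso_res W W' (hW.trans h)

lemma isOpen_image (c : Coord O p q V) : IsOpen (c.x '' (V : Set X)) := by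
  have := c.isOpenEmbedding.isOpen_range
  rwa [show Set.range (fun u : V => c.x u) = c.x '' (V : Set X) by
    ext y; simp] at this

/-- The coordinates as sections of the structure sheaf. -/
def coord (c : Coord O p q V) : Idx p q → O.sec V
  | .inl a => c.iso V le_rfl (smoothCoord c.x V a ⊗ₜ[ℝ] 1)
  | .inr b => c.iso V le_rfl (1 ⊗ₜ[ℝ] ExteriorAlgebra.ι ℝ (Pi.single b 1))

/-- The (left) partial derivatives `∂_a` with respect to the coordinates. -/
def pd (c : Coord O p q V) (a : Idx p q) : O.sec V →ₗ[ℝ] O.sec V :=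
  (c.iso V le_rfl).toLinearMap ∘ₗ
    (match a with
      | .inl a => LinearMap.rTensor (Gr q) (smoothPd c.x V c.isOpen_image a)
      | .inr b => LinearMap.lTensor (smoothFun c.x V)
          (CliffordAlgebra.contractLeft (Q := (0 : QuadraticForm ℝ (Fin q → ℝ)))
            (LinearMap.proj b))) ∘ₗ
    (c.iso V le_rfl).symm.toLinearMap

/-- The Jacobian `J = Dx'/Dx`, i.e. the Berezinian of the matrix `∂x'^b/∂x^a`. -/
def jac (c c' : Coord O p q V) : O.sec V :=
  ber O (Matrix.of fun a b => c.pd a (c'.coord b))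

/-- The body of a superfunction: all odd coordinates are set to zero. -/
def body (c : Coord O p q V) (s : O.sec V) : smoothFun c.x V :=
  Algebra.TensorProduct.rid ℝ ℝ (smoothFun c.x V)
    (Algebra.TensorProduct.map (AlgHom.id ℝ (smoothFun c.x V)) ExteriorAlgebra.algebraMapInv
      ((c.iso V le_rfl).symm s))

/-- A real function on `V`, smooth in the even coordinates, as a superfunction. -/
def lift (c : Coord O p q V) (f : V → ℝ) : O.sec V :=
  c.iso V le_rfl (toSmooth c.x V f ⊗ₜ[ℝ] 1)

/-- The real power `|s|^w` of an even superfunction `s` whose body `b` vanishes nowhere: with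
`F(t) = |t|^w` and the nilpotent superfunction `n = s - b` it is the (finite) Taylor expansion
`F(b + n) = ∑ F^{(k)}(b) n^k / k!`. -/
def absPow (c : Coord O p q V) (w : ℝ) (s : O.sec V) : O.sec V :=
  ∑ k ∈ Finset.range (q + 1), ((k.factorial : ℝ)⁻¹) •
    (c.lift (fun u => iteratedDeriv k (fun t : ℝ => |t| ^ w) ((c.body s).1 u)) *
      (s - c.lift (c.body s).1) ^ k)

end Coord

/-! ### Densities -/

section Densities

variable {X : Type u} [TopologicalSpace X] {p q : ℕ} (M : Supermanifold.{u, v} X p q)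

/-- Coordinate systems on the open set `V` of the supermanifold. -/
abbrev Chart (V : Opens X) : Type (max u v) := Coord M.toSuperSheaf p q V

/-- The densities of weight `w` on the open set `U`. A density `ψ (Dx)^w` is given by its
coefficient `ψ` in every system of coordinates on an open subset of `U`; the coefficients are
compatible with restriction, and `ψ = |J|^w ψ'` with `J = Dx'/Dx` for two systems of coordinates
`x`, `x'`. -/
def Density (w : ℝ) (U : Opens X) : Submodule ℝ (∀ V : {V : Opens X // V ≤ U}, Chart M V.1 → M.sec V.1) where
  carrier := {ψ |
    (∀ (V V' : Opens X) (hV : V ≤ U) (h : V' ≤ V) (c : Chart M V),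
      M.res h (ψ ⟨V, hV⟩ c) = ψ ⟨V', h.trans hV⟩ (c.restrict h)) ∧
    (∀ (V : Opens X) (hV : V ≤ U) (c c' : Chart M V),
      ψ ⟨V, hV⟩ c = c.absPow w (c.jac c') * ψ ⟨V, hV⟩ c')}
  add_mem' := by
    rintro ψ χ ⟨h1, h2⟩ ⟨h1', h2'⟩
    refine ⟨fun V V' hV h c => ?_, fun V hV c c' => ?_⟩
    · simp [h1 V V' hV h c, h1' V V' hV h c]
    · simp only [Pi.add_apply, mul_add]
      rw [← h2 V hV c c', ← h2' V hV c c']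
  zero_mem' := ⟨fun _ _ _ _ _ => by simp, fun _ _ _ _ => by simp⟩
  smul_mem' := by
    rintro r ψ ⟨h1, h2⟩
    refine ⟨fun V V' hV h c => ?_, fun V hV c c' => ?_⟩
    · simp [h1 V V' hV h c]
    · simp only [Pi.smul_apply, mul_smul_comm]
      rw [← h2 V hV c c']

variable {M}

/-- Restriction of densities to a smaller open set. -/
def resDensity {w : ℝ} {U U' : Opens X} (h : U' ≤ U) (ψ : Density M w U) : Density M w U' :=
  ⟨fun V c => ψ.1 ⟨V.1, V.2.trans h⟩ c,
    fun V V' hV h' c => ψ.2.1 V V' (hV.trans h) h' c,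
    fun V hV c c' => ψ.2.2 V (hV.trans h) c c'⟩

/-- The coefficient of a density on `V` in a system of coordinates on `V`. -/
def coeff {w : ℝ} {V : Opens X} (c : Chart M V) (ψ : Density M w V) : M.sec V :=
  ψ.1 ⟨V, le_rfl⟩ c

variable (M)

/-- Linear operators on densities of weight `w`: linear maps on the densities over every open set,
compatible with restriction. -/
@[ext]
structure DensityOp (w : ℝ) where
  app : ∀ U : Opens X, Density M w U →ₗ[ℝ] Density M w U
  app_res : ∀ (U U' : Opens X) (h : U' ≤ U) (ψ : Density M w U),
    app U' (resDensity h ψ) = resDensity h (app U ψ)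

/-- Volume forms: even, nowhere vanishing (i.e. invertible) densities of weight `1` on all
of `M`. -/
structure VolumeForm where
  density : Density M 1 ⊤
  even : ∀ (V : Opens X) (c : Chart M V), density.1 ⟨V, le_top⟩ c ∈ M.gr V 0
  isUnit : ∀ (V : Opens X) (c : Chart M V), IsUnit (density.1 ⟨V, le_top⟩ c)

variable {M} in
/-- The coefficient `ρ` of a volume form `ρ Dx`. -/
def VolumeForm.coeff (ρ : VolumeForm M) {V : Opens X} (c : Chart M V) : M.sec V :=
  ρ.density.1 ⟨V, le_top⟩ c

/-- Vector fields `X = X^a ∂_a` of parity `ε`. -/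
@[ext]
structure VectorField (ε : ZMod 2) where
  coeff : ∀ V : Opens X, Chart M V → Idx p q → M.sec V
  parity : ∀ V (c : Chart M V) a, coeff V c a ∈ M.gr V (ε + par a)
  coeff_res : ∀ (V V' : Opens X) (h : V' ≤ V) (c : Chart M V) a,
    M.res h (coeff V c a) = coeff V' (c.restrict h) a
  transform : ∀ (V : Opens X) (c c' : Chart M V) a',
    coeff V c' a' = ∑ a, coeff V c a * c.pd a (c'.coord a')

variable {M}
variable {V : Opens X}

/-! ### Differential operators of the second order -/

/-- In the coordinates `c` on `V` the operator `L` of parity `ε` is given by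
`L = ½ S^{ab} ∂_b ∂_a + T^a ∂_a + R` with (super)symmetric `S^{ab}`. -/
structure DensityOp.HasCoeffs {w : ℝ} (L : DensityOp M w) (ε : ZMod 2) (c : Chart M V)
    (S : Idx p q → Idx p q → M.sec V) (T : Idx p q → M.sec V) (R : M.sec V) : Prop where
  parity_S : ∀ a b, S a b ∈ M.gr V (ε + par a + par b)
  parity_T : ∀ a, T a ∈ M.gr V (ε + par a)
  parity_R : R ∈ M.gr V ε
  symm : ∀ a b, S a b = sgn (par a * par b) • S b a
  eq : ∀ ψ : Density M w V, coeff c (L.app V ψ) =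
    (1 / 2 : ℝ) • (∑ a, ∑ b, S a b * c.pd b (c.pd a (coeff c ψ))) +
      (∑ a, T a * c.pd a (coeff c ψ)) + R * coeff c ψ

/-- Differential operators of the second order (i.e. of order `≤ 2`) and of parity `ε` on
densities of weight `w`. -/
def DensityOp.IsSecondOrder {w : ℝ} (L : DensityOp M w) (ε : ZMod 2) : Prop :=
  ∀ (V : Opens X) (c : Chart M V), ∃ S T R, L.HasCoeffs ε c S T R

/-! ### Long brackets and canonical pencils -/

variable (M) in
/-- Long brackets of parity `ε` and weight `0`: brackets `{ψ; χ}` of densities of arbitrary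
weights `w₁`, `w₂`, with values in densities of weight `w₁ + w₂`, which in coordinates are given by
components `S^{ab}`, `γ^a`, `θ`; on homogeneous `ψ`
`{ψ; χ} = S^{ab} ∂_bψ ∂_aχ (-1)^{aψ} + γ^a (w₂ ∂_aψ χ + (-1)^{aψ} w₁ ψ ∂_aχ) + w₁ w₂ θ ψ χ`. -/
structure LongBracket (ε : ZMod 2) where
  S : ∀ V : Opens X, Chart M V → Idx p q → Idx p q → M.sec V
  γ : ∀ V : Opens X, Chart M V → Idx p q → M.sec V
  θ : ∀ V : Opens X, Chart M V → M.sec V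
  parity_S : ∀ V (c : Chart M V) a b, S V c a b ∈ M.gr V (ε + par a + par b)
  parity_γ : ∀ V (c : Chart M V) a, γ V c a ∈ M.gr V (ε + par a)
  parity_θ : ∀ V (c : Chart M V), θ V c ∈ M.gr V ε
  symm : ∀ V (c : Chart M V) a b, S V c a b = sgn (par a * par b) • S V c b a
  br : ∀ (w₁ w₂ : ℝ) (U : Opens X),
    Density M w₁ U →ₗ[ℝ] Density M w₂ U →ₗ[ℝ] Density M (w₁ + w₂) U
  br_res : ∀ (w₁ w₂ : ℝ) (U U' : Opens X) (h : U' ≤ U) (ψ : Density M w₁ U) (χ : Density M w₂ U),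
    br w₁ w₂ U' (resDensity h ψ) (resDensity h χ) = resDensity h (br w₁ w₂ U ψ χ)
  br_eq : ∀ (w₁ w₂ : ℝ) (V : Opens X) (c : Chart M V) (ψ : Density M w₁ V) (χ : Density M w₂ V)
    (i : ZMod 2), coeff c ψ ∈ M.gr V i →
    coeff c (br w₁ w₂ V ψ χ) =
      (∑ a, ∑ b, sgn (par a * i) • (S V c a b * c.pd b (coeff c ψ) * c.pd a (coeff c χ))) +
      (∑ a, γ V c a * (w₂ • (c.pd a (coeff c ψ) * coeff c χ) +
        (sgn (par a * i) * w₁) • (coeff c ψ * c.pd a (coeff c χ)))) +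
      (w₁ * w₂) • (θ V c * coeff c ψ * coeff c χ)

/-- The pencil `Δ_w` is the canonical pencil of the long bracket `B`:
`Δ_w = ½ (S^{ab} ∂_b ∂_a + (∂_b S^{ba} (-1)^{b(ε+1)} + (2w-1) γ^a) ∂_a
  + w ∂_a γ^a (-1)^{a(ε+1)} + w(w-1) θ)`. -/
def LongBracket.IsPencil {ε : ZMod 2} (B : LongBracket M ε) (Δ : ∀ w : ℝ, DensityOp M w) : Prop :=
  ∀ (w : ℝ) (V : Opens X) (c : Chart M V) (ψ : Density M w V),
    coeff c ((Δ w).app V ψ) = (1 / 2 : ℝ) •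
      ((∑ a, ∑ b, B.S V c a b * c.pd b (c.pd a (coeff c ψ))) +
        (∑ a, ((∑ b, sgn (par b * (ε + 1)) • c.pd b (B.S V c b a)) + (2 * w - 1) • B.γ V c a) *
          c.pd a (coeff c ψ)) +
        w • ((∑ a, sgn (par a * (ε + 1)) • c.pd a (B.γ V c a)) * coeff c ψ) +
        (w * (w - 1)) • (B.θ V c * coeff c ψ))

/-- The canonical pencils of parity `ε`: those that correspond to long brackets. -/
def IsCanonicalPencil (ε : ZMod 2) (Δ : ∀ w : ℝ, DensityOp M w) : Prop :=
  ∃ B : LongBracket M ε, B.IsPencil Δ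

/-! ### The decomposition relative to a volume form -/

/-- The Laplace--Beltrami operator on densities of weight `w`,
`½ ρ^{w-1} ∂_a (ρ S^{ab} ∂_b (ρ^{-w} ψ)) (-1)^{a(ε+1)}`, in the coordinates `c`; the powers of `ρ`
are those of `|ρ|`. -/
def laplaceBeltrami (ε : ZMod 2) (c : Chart M V) (S : Idx p q → Idx p q → M.sec V)
    (ρ : VolumeForm M) (w : ℝ) (ψ : M.sec V) : M.sec V :=
  (1 / 2 : ℝ) • (c.absPow (w - 1) (ρ.coeff c) *
    ∑ a, sgn (par a * (ε + 1)) • c.pd a (c.absPow 1 (ρ.coeff c) *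
      ∑ b, S a b * c.pd b (c.absPow (-w) (ρ.coeff c) * ψ)))

/-- The Lie derivative `X^a ∂_a + w ∂_a X^a (-1)^{a(ε+1)}` on densities of weight `w`, in the
coordinates `c`. -/
def lieDeriv {ε : ZMod 2} (c : Chart M V) (Q : VectorField M ε) (w : ℝ) (ψ : M.sec V) : M.sec V :=
  (∑ a, Q.coeff V c a * c.pd a ψ) +
    w • ((∑ a, sgn (par a * (ε + 1)) • c.pd a (Q.coeff V c a)) * ψ)

/-- `A = Δ^{LB}_w + r ℒ_Q + s f` as operators on densities of weight `w`, where `Δ^{LB}` is formed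
with the volume form `ρ` and the principal symbol `S^{ab}` of the operator `L`. -/
def IsCombination {w₀ w : ℝ} (A : DensityOp M w) (L : DensityOp M w₀) (ε : ZMod 2)
    (ρ : VolumeForm M) (r : ℝ) (Q : VectorField M ε) (s : ℝ) (f : M.gr ⊤ ε) : Prop :=
  ∀ (V : Opens X) (c : Chart M V) (S : Idx p q → Idx p q → M.sec V) (T : Idx p q → M.sec V)
    (R : M.sec V), L.HasCoeffs ε c S T R → ∀ ψ : Density M w V,
    coeff c (A.app V ψ) = laplaceBeltrami ε c S ρ w (coeff c ψ) +
      r • lieDeriv c Q w (coeff c ψ) +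
      s • (M.res le_top (f : M.sec ⊤) * coeff c ψ)

end Densities

end SuperDensity

end

/-! In one chart the theorem is linear algebra. An operator ½S∂∂+T∂+R determines S, T, R through its
values on 1, x^a and x^a x^b (`op_unique`), and the operator of weight w in a canonical pencil has T
= ½(div S+(2w-1)γ) and R = ½(w div γ+w(w-1)θ). At w₀ these equations can be solved, uniquely, first
for γ and then for θ, exactly because 2w₀-1 and w₀(w₀-1) do not vanish (`canon_unique`,
`canon_pencil`). What remains is that the local solutions fit together at every weight, not only at
w₀, and that they come from a long bracket.

The central identity is `lb_add_lie_eq_canon`: for a covector ℓ in the role of ∂ log ρ, the family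
Δ^{LB}_w + (2w-1)r 𝓛_Q + w(w-1)t f is a canonical pencil with γ = -Sℓ+2rQ and θ = Sℓℓ+4r div Q+2tf.
Each of its three terms is invariant under a change of coordinates at every weight (`lb_transform`,
`lie_transform`), and only the transformation law of ℓ matters for this. To compare two charts one
takes ℓ = 0 in the first, that is, the coordinate volume form. The pencil of the first chart then
becomes, in the second chart, a pencil with components that do not depend on w; at w₀ both charts
describe L, so uniqueness identifies these components with those computed in the second chart
(`canon_transform`). The bracket is the failure of the pencil to be a derivation,
Δ(ψχ)-Δ(ψ)χ-(-1)^{εψ}ψΔ(χ), which is invariant by construction and has the required form by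
`canon_mul`.

For a volume form ρ, L and Δ^{LB}_{w₀} have the same principal symbol, so their difference is of
first order and is 𝓛_Q+f for unique Q and f. Invariance of L and Δ^{LB} makes Q a vector field and f
a function, which is glued by the sheaf property. The formula for all w is the central identity with
r = 1/(2w₀-1) and t = 1/(w₀(w₀-1)): its right-hand side is a canonical pencil passing through L.

The invariance rests on superanalysis: the chain rule, from Hadamard's lemma (`chain_rule`);
multiplicativity and logarithmic derivative of the Berezinian (`ber_mul`, `ber_deriv`), giving ∂_a J
= J·`logJac`; and a characterisation of |s|^w by its body and a first-order equation in the odd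
directions (`absPow_unique`), from which all rules for powers follow. -/

namespace SuperDensity

/-! ### The Grassmann algebra -/

section Grassmann

variable {q : ℕ}

/-- Contraction of the Grassmann algebra with the `b`-th coordinate: the odd derivative. -/
noncomputable def contr (b : Fin q) : Gr q →ₗ[ℝ] Gr q :=
  CliffordAlgebra.contractLeft (Q := (0 : QuadraticForm ℝ (Fin q → ℝ))) (LinearMap.proj b)

lemma contr_ι_mul (b : Fin q) (m : Fin q → ℝ) (x : Gr q) :
    contr b (ExteriorAlgebra.ι ℝ m * x) = m b • x - ExteriorAlgebra.ι ℝ m * contr b x :=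
  CliffordAlgebra.contractLeft_ι_mul ..

lemma contr_ι (b : Fin q) (m : Fin q → ℝ) :
    contr b (ExteriorAlgebra.ι ℝ m) = algebraMap ℝ (Gr q) (m b) :=
  CliffordAlgebra.contractLeft_ι ..

lemma contr_algebraMap (b : Fin q) (r : ℝ) : contr b (algebraMap ℝ (Gr q) r) = 0 :=
  CliffordAlgebra.contractLeft_algebraMap ..

lemma contr_one (b : Fin q) : contr b (1 : Gr q) = 0 :=
  CliffordAlgebra.contractLeft_one ..

lemma contr_comm (b b' : Fin q) (x : Gr q) : contr b (contr b' x) = -contr b' (contr b x) :=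
  CliffordAlgebra.contractLeft_comm ..

lemma gr_induction {P : Gr q → Prop} (h0 : ∀ r : ℝ, P (algebraMap ℝ (Gr q) r))
    (hadd : ∀ x y, P x → P y → P (x + y))
    (hmul : ∀ (x : Gr q) (m : Fin q → ℝ), P x → P (ExteriorAlgebra.ι ℝ m * x)) (x : Gr q) : P x :=
  CliffordAlgebra.left_induction (Q := (0 : QuadraticForm ℝ (Fin q → ℝ))) h0 hadd hmul x

lemma contr_mul (b : Fin q) (x y : Gr q) :
    contr b (x * y) = contr b x * y + CliffordAlgebra.involute x * contr b y := by
  induction x using gr_induction with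
  | h0 r => simp [contr_algebraMap, ← Algebra.smul_def]
  | hadd x x' hx hx' => simp only [add_mul, map_add, hx, hx']; abel
  | hmul x m hx =>
    have h : CliffordAlgebra.involute (ExteriorAlgebra.ι ℝ m * x) =
        - (ExteriorAlgebra.ι ℝ m * CliffordAlgebra.involute x) := by
      rw [map_mul]
      erw [CliffordAlgebra.involute_ι]
      rw [neg_mul]
    rw [mul_assoc, contr_ι_mul, hx, contr_ι_mul, h]
    simp only [mul_add, sub_mul, smul_mul_assoc, mul_assoc, neg_mul]
    abel

lemma involute_eq_sgn {i : ZMod 2} {x : Gr q} (hx : x ∈ GrPart q i) :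
    CliffordAlgebra.involute x = sgn i • x := by
  fin_cases i
  · have := CliffordAlgebra.involute_eq_of_mem_even hx
    rw [this]; exact (one_smul ℝ x).symm
  · have := CliffordAlgebra.involute_eq_of_mem_odd hx
    rw [this]; exact (neg_one_smul ℝ x).symm

lemma ι_mem_grPart (m : Fin q → ℝ) : ExteriorAlgebra.ι ℝ m ∈ GrPart q 1 :=
  CliffordAlgebra.ι_mem_evenOdd_one _ m

lemma one_mem_grPart : (1 : Gr q) ∈ GrPart q 0 :=
  Submodule.one_le.1 (CliffordAlgebra.one_le_evenOdd_zero _)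

lemma grPart_mul {i j : ZMod 2} {x y : Gr q} (hx : x ∈ GrPart q i) (hy : y ∈ GrPart q j) :
    x * y ∈ GrPart q (i + j) :=
  CliffordAlgebra.evenOdd_mul_le _ i j (Submodule.mul_mem_mul hx hy)

/-- The even and the odd part are generated from the scalars and the vectors, respectively, by
multiplication with pairs of vectors, so the parity claim only has to survive such a multiplication;
this is `key`. -/
lemma contr_mem (b : Fin q) {i : ZMod 2} {x : Gr q} (hx : x ∈ GrPart q i) :
    contr b x ∈ GrPart q (i + 1) := by
  have key : ∀ (m n : Fin q → ℝ) (j : ZMod 2) (y : Gr q), y ∈ GrPart q j →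
      contr b y ∈ GrPart q (j + 1) →
      contr b (ExteriorAlgebra.ι ℝ m * ExteriorAlgebra.ι ℝ n * y) ∈ GrPart q (j + 1) := by
    intro m n j y hy h
    rw [mul_assoc, contr_ι_mul, contr_ι_mul]
    have h1 : ∀ z : Gr q, ∀ k, z ∈ GrPart q k → ∀ m, ExteriorAlgebra.ι ℝ m * z ∈ GrPart q (k + 1) := by
      intro z k hz m
      rw [add_comm]
      exact grPart_mul (ι_mem_grPart m) hz
    have h2 := h1 _ _ (h1 _ _ h n) m
    have e : j + 1 + 1 + 1 = j + 1 := by clear * -; revert j; decide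
    rw [e] at h2
    rw [mul_sub, mul_smul_comm]
    exact Submodule.sub_mem _ (Submodule.smul_mem _ _ (h1 _ _ hy n))
      (Submodule.sub_mem _ (Submodule.smul_mem _ _ (h1 _ _ hy m)) h2)
  induction i using Fin.cases with
  | zero =>
    induction x, hx using CliffordAlgebra.even_induction with
    | algebraMap r => exact (contr_algebraMap b r) ▸ Submodule.zero_mem _
    | add x y hx hy h h' => rw [map_add]; exact Submodule.add_mem _ h h'
    | ι_mul_ι_mul m n x hx h => exact key m n 0 x hx h
  | succ i =>
    obtain rfl : i = 0 := Subsingleton.elim _ _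
    change x ∈ GrPart q 1 at hx
    change contr b x ∈ GrPart q (1 + 1)
    induction x, hx using CliffordAlgebra.odd_induction with
    | ι m =>
      erw [contr_ι]
      have := Submodule.smul_mem _ (m b) (one_mem_grPart (q := q))
      rwa [← Algebra.algebraMap_eq_smul_one] at this
    | add x y hx hy h h' => rw [map_add]; exact Submodule.add_mem _ h h'
    | ι_mul_ι_mul m n x hx h => exact key m n 1 x hx h

/-- The augmentation of the Grassmann algebra. -/
noncomputable abbrev aug : Gr q →ₐ[ℝ] ℝ := ExteriorAlgebra.algebraMapInv

lemma aug_ι (m : Fin q → ℝ) : aug (ExteriorAlgebra.ι ℝ m) = 0 := by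
  simp [aug, ExteriorAlgebra.algebraMapInv]

lemma aug_algebraMap (r : ℝ) : aug (algebraMap ℝ (Gr q) r) = r := by simp

/-- The filtration of the Grassmann algebra by degree. -/
noncomputable def grFil (q k : ℕ) : Submodule ℝ (Gr q) :=
  LinearMap.range (ExteriorAlgebra.ι ℝ (M := Fin q → ℝ)) ^ k * ⊤

lemma ι_mul_mem_grFil {k : ℕ} (m : Fin q → ℝ) {x : Gr q} (hx : x ∈ grFil q k) :
    ExteriorAlgebra.ι ℝ m * x ∈ grFil q (k + 1) := by
  rw [grFil, pow_succ', mul_assoc]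
  exact Submodule.mul_mem_mul ⟨m, rfl⟩ hx

lemma grFil_succ_induction {k : ℕ} {P : Gr q → Prop} (hadd : ∀ x y, P x → P y → P (x + y))
    (hmul : ∀ (m : Fin q → ℝ) (x : Gr q), x ∈ grFil q k → P (ExteriorAlgebra.ι ℝ m * x))
    {x : Gr q} (hx : x ∈ grFil q (k + 1)) : P x := by
  rw [grFil, pow_succ', mul_assoc] at hx
  induction hx using Submodule.mul_induction_on' with
  | mem_mul_mem m hm n hn =>
    obtain ⟨m, rfl⟩ := hm
    exact hmul m n hn
  | add x hx y hy h h' => exact hadd x y h h'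

lemma mem_grFil_zero (x : Gr q) : x ∈ grFil q 0 := by
  rw [grFil, pow_zero, one_mul]; trivial

lemma sub_aug_mem (x : Gr q) : x - algebraMap ℝ _ (aug x) ∈ grFil q 1 := by
  induction x using gr_induction with
  | h0 r => rw [aug_algebraMap, sub_self]; exact Submodule.zero_mem _
  | hadd x y hx hy =>
    rw [map_add, map_add, add_sub_add_comm]
    exact Submodule.add_mem _ hx hy
  | hmul x m hx =>
    rw [map_mul, aug_ι, zero_mul, map_zero, sub_zero]
    exact ι_mul_mem_grFil m (mem_grFil_zero x)

lemma mul_mem_grFil {k l : ℕ} {x y : Gr q} (hx : x ∈ grFil q k) (hy : y ∈ grFil q l) :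
    x * y ∈ grFil q (k + l) := by
  -- The filtration is defined by right ideals, but it is also stable under multiplication from the
  -- left. For a left factor `ι m * x`, the element `y` is first demoted by one degree, `x * y` is
  -- handled in that degree, and `ι m` in front restores what was lost.
  have comm : ∀ (y : Gr q) (l : ℕ), y ∈ grFil q l → ∀ x : Gr q, x * y ∈ grFil q l := by
    intro y l hy x
    induction l generalizing y x with
    | zero => exact mem_grFil_zero _
    | succ l ih =>
      induction x using gr_induction generalizing y with
      | h0 r => rw [← Algebra.smul_def]; exact Submodule.smul_mem _ _ hy
      | hadd x x' h h' => rw [add_mul]; exact Submodule.add_mem _ (h y hy) (h' y hy)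
      | hmul x m h =>
        rw [mul_assoc]
        refine ι_mul_mem_grFil m (ih _ ?_ x)
        have mono : grFil q (l + 1) ≤ grFil q l := by
          rw [grFil, pow_succ, mul_assoc]
          exact mul_le_mul' le_rfl le_top
        exact mono hy
  induction k generalizing x with
  | zero => rw [zero_add]; exact comm y l hy x
  | succ k ih =>
    refine grFil_succ_induction (P := fun x => x * y ∈ grFil q (k + 1 + l)) (fun x x' h h' => ?_) (fun m x h => ?_) hx
    · rw [add_mul]; exact Submodule.add_mem _ h h'
    · rw [mul_assoc, add_right_comm]
      exact ι_mul_mem_grFil m (ih h)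

lemma pow_mem_grFil {k : ℕ} {x : Gr q} (hx : x ∈ grFil q k) (n : ℕ) : x ^ n ∈ grFil q (n * k) := by
  induction n with
  | zero => simpa using mem_grFil_zero _
  | succ n ih =>
    rw [pow_succ, add_mul, one_mul]
    exact mul_mem_grFil ih hx

/-- More than `q` vectors of `ℝ^q` are linearly dependent, so their exterior product vanishes. -/
lemma grFil_eq_bot {k : ℕ} (h : q < k) : grFil q k = ⊥ := by
  have : LinearMap.range (ExteriorAlgebra.ι ℝ (M := Fin q → ℝ)) ^ k = ⊥ := by
    have := ExteriorAlgebra.ιMulti_span_fixedDegree ℝ k (M := Fin q → ℝ)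
    change ⋀[ℝ]^k (Fin q → ℝ) = ⊥
    rw [← this, Submodule.span_eq_bot]
    rintro _ ⟨v, rfl⟩
    apply AlternatingMap.map_linearDependent
    intro hli
    have := hli.fintype_card_le_finrank
    simp at this
    omega
  rw [grFil, this, Submodule.bot_mul]

lemma pow_eq_zero_of_aug {x : Gr q} (hx : aug x = 0) : x ^ (q + 1) = 0 := by
  have h := sub_aug_mem x
  rw [hx, map_zero, sub_zero] at h
  have := pow_mem_grFil h (q + 1)
  rwa [grFil_eq_bot (by omega), Submodule.mem_bot] at this

/-- Even elements arise from scalars by multiplying with pairs of vectors, so the non-constant part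
starts in degree two. This doubles the degree of powers and makes the `q`-th power vanish already
(for `q ≠ 0`), where the general bound gives only the `(q+1)`-st; the Taylor sums truncated at `q`
depend on it. -/
lemma even_mem_grFil_two {x : Gr q} (he : x ∈ GrPart q 0) :
    x - algebraMap ℝ _ (aug x) ∈ grFil q 2 := by
  induction x, he using CliffordAlgebra.even_induction with
  | algebraMap r => erw [aug_algebraMap]; erw [sub_self]; exact Submodule.zero_mem _
  | add x y hx hy h h' =>
    rw [map_add, map_add, add_sub_add_comm]
    exact Submodule.add_mem _ h h'
  | ι_mul_ι_mul m n x hx h =>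
    have e : aug (ExteriorAlgebra.ι ℝ m * ExteriorAlgebra.ι ℝ n * x) = 0 := by
      rw [map_mul, map_mul, aug_ι, zero_mul, zero_mul]
    erw [e]
    rw [map_zero, sub_zero, mul_assoc]
    exact ι_mul_mem_grFil m (ι_mul_mem_grFil n (mem_grFil_zero x))

lemma even_pow_eq_zero {x : Gr q} (he : x ∈ GrPart q 0) (hx : aug x = 0) {n : ℕ} (hn : n ≠ 0)
    (hq : q ≤ n) : x ^ n = 0 := by
  have h := even_mem_grFil_two he
  rw [hx, map_zero, sub_zero] at h
  have := pow_mem_grFil h n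
  rwa [grFil_eq_bot (by omega), Submodule.mem_bot] at this

/-- The number operator `∑ ξ^b ∂_b` of the Grassmann algebra. -/
noncomputable def numOp (x : Gr q) : Gr q :=
  ∑ b : Fin q, ExteriorAlgebra.ι ℝ (Pi.single b 1) * contr b x

lemma numOp_ι_mul (m : Fin q → ℝ) (x : Gr q) :
    numOp (ExteriorAlgebra.ι ℝ m * x) = ExteriorAlgebra.ι ℝ m * x + ExteriorAlgebra.ι ℝ m * numOp x := by
  have hm : ExteriorAlgebra.ι ℝ m = ∑ b, m b • ExteriorAlgebra.ι ℝ (Pi.single b (1 : ℝ)) := by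
    conv_lhs => rw [← Finset.univ_sum_single m]
    rw [map_sum]
    refine Finset.sum_congr rfl fun b _ => ?_
    rw [← map_smul]
    congr 1
    ext i
    simp [Pi.single_apply]
  have h : ∀ b : Fin q, ExteriorAlgebra.ι ℝ (Pi.single b (1 : ℝ)) * ExteriorAlgebra.ι ℝ m =
      - (ExteriorAlgebra.ι ℝ m * ExteriorAlgebra.ι ℝ (Pi.single b (1 : ℝ))) := fun b =>
    eq_neg_of_add_eq_zero_left (ExteriorAlgebra.ι_add_mul_swap _ _)
  have h2 : ExteriorAlgebra.ι ℝ m * x =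
      ∑ b, m b • (ExteriorAlgebra.ι ℝ (Pi.single b (1 : ℝ)) * x) := by
    conv_lhs => rw [hm, Finset.sum_mul]
    simp
  trans (∑ b, m b • (ExteriorAlgebra.ι ℝ (Pi.single b (1 : ℝ)) * x)) +
    ExteriorAlgebra.ι ℝ m * numOp x
  swap
  · rw [h2]
  simp only [numOp, contr_ι_mul, mul_sub, ← mul_assoc, h, neg_mul,
    sub_neg_eq_add, Finset.mul_sum, mul_smul_comm, Finset.sum_add_distrib]

/-- Euler's identity for the number operator, up to terms of higher degree. Each vector split off on
the left contributes one copy of the element. -/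
lemma numOp_sub_mem {k : ℕ} {x : Gr q} (hx : x ∈ grFil q k) :
    numOp x - (k : ℝ) • x ∈ grFil q (k + 1) := by
  induction k generalizing x with
  | zero =>
    simp only [Nat.cast_zero, zero_smul, sub_zero, numOp]
    exact Submodule.sum_mem _ fun b _ => ι_mul_mem_grFil _ (mem_grFil_zero _)
  | succ k ih =>
    refine grFil_succ_induction
      (P := fun x => numOp x - ((k + 1 : ℕ) : ℝ) • x ∈ grFil q (k + 1 + 1)) (fun x y h h' => ?_) (fun m x h => ?_) hx
    · have : numOp (x + y) = numOp x + numOp y := by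
        simp [numOp, mul_add, Finset.sum_add_distrib]
      rw [this, smul_add, add_sub_add_comm]
      exact Submodule.add_mem _ h h'
    · rw [numOp_ι_mul]
      have : ExteriorAlgebra.ι ℝ m * x + ExteriorAlgebra.ι ℝ m * numOp x -
          ((k + 1 : ℕ) : ℝ) • (ExteriorAlgebra.ι ℝ m * x) =
          ExteriorAlgebra.ι ℝ m * (numOp x - (k : ℝ) • x) := by
        rw [mul_sub, mul_smul_comm]
        push_cast
        module
      rw [this]
      exact ι_mul_mem_grFil m (ih h)

/-- The difference `y` from the constant term is killed by the number operator. By Euler's identity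
a nonzero multiple of `y` lies one degree higher than `y` is known to lie, so `y` climbs through the
filtration until the filtration is zero. -/
lemma eq_algebraMap_of_contr_eq_zero {x : Gr q} (h : ∀ b, contr b x = 0) :
    x = algebraMap ℝ _ (aug x) := by
  set y := x - algebraMap ℝ _ (aug x) with hy
  have hc : numOp y = 0 := by
    simp [numOp, hy, h, contr_algebraMap]
  have hk : ∀ k : ℕ, y ∈ grFil q (k + 1) := by
    intro k
    induction k with
    | zero => exact sub_aug_mem x
    | succ k ih =>
      have := numOp_sub_mem ih
      rw [hc, zero_sub, Submodule.neg_mem_iff] at this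
      exact (Submodule.smul_mem_iff _ (by positivity)).1 this
  have := hk q
  rw [grFil_eq_bot (by omega), Submodule.mem_bot] at this
  exact sub_eq_zero.1 this

end Grassmann

end SuperDensity

namespace SuperDensity

/-! ### Smooth functions in coordinates -/

/-! ### Differentiation under the integral and Hadamard's lemma. -/

section Hadamard

variable {E : Type} [NormedAddCommGroup E] [NormedSpace ℝ E] [FiniteDimensional ℝ E]

/-- Differentiation under the integral sign, dominated by a bound on the compact set `[0,1] ×
closedBall y 1`, gives a parametric integral of the same kind with operator values. This is why the
target `F` varies in the induction. -/
lemma contDiff_parametric_integral (n : ℕ) {F : Type} [NormedAddCommGroup F] [NormedSpace ℝ F]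
    [CompleteSpace F] (k : ℝ × E → F) (hk : ContDiff ℝ ∞ k) :
    ContDiff ℝ n (fun y => ∫ t in (0 : ℝ)..1, k (t, y)) := by
  have : ProperSpace E := FiniteDimensional.proper ℝ E
  induction n generalizing F with
  | zero =>
    rw [Nat.cast_zero, contDiff_zero]
    exact intervalIntegral.continuous_parametric_intervalIntegral_of_continuous'
      (f := fun y t => k (t, y)) (hk.continuous.comp continuous_swap) 0 1
  | succ n ih =>
    set k' : ℝ × E → (E →L[ℝ] F) := fun z => (fderiv ℝ k z).comp (ContinuousLinearMap.inr ℝ ℝ E)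
      with hk'
    have hk's : ContDiff ℝ ∞ k' := (hk.fderiv_right (m := ∞) le_rfl).clm_comp contDiff_const
    have hd : ∀ y t, HasFDerivAt (fun y => k (t, y)) (k' (t, y)) y := fun y t =>
      ((hk.differentiable (by simp)) (t, y)).hasFDerivAt.comp y (hasFDerivAt_prodMk_right t y)
    have hD : ∀ y, HasFDerivAt (fun y => ∫ t in (0 : ℝ)..1, k (t, y))
        (∫ t in (0 : ℝ)..1, k' (t, y)) y := by
      intro y
      obtain ⟨C, hC⟩ := ((isCompact_Icc (a := (0 : ℝ)) (b := 1)).prod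
        (isCompact_closedBall y 1)).exists_bound_of_continuousOn hk's.continuous.continuousOn
      refine (intervalIntegral.hasFDerivAt_integral_of_dominated_of_fderiv_le
        (F := fun y t => k (t, y)) (F' := fun y t => k' (t, y)) (bound := fun _ => C)
        (Metric.ball_mem_nhds y one_pos) ?_ ?_ ?_ ?_ ?_ ?_)
      · exact Filter.Eventually.of_forall fun z =>
          (hk.continuous.comp (by fun_prop : Continuous fun t : ℝ => (t, z))).aestronglyMeasurable
      · exact (hk.continuous.comp
          (by fun_prop : Continuous fun t : ℝ => (t, y))).intervalIntegrable _ _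
      · exact (hk's.continuous.comp
          (by fun_prop : Continuous fun t : ℝ => (t, y))).aestronglyMeasurable
      · refine Filter.Eventually.of_forall fun t ht z hz => hC (t, z) ⟨?_, ?_⟩
        · rw [Set.uIoc_of_le zero_le_one] at ht
          exact ⟨ht.1.le, ht.2⟩
        · exact Metric.ball_subset_closedBall hz
      · exact intervalIntegrable_const
      · exact Filter.Eventually.of_forall fun t _ z _ => hd z t
    rw [Nat.cast_succ, contDiff_succ_iff_fderiv]
    refine ⟨fun y => (hD y).differentiableAt, by simp, ?_⟩
    have : fderiv ℝ (fun y => ∫ t in (0 : ℝ)..1, k (t, y)) = fun y => ∫ t in (0 : ℝ)..1, k' (t, y) :=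
      funext fun y => (hD y).fderiv
    rw [this]
    exact ih k' hk's

/-- The fundamental theorem of calculus along the segment from `y₀` to `y`; the factors are the
integrals of the partial derivatives over the segment. -/
lemma hadamard_global {p : ℕ} (g : (Fin p → ℝ) → ℝ) (hg : ContDiff ℝ ∞ g) (y₀ : Fin p → ℝ) :
    ∃ h : Fin p → (Fin p → ℝ) → ℝ, (∀ b, ContDiff ℝ ∞ (h b)) ∧
      ∀ y, g y = g y₀ + ∑ b, (y b - y₀ b) * h b y := by
  have hg' : ContDiff ℝ ∞ (fderiv ℝ g) := hg.fderiv_right (m := ∞) le_rfl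
  let k : Fin p → ℝ × (Fin p → ℝ) → ℝ := fun b z =>
    fderiv ℝ g (y₀ + z.1 • (z.2 - y₀)) (Pi.single b 1)
  have hk : ∀ b, ContDiff ℝ ∞ (k b) := fun b =>
    (hg'.comp (by fun_prop : ContDiff ℝ ∞ fun z : ℝ × (Fin p → ℝ) =>
      y₀ + z.1 • (z.2 - y₀))).clm_apply contDiff_const
  refine ⟨fun b y => ∫ t in (0 : ℝ)..1, k b (t, y), fun b => contDiff_infty.2 fun n =>
    contDiff_parametric_integral n (k b) (hk b), fun y => ?_⟩
  have hc : ∀ b, Continuous fun t : ℝ => k b (t, y) := fun b =>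
    (hk b).continuous.comp (by fun_prop)
  have hderiv : ∀ t : ℝ, HasDerivAt (fun t : ℝ => g (y₀ + t • (y - y₀)))
      (∑ b, (y b - y₀ b) * k b (t, y)) t := by
    intro t
    have h1 : HasDerivAt (fun t : ℝ => y₀ + t • (y - y₀)) (y - y₀) t := by
      simpa using ((hasDerivAt_id t).smul_const (y - y₀)).const_add y₀
    have h2 := ((hg.differentiable (by simp)) (y₀ + t • (y - y₀))).hasFDerivAt.comp_hasDerivAt t h1
    have hsum : y - y₀ = ∑ b, Pi.single b ((y - y₀) b) := (Finset.univ_sum_single _).symm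
    have h3 := congrArg (fderiv ℝ g (y₀ + t • (y - y₀))) hsum
    rw [map_sum] at h3
    refine h2.congr_deriv (h3.trans ?_)
    refine Finset.sum_congr rfl fun b _ => ?_
    have : (Pi.single b ((y - y₀) b) : Fin p → ℝ) = (y b - y₀ b) • Pi.single b 1 := by
      ext i; simp [Pi.single_apply]
    rw [this, map_smul, smul_eq_mul]
  have := intervalIntegral.integral_eq_sub_of_hasDerivAt (a := 0) (b := 1)
    (fun t _ => hderiv t) (Continuous.intervalIntegrable (by fun_prop) _ _)
  rw [intervalIntegral.integral_finsetSum
    (fun b _ => Continuous.intervalIntegrable (by fun_prop) _ _)] at this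
  simp only [intervalIntegral.integral_const_mul, one_smul, zero_smul, add_zero,
    add_sub_cancel] at this
  linarith

/-- A bump function equal to 1 near `y₀` and supported in `s` reduces this to a globally smooth
function, at the price of shrinking the neighbourhood to the set where the bump is 1. -/
lemma hadamard {p : ℕ} (g : (Fin p → ℝ) → ℝ) {s : Set (Fin p → ℝ)} (hs : IsOpen s)
    (hg : ContDiffOn ℝ ∞ g s) {y₀ : Fin p → ℝ} (hy : y₀ ∈ s) :
    ∃ (t : Set (Fin p → ℝ)) (h : Fin p → (Fin p → ℝ) → ℝ), IsOpen t ∧ y₀ ∈ t ∧ t ⊆ s ∧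
      (∀ b, ContDiff ℝ ∞ (h b)) ∧ ∀ y ∈ t, g y = g y₀ + ∑ b, (y b - y₀ b) * h b y := by
  obtain ⟨φ, hφs, hφ, hφc, hφ1, hφ0⟩ : ∃ φ : (Fin p → ℝ) → ℝ, tsupport φ ⊆ s ∧ ContDiff ℝ ∞ φ ∧
      HasCompactSupport φ ∧ (∀ᶠ y in nhds y₀, φ y = 1) ∧ True := by
    obtain ⟨r, hr, hrs⟩ := Metric.isOpen_iff.1 hs y₀ hy
    let B : ContDiffBump y₀ := ⟨r / 4, r / 2, by positivity, by linarith⟩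
    refine ⟨B, ?_, B.contDiff, B.hasCompactSupport, B.eventuallyEq_one, trivial⟩
    rw [B.tsupport_eq]
    exact (Metric.closedBall_subset_ball (by simp [B]; linarith)).trans hrs
  have hG : ContDiff ℝ ∞ (fun y => φ y * g y) := by
    rw [contDiff_iff_contDiffAt]
    intro y
    by_cases h : y ∈ tsupport φ
    · exact hφ.contDiffAt.mul (hg.contDiffAt (hs.mem_nhds (hφs h)))
    · refine (contDiffAt_const (c := (0 : ℝ))).congr_of_eventuallyEq ?_
      filter_upwards [notMem_tsupport_iff_eventuallyEq.1 h] with z hz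
      rw [hz]; simp
  obtain ⟨h, hh, hhe⟩ := hadamard_global _ hG y₀
  obtain ⟨t, ht, hto, hyt⟩ := eventually_nhds_iff.1 (hφ1.and (hs.mem_nhds hy))
  refine ⟨t, h, hto, hyt, fun y hy => (ht y hy).2, hh, fun y hy => ?_⟩
  have := hhe y
  simp only [(ht y hy).1, (ht y₀ hyt).1, one_mul] at this
  exact this

end Hadamard

/-! ### Coordinate derivatives of smooth functions and evaluation at points. -/

section Smooth

variable {X : Type u} [TopologicalSpace X] {p : ℕ} (x : X → Fin p → ℝ)

lemma smoothPd_apply {U : Opens X} (hx : IsOpen (x '' (U : Set X))) (a : Fin p)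
    (f : smoothFun x U) {g : (Fin p → ℝ) → ℝ} (hf : ∀ u : U, f.1 u = g (x u)) (u : U) :
    (smoothPd x U hx a f).1 u = fderiv ℝ g (x u) (Pi.single a 1) := by
  have := smoothPd_aux x U hx (g := Classical.choose f.2) (g' := g) (fun v => by
    rw [← (Classical.choose_spec f.2).2 v]; exact hf v) u
  exact congrArg (fun l => l (Pi.single a 1)) this

lemma smoothFun_rep {U : Opens X} (hx : IsOpen (x '' (U : Set X))) (f : smoothFun x U) :
    ∃ g : (Fin p → ℝ) → ℝ, ContDiffOn ℝ ∞ g (x '' (U : Set X)) ∧ (∀ u : U, f.1 u = g (x u)) ∧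
      ∀ u : U, DifferentiableAt ℝ g (x u) := by
  obtain ⟨g, hg, hf⟩ := f.2
  exact ⟨g, hg, hf, fun u => (hg.contDiffAt (hx.mem_nhds ⟨u.1, u.2, rfl⟩)).differentiableAt
    (by simp)⟩

lemma smoothPd_mul {U : Opens X} (hx : IsOpen (x '' (U : Set X))) (a : Fin p)
    (f f' : smoothFun x U) :
    smoothPd x U hx a (f * f') = smoothPd x U hx a f * f' + f * smoothPd x U hx a f' := by
  obtain ⟨g, hg, hf, hd⟩ := smoothFun_rep x hx f
  obtain ⟨g', hg', hf', hd'⟩ := smoothFun_rep x hx f'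
  ext u
  rw [smoothPd_apply x hx a (f * f') (g := g * g') (fun v => by simp [← hf, ← hf'])]
  rw [fderiv_mul (hd u) (hd' u)]
  have h1 := smoothPd_apply x hx a f hf u
  have h2 := smoothPd_apply x hx a f' hf' u
  simp only [Subalgebra.coe_add, Subalgebra.coe_mul, Pi.add_apply, Pi.mul_apply, h1, h2, hf, hf']
  simp [mul_comm, add_comm]

lemma smoothPd_comp {U : Opens X} (hx : IsOpen (x '' (U : Set X))) (a : Fin p)
    (f f' : smoothFun x U) (φ φ' : ℝ → ℝ) (hφ : ∀ u, HasDerivAt φ (φ' (f.1 u)) (f.1 u))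
    (hf' : ∀ u, f'.1 u = φ (f.1 u)) (u : U) :
    (smoothPd x U hx a f').1 u = φ' (f.1 u) * (smoothPd x U hx a f).1 u := by
  obtain ⟨g, hg, hf, hd⟩ := smoothFun_rep x hx f
  rw [smoothPd_apply x hx a f' (g := φ ∘ g) (fun v => by rw [hf', hf]; rfl),
    smoothPd_apply x hx a f hf u]
  have h := hφ u
  rw [hf] at h ⊢
  have := (h.comp_hasFDerivAt _ (hd u).hasFDerivAt).fderiv
  rw [this]
  simp

lemma smoothPd_comm {U : Opens X} (hx : IsOpen (x '' (U : Set X))) (a b : Fin p)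
    (f : smoothFun x U) :
    smoothPd x U hx a (smoothPd x U hx b f) = smoothPd x U hx b (smoothPd x U hx a f) := by
  obtain ⟨g, hg, hf, hd⟩ := smoothFun_rep x hx f
  ext u
  have hu : x u ∈ x '' (U : Set X) := ⟨u.1, u.2, rfl⟩
  have hd2 : DifferentiableAt ℝ (fderiv ℝ g) (x u) :=
    (((hg.fderiv_of_isOpen hx (m := ∞) le_rfl).contDiffAt (hx.mem_nhds hu))).differentiableAt
      (by simp)
  have h1 : ∀ a b, (smoothPd x U hx a (smoothPd x U hx b f)).1 u =
      fderiv ℝ (fderiv ℝ g) (x u) (Pi.single a 1) (Pi.single b 1) := by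
    intro a b
    rw [smoothPd_apply x hx a _ (g := fun y => fderiv ℝ g y (Pi.single b 1))
      (smoothPd_apply x hx b f hf)]
    rw [fderiv_clm_apply hd2 (by fun_prop)]
    simp
  rw [h1, h1]
  have : IsSymmSndFDerivAt ℝ g (x u) :=
    (hg.contDiffAt (hx.mem_nhds hu)).isSymmSndFDerivAt
      (by rw [minSmoothness_of_isRCLikeNormedField]; exact WithTop.coe_le_coe.2 le_top)
  exact this _ _

lemma smoothPd_coord {U : Opens X} (hx : IsOpen (x '' (U : Set X))) (a b : Fin p) :
    smoothPd x U hx a (smoothCoord x U b) = if a = b then 1 else 0 := by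
  ext u
  rw [smoothPd_apply x hx a _ (g := fun y => y b) (fun v => rfl)]
  have : fderiv ℝ (fun y : Fin p → ℝ => y b) (x u) = ContinuousLinearMap.proj b :=
    (ContinuousLinearMap.proj (R := ℝ) (φ := fun _ : Fin p => ℝ) b).fderiv
  rw [this]
  split_ifs with h
  · subst h; simp
  · simp [Ne.symm h]

lemma smoothPd_algebraMap {U : Opens X} (hx : IsOpen (x '' (U : Set X))) (a : Fin p) (r : ℝ) :
    smoothPd x U hx a (algebraMap ℝ _ r) = 0 := by
  ext u
  rw [smoothPd_apply x hx a _ (g := fun _ => r) (fun v => rfl)]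
  simp

lemma smoothPd_res {U V : Opens X} (h : U ≤ V) (hx : IsOpen (x '' (V : Set X)))
    (hx' : IsOpen (x '' (U : Set X))) (a : Fin p) (f : smoothFun x V) :
    smoothRes x h (smoothPd x V hx a f) = smoothPd x U hx' a (smoothRes x h f) := by
  obtain ⟨g, hg, hf, hd⟩ := smoothFun_rep x hx f
  ext u
  rw [smoothPd_apply x hx' a (smoothRes x h f) (g := g) (fun v => hf ⟨v.1, h v.2⟩)]
  exact smoothPd_apply x hx a f hf ⟨u.1, h u.2⟩

lemma comp_mem_smoothFun {U : Opens X} (f : smoothFun x U) {φ : ℝ → ℝ} {s : Set ℝ}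
    (hφ : ContDiffOn ℝ ∞ φ s) (hf : ∀ u, f.1 u ∈ s) :
    (fun u => φ (f.1 u)) ∈ smoothFun x U := by
  obtain ⟨g, hg, hfg⟩ := f.2
  refine ⟨fun y => φ (g y), hφ.comp hg ?_, fun u => congrArg φ (hfg u)⟩
  rintro _ ⟨u, hu, rfl⟩
  have := hf ⟨u, hu⟩
  rwa [hfg] at this

/-- The evaluation of smooth functions at a point. -/
def smoothEval {U : Opens X} (u : U) : smoothFun x U →ₐ[ℝ] ℝ :=
  (Pi.evalAlgHom ℝ (fun _ : U => ℝ) u).comp (smoothFun x U).val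

/-- Evaluation at a point of smooth functions with values in the Grassmann algebra. -/
noncomputable def grEval (q : ℕ) {U : Opens X} (u : U) : smoothFun x U ⊗[ℝ] Gr q →ₐ[ℝ] Gr q :=
  (Algebra.TensorProduct.lid ℝ (Gr q)).toAlgHom.comp
    (Algebra.TensorProduct.map (smoothEval x u) (AlgHom.id ℝ (Gr q)))

@[simp]
lemma grEval_tmul (q : ℕ) {U : Opens X} (u : U) (f : smoothFun x U) (l : Gr q) :
    grEval x q u (f ⊗ₜ l) = f.1 u • l := rfl

/-- In a basis of the Grassmann algebra the components of `t` are smooth functions, and their values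
at `u` are the components of the evaluation at `u`. -/
lemma grEval_ext (q : ℕ) {U : Opens X} {t : smoothFun x U ⊗[ℝ] Gr q}
    (h : ∀ u, grEval x q u t = 0) : t = 0 := by
  let b := Module.Free.chooseBasis ℝ (Gr q)
  classical
  let e := TensorProduct.equivFinsuppOfBasisRight (M := smoothFun x U) b
  have key : ∀ (u : U) (t : smoothFun x U ⊗[ℝ] Gr q) i,
      (e t i).1 u = b.repr (grEval x q u t) i := by
    intro u t i
    induction t with
    | zero =>
      rw [LinearEquiv.map_zero, map_zero, map_zero]
      rfl
    | add t t' h h' => rw [LinearEquiv.map_add, map_add, map_add, Finsupp.add_apply, Finsupp.add_apply, ← h, ← h']; rfl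
    | tmul f l =>
      simp only [e, TensorProduct.equivFinsuppOfBasisRight_apply_tmul_apply, grEval_tmul, map_smul,
        Finsupp.smul_apply]
      change (b.repr l i • f).1 u = _
      simp [mul_comm]
  apply e.injective
  rw [LinearEquiv.map_zero]
  ext i u
  rw [key, h]
  simp

end Smooth

end SuperDensity

namespace SuperDensity

/-! ### Signs and graded pieces -/

lemma sgn_zero : sgn 0 = 1 := by simp [sgn]

lemma sgn_one : sgn 1 = -1 := by simp [sgn]

lemma sgn_add (i j : ZMod 2) : sgn (i + j) = sgn i * sgn j := by
  have h : ∀ i : ZMod 2, i = 0 ∨ i = 1 := by decide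
  rcases h i with rfl | rfl <;> rcases h j with rfl | rfl <;>
    simp [sgn, show (1 : ZMod 2) + 1 = 0 from rfl]

lemma sgn_mul_self (i : ZMod 2) : sgn i * sgn i = 1 := by
  rw [← sgn_add, show i + i = 0 by revert i; decide, sgn_zero]

section Graded

variable {A : Type v} [Ring A] [Algebra ℝ A] (𝒜 : ZMod 2 → Submodule ℝ A) [GradedAlgebra 𝒜]

lemma eq_zero_of_mem_mem {i : ZMod 2} {s : A} (h : s ∈ 𝒜 i) (h' : s ∈ 𝒜 (i + 1)) : s = 0 := by
  by_contra hs
  have := DirectSum.degree_eq_of_mem_mem 𝒜 h h' hs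
  clear h h' hs
  revert this
  revert i
  decide

lemma exists_even_add_odd (s : A) : ∃ a ∈ 𝒜 0, ∃ b ∈ 𝒜 1, s = a + b := by
  refine ⟨_, SetLike.coe_mem (DirectSum.decompose 𝒜 s 0), _,
    SetLike.coe_mem (DirectSum.decompose 𝒜 s 1), ?_⟩
  classical
  conv_lhs => rw [← DirectSum.sum_support_decompose 𝒜 s]
  rw [Finset.sum_subset (Finset.subset_univ _)]
  · exact Fin.sum_univ_two (fun i : Fin 2 => ((DirectSum.decompose 𝒜 s) i : A))
  · intro i _ hi
    simpa using hi

lemma graded_induction {P : A → Prop} (hadd : ∀ a b, P a → P b → P (a + b))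
    (hom : ∀ i, ∀ a ∈ 𝒜 i, P a) (s : A) : P s := by
  obtain ⟨a, ha, b, hb, rfl⟩ := exists_even_add_odd 𝒜 s
  exact hadd _ _ (hom _ _ ha) (hom _ _ hb)

lemma graded_mul_mem {i j k : ZMod 2} {a b : A} (ha : a ∈ 𝒜 i) (hb : b ∈ 𝒜 j) (h : i + j = k) :
    a * b ∈ 𝒜 k := h ▸ SetLike.mul_mem_graded ha hb

end Graded

/-! ### Superfunctions in a chart: graded derivations, evaluation and the body. -/

namespace Coord

variable {X : Type u} [TopologicalSpace X] {O : SuperSheaf.{u, v} X} {p q : ℕ} {V : Opens X}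

/-- The isomorphism of the sections over the coordinate domain with the smooth functions with
values in the Grassmann algebra. -/
abbrev isoV (c : Coord O p q V) : (smoothFun c.x V ⊗[ℝ] Gr q) ≃ₐ[ℝ] O.sec V := c.iso V le_rfl

lemma induction (c : Coord O p q V) {P : O.sec V → Prop} (hadd : ∀ s t, P s → P t → P (s + t))
    (tmul : ∀ (f : smoothFun c.x V) (l : Gr q), P (c.isoV (f ⊗ₜ l))) (s : O.sec V) : P s := by
  obtain ⟨t, rfl⟩ := c.isoV.surjective s
  induction t with
  | zero =>
    have := tmul 0 0
    rwa [TensorProduct.zero_tmul] at this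
  | add t t' h h' => rw [map_add]; exact hadd _ _ h h'
  | tmul f l => exact tmul f l

/-- An arbitrary section is a sum of tensors with homogeneous Grassmann factors. If the section has
parity `i`, the total contribution of the factors of parity `i + 1` lies in both graded pieces and
is therefore zero. -/
lemma induction_gr (c : Coord O p q V) {i : ZMod 2} {P' : ∀ s : O.sec V, s ∈ O.gr V i → Prop}
    (hadd : ∀ s t hs ht, P' s hs → P' t ht → P' (s + t) (Submodule.add_mem _ hs ht))
    (tmul : ∀ (f : smoothFun c.x V) (l : Gr q) (hl : l ∈ GrPart q i),
      P' (c.isoV (f ⊗ₜ l)) (c.iso_gr V le_rfl i f l hl))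
    (s : O.sec V) (hs : s ∈ O.gr V i) : P' s hs := by
  set P : O.sec V → Prop := fun s => ∃ hs, P' s hs with hP
  replace hadd : ∀ s t, P s → P t → P (s + t) := fun s t ⟨h, h1⟩ ⟨h', h1'⟩ =>
    ⟨_, hadd s t h h' h1 h1'⟩
  replace tmul : ∀ (f : smoothFun c.x V), ∀ l ∈ GrPart q i, P (c.isoV (f ⊗ₜ l)) :=
    fun f l hl => ⟨_, tmul f l hl⟩
  suffices P s from this.2
  have h : ∀ s : O.sec V, ∃ a b, s = a + b ∧ P a ∧ a ∈ O.gr V i ∧ b ∈ O.gr V (i + 1) := by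
    intro s
    induction s using c.induction with
    | hadd s t h h' =>
      obtain ⟨a, b, rfl, h1, h2, h3⟩ := h
      obtain ⟨a', b', rfl, h1', h2', h3'⟩ := h'
      exact ⟨a + a', b + b', by abel, hadd _ _ h1 h1', Submodule.add_mem _ h2 h2',
        Submodule.add_mem _ h3 h3'⟩
    | tmul f l =>
      obtain ⟨l0, l1, rfl, h0, h1⟩ : ∃ l0 l1, l = l0 + l1 ∧ l0 ∈ GrPart q i ∧
          l1 ∈ GrPart q (i + 1) := by
        obtain ⟨a, ha, b, hb, rfl⟩ := exists_even_add_odd (GrPart q) l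
        have hi : i = 0 ∨ i = 1 := by clear * -; revert i; decide
        rcases hi with rfl | rfl
        · exact ⟨a, b, rfl, ha, hb⟩
        · exact ⟨b, a, add_comm _ _, hb, ha⟩
      rw [TensorProduct.tmul_add, map_add]
      exact ⟨_, _, rfl, tmul f l0 h0, c.iso_gr V le_rfl i f l0 h0, c.iso_gr V le_rfl _ f l1 h1⟩
  obtain ⟨a, b, rfl, h1, h2, h3⟩ := h s
  have hb : b = 0 := by
    refine eq_zero_of_mem_mem (O.gr V) ?_ h3
    have := Submodule.sub_mem _ hs h2
    rwa [add_sub_cancel_left] at this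
  rwa [hb, add_zero]

lemma pd_inl (c : Coord O p q V) (a : Fin p) (f : smoothFun c.x V) (l : Gr q) :
    c.pd (.inl a) (c.isoV (f ⊗ₜ l)) = c.isoV (smoothPd c.x V c.isOpen_image a f ⊗ₜ l) := by
  simp [pd, isoV]

lemma pd_inr (c : Coord O p q V) (b : Fin q) (f : smoothFun c.x V) (l : Gr q) :
    c.pd (.inr b) (c.isoV (f ⊗ₜ l)) = c.isoV (f ⊗ₜ contr b l) := by
  simp [pd, isoV, contr]

lemma pd_mem (c : Coord O p q V) (a : Idx p q) {i : ZMod 2} {s : O.sec V} (hs : s ∈ O.gr V i) :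
    c.pd a s ∈ O.gr V (i + par a) := by
  induction s, hs using c.induction_gr with
  | hadd s t _ _ h h' => rw [map_add]; exact Submodule.add_mem _ h h'
  | tmul f l hl =>
    cases a with
    | inl a =>
      rw [pd_inl]
      simpa [par] using c.iso_gr V le_rfl i _ l hl
    | inr b =>
      rw [pd_inr]
      exact c.iso_gr V le_rfl _ _ _ (contr_mem b hl)

lemma pd_mul (c : Coord O p q V) (a : Idx p q) {i : ZMod 2} {s : O.sec V} (hs : s ∈ O.gr V i)
    (t : O.sec V) : c.pd a (s * t) = c.pd a s * t + sgn (par a * i) • (s * c.pd a t) := by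
  induction s, hs using c.induction_gr with
  | hadd s s' _ _ h h' => simp only [add_mul, map_add, h, h', smul_add]; abel
  | tmul f l hl =>
    induction t using c.induction with
    | hadd t t' h h' => simp only [mul_add, map_add, h, h', smul_add]; abel
    | tmul f' l' =>
      cases a with
      | inl a =>
        rw [← map_mul, Algebra.TensorProduct.tmul_mul_tmul, pd_inl, pd_inl, pd_inl, smoothPd_mul,
          ← map_mul, ← map_mul, Algebra.TensorProduct.tmul_mul_tmul,
          Algebra.TensorProduct.tmul_mul_tmul, TensorProduct.add_tmul, map_add]
        simp [par, sgn_zero]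
      | inr b =>
        rw [← map_mul, Algebra.TensorProduct.tmul_mul_tmul, pd_inr, pd_inr, pd_inr, contr_mul,
          involute_eq_sgn hl,
          ← map_mul, ← map_mul, Algebra.TensorProduct.tmul_mul_tmul,
          Algebra.TensorProduct.tmul_mul_tmul, TensorProduct.tmul_add, map_add, ← map_smul]
        congr 2
        rw [smul_mul_assoc, TensorProduct.tmul_smul]
        simp [par]

lemma pd_comm (c : Coord O p q V) (a b : Idx p q) (s : O.sec V) :
    c.pd a (c.pd b s) = sgn (par a * par b) • c.pd b (c.pd a s) := by
  induction s using c.induction with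
  | hadd s t h h' => simp only [map_add, h, h', smul_add]
  | tmul f l =>
    cases a with
    | inl a =>
      cases b with
      | inl b => simp only [pd_inl, smoothPd_comm c.x c.isOpen_image a b, par, Sum.elim_inl,
          mul_zero, sgn_zero, one_smul]
      | inr b => simp only [pd_inl, pd_inr, par, Sum.elim_inl, zero_mul, sgn_zero, one_smul]
    | inr a =>
      cases b with
      | inl b => simp only [pd_inl, pd_inr, par, Sum.elim_inl, mul_zero, sgn_zero, one_smul]
      | inr b =>
        simp only [pd_inr, contr_comm a b, par, Sum.elim_inr, mul_one, sgn_one]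
        rw [← neg_one_smul ℝ (contr b _), TensorProduct.tmul_smul, map_smul]

lemma coord_mem (c : Coord O p q V) (a : Idx p q) : c.coord a ∈ O.gr V (par a) := by
  cases a with
  | inl a => exact c.iso_gr V le_rfl 0 _ _ one_mem_grPart
  | inr b => exact c.iso_gr V le_rfl 1 _ _ (ι_mem_grPart _)

lemma pd_coord (c : Coord O p q V) (a b : Idx p q) :
    c.pd a (c.coord b) = if a = b then 1 else 0 := by
  cases a with
  | inl a =>
    cases b with
    | inl b =>
      rw [coord, pd_inl, smoothPd_coord]
      simp only [Sum.inl.injEq]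
      split_ifs
      · exact map_one _
      · rw [TensorProduct.zero_tmul, map_zero]
    | inr b =>
      have : smoothPd c.x V c.isOpen_image a 1 = 0 := by
        rw [← map_one (algebraMap ℝ _), smoothPd_algebraMap]
      rw [coord, pd_inl, this, TensorProduct.zero_tmul, map_zero, if_neg (by simp)]
  | inr a =>
    cases b with
    | inl b =>
      rw [coord, pd_inr, contr_one, TensorProduct.tmul_zero, map_zero, if_neg (by simp)]
    | inr b =>
      rw [coord, pd_inr, contr_ι]
      simp only [Sum.inr.injEq, Pi.single_apply]
      split_ifs
      · rw [map_one]; exact map_one _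
      · rw [map_zero, TensorProduct.tmul_zero, map_zero]

lemma pd_algebraMap (c : Coord O p q V) (a : Idx p q) (r : ℝ) :
    c.pd a (algebraMap ℝ _ r) = 0 := by
  have h : (algebraMap ℝ (O.sec V) r) = c.isoV (algebraMap ℝ _ r ⊗ₜ 1) := by
    rw [← c.isoV.commutes]; rfl
  rw [h]
  cases a with
  | inl a => rw [pd_inl, smoothPd_algebraMap, TensorProduct.zero_tmul, map_zero]
  | inr b => rw [pd_inr, contr_one, TensorProduct.tmul_zero, map_zero]

lemma pd_one (c : Coord O p q V) (a : Idx p q) : c.pd a 1 = 0 := by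
  rw [← map_one (algebraMap ℝ _), pd_algebraMap]

lemma res_iso (c : Coord O p q V) {U : Opens X} (h : U ≤ V) (f : smoothFun c.x V) (l : Gr q) :
    O.res h (c.isoV (f ⊗ₜ l)) = (c.restrict h).isoV (smoothRes c.x h f ⊗ₜ l) :=
  c.iso_res V U le_rfl h f l

lemma res_pd (c : Coord O p q V) {U : Opens X} (h : U ≤ V) (a : Idx p q) (s : O.sec V) :
    O.res h (c.pd a s) = (c.restrict h).pd a (O.res h s) := by
  induction s using c.induction with
  | hadd s t h h' => simp only [map_add, h, h']
  | tmul f l =>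
    cases a with
    | inl a =>
      rw [pd_inl, res_iso, res_iso, smoothPd_res c.x h _ (c.restrict h).isOpen_image]
      exact ((c.restrict h).pd_inl a _ l).symm
    | inr b =>
      rw [pd_inr, res_iso, res_iso]
      exact ((c.restrict h).pd_inr b _ l).symm

lemma res_coord (c : Coord O p q V) {U : Opens X} (h : U ≤ V) (a : Idx p q) :
    O.res h (c.coord a) = (c.restrict h).coord a := by
  cases a with
  | inl a => exact c.res_iso h _ _
  | inr b => exact c.res_iso h _ _

/-! #### Evaluation at points -/

/-- The value of a superfunction at a point, in the Grassmann algebra. -/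
noncomputable def ev (c : Coord O p q V) (u : V) : O.sec V →ₐ[ℝ] Gr q :=
  (grEval c.x q u).comp (c.isoV.symm : O.sec V →ₐ[ℝ] _)

lemma ev_iso (c : Coord O p q V) (u : V) (f : smoothFun c.x V) (l : Gr q) :
    c.ev u (c.isoV (f ⊗ₜ l)) = f.1 u • l := by
  simp [ev]

lemma ev_ext (c : Coord O p q V) {s t : O.sec V} (h : ∀ u, c.ev u s = c.ev u t) : s = t := by
  rw [← sub_eq_zero]
  apply c.isoV.symm.injective
  rw [map_zero]
  refine grEval_ext c.x q fun u => ?_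
  change c.ev u (s - t) = 0
  rw [map_sub, sub_eq_zero]
  exact h u

lemma ev_res (c : Coord O p q V) {U : Opens X} (h : U ≤ V) (u : U) (s : O.sec V) :
    (c.restrict h).ev u (O.res h s) = c.ev ⟨u.1, h u.2⟩ s := by
  induction s using c.induction with
  | hadd s t h h' => simp only [map_add, h, h']
  | tmul f l =>
    rw [res_iso, ev_iso]
    exact (c.restrict h).ev_iso _ _ _

lemma ev_mem (c : Coord O p q V) (u : V) {i : ZMod 2} {s : O.sec V} (hs : s ∈ O.gr V i) :
    c.ev u s ∈ GrPart q i := by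
  induction s, hs using c.induction_gr with
  | hadd s t _ _ h h' => rw [map_add]; exact Submodule.add_mem _ h h'
  | tmul f l hl => rw [ev_iso]; exact Submodule.smul_mem _ _ hl

lemma ev_pd_inr (c : Coord O p q V) (u : V) (b : Fin q) (s : O.sec V) :
    c.ev u (c.pd (.inr b) s) = contr b (c.ev u s) := by
  induction s using c.induction with
  | hadd s t h h' => simp only [map_add, h, h']
  | tmul f l => rw [pd_inr, ev_iso, ev_iso, map_smul]

/-- The body of a superfunction as a function on the underlying space. -/
noncomputable def bodyFun (c : Coord O p q V) : O.sec V →ₐ[ℝ] (V → ℝ) :=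
  AlgHom.pi fun u => aug.comp (c.ev u)

lemma bodyFun_apply (c : Coord O p q V) (s : O.sec V) (u : V) :
    c.bodyFun s u = aug (c.ev u s) := rfl

lemma body_eq (c : Coord O p q V) (s : O.sec V) : (c.body s).1 = c.bodyFun s := by
  ext u
  induction s using c.induction with
  | hadd s t h h' =>
    rw [map_add, Pi.add_apply, ← h, ← h']
    simp [body]
  | tmul f l =>
    rw [bodyFun_apply, ev_iso, map_smul]
    simp [body, isoV, mul_comm]

lemma bodyFun_iso (c : Coord O p q V) (f : smoothFun c.x V) (l : Gr q) (u : V) :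
    c.bodyFun (c.isoV (f ⊗ₜ l)) u = f.1 u * aug l := by
  rw [bodyFun_apply, ev_iso, map_smul, smul_eq_mul]

lemma bodyFun_res (c : Coord O p q V) {U : Opens X} (h : U ≤ V) (s : O.sec V) (u : U) :
    (c.restrict h).bodyFun (O.res h s) u = c.bodyFun s ⟨u.1, h u.2⟩ := by
  rw [bodyFun_apply, bodyFun_apply, ev_res]

lemma pow_eq_zero_of_bodyFun (c : Coord O p q V) {s : O.sec V} (hs : c.bodyFun s = 0) :
    s ^ (q + 1) = 0 :=
  c.ev_ext fun u => by
    rw [map_pow, map_zero]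
    exact pow_eq_zero_of_aug (congrFun hs u)

lemma smoothFun_continuous (c : Coord O p q V) (f : smoothFun c.x V) : Continuous f.1 := by
  obtain ⟨g, hg, hf⟩ := f.2
  have : f.1 = fun u : V => g (c.x u) := funext hf
  rw [this]
  exact hg.continuousOn.comp_continuous c.isOpenEmbedding.continuous fun u => ⟨u.1, u.2, rfl⟩

lemma bodyFun_continuous (c : Coord O p q V) (s : O.sec V) : Continuous (c.bodyFun s) := by
  rw [← body_eq]
  exact c.smoothFun_continuous _

/-- A smooth function as a superfunction. -/
noncomputable def emb (c : Coord O p q V) : smoothFun c.x V →ₐ[ℝ] O.sec V :=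
  (c.isoV : (smoothFun c.x V ⊗[ℝ] Gr q) →ₐ[ℝ] O.sec V).comp Algebra.TensorProduct.includeLeft

lemma emb_apply (c : Coord O p q V) (f : smoothFun c.x V) : c.emb f = c.isoV (f ⊗ₜ 1) := rfl

lemma emb_mem (c : Coord O p q V) (f : smoothFun c.x V) : c.emb f ∈ O.gr V 0 :=
  c.iso_gr V le_rfl 0 f 1 one_mem_grPart

lemma bodyFun_emb (c : Coord O p q V) (f : smoothFun c.x V) : c.bodyFun (c.emb f) = f.1 := by
  ext u
  rw [emb_apply, bodyFun_iso, map_one, mul_one]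

lemma even_commute {s : O.sec V} (hs : s ∈ O.gr V 0) (t : O.sec V) : Commute s t := by
  induction t using graded_induction (O.gr V) with
  | hadd a b h h' => exact h.add_right h'
  | hom i a ha =>
    have := O.supercomm V 0 i s a hs ha
    rwa [zero_mul, sgn_zero, one_smul] at this

/-- The body is an invertible smooth function, and `s` differs from it by a nilpotent that commutes
with it. -/
lemma isUnit_of_bodyFun_ne_zero (c : Coord O p q V) {s : O.sec V} (hs : ∀ u, c.bodyFun s u ≠ 0) :
    IsUnit s := by
  have hb : ∀ u, (c.body s).1 u ≠ 0 := fun u => by rw [body_eq]; exact hs u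
  have hinv := comp_mem_smoothFun c.x (c.body s) (φ := fun t => t⁻¹) (s := {0}ᶜ)
    (fun t ht => (contDiffAt_inv ℝ ht).contDiffWithinAt) hb
  have h1 : c.emb (c.body s) * c.emb ⟨_, hinv⟩ = 1 := by
    rw [← map_mul, ← map_one c.emb]
    congr 1
    ext u
    exact mul_inv_cancel₀ (hb u)
  have hu : IsUnit (c.emb (c.body s)) :=
    ⟨⟨_, _, h1, by rw [(even_commute (c.emb_mem _) _).eq] at h1; exact h1⟩, rfl⟩
  have hn : IsNilpotent (s - c.emb (c.body s)) :=
    ⟨q + 1, c.pow_eq_zero_of_bodyFun (by rw [map_sub, bodyFun_emb, body_eq, sub_self])⟩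
  have := hn.isUnit_add_left_of_commute hu ((even_commute (c.emb_mem _) _).symm)
  rwa [add_sub_cancel] at this

lemma bodyFun_ne_zero_of_isUnit (c : Coord O p q V) {s : O.sec V} (hs : IsUnit s) (u : V) :
    c.bodyFun s u ≠ 0 := by
  have := (hs.map c.bodyFun).map (Pi.evalRingHom (fun _ : V => ℝ) u)
  exact this.ne_zero

/-- Vanishing of the body is detected by invertibility, which does not refer to coordinates. If the
two bodies differed at a point, subtracting a constant would give a section that is invertible near
the point according to `c` while its body with respect to `c'` vanishes there. -/
lemma bodyFun_indep (c c' : Coord O p q V) : c.bodyFun = c'.bodyFun := by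
  ext s u
  by_contra hne
  set t := s - algebraMap ℝ _ (c'.bodyFun s u) with ht
  have h1 : c.bodyFun t u ≠ 0 := by
    rw [ht, map_sub, AlgHom.commutes]
    exact sub_ne_zero.2 hne
  have h2 : c'.bodyFun t u = 0 := by
    rw [ht, map_sub, AlgHom.commutes]
    exact sub_self _
  have hopen : IsOpen {v : V | c.bodyFun t v ≠ 0} :=
    isOpen_ne_fun (c.bodyFun_continuous t) continuous_const
  let W : Opens X := ⟨Subtype.val '' {v : V | c.bodyFun t v ≠ 0},
    V.isOpen.isOpenMap_subtype_val _ hopen⟩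
  have hW : W ≤ V := by
    rintro _ ⟨v, _, rfl⟩
    exact v.2
  have hu : u.1 ∈ W := ⟨u, h1, rfl⟩
  have hunit : IsUnit (O.res hW t) := by
    refine (c.restrict hW).isUnit_of_bodyFun_ne_zero fun v => ?_
    rw [bodyFun_res]
    obtain ⟨v', hv', e⟩ := v.2
    have : v' = ⟨v.1, hW v.2⟩ := Subtype.ext e
    rwa [← this]
  have := (c'.restrict hW).bodyFun_ne_zero_of_isUnit hunit ⟨u, hu⟩
  rw [bodyFun_res] at this
  exact this h2

end Coord

end SuperDensity

namespace SuperDensity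

namespace Coord

variable {X : Type u} [TopologicalSpace X] {O : SuperSheaf.{u, v} X} {p q : ℕ} {V : Opens X}

/-! #### The chain rule -/

/-- A graded derivation is determined by its values on the coordinates. On the Grassmann factor this
is induction on products of generators. For a smooth function one works at one point at a time: by
Hadamard's lemma it is, nearby, a constant plus a sum of products `(x^b - x^b(u)) F_b`, and after
applying `D` every term keeps a factor vanishing at `u`. Hadamard's lemma is local, so `D` has to be
given on all smaller open sets, compatibly with restriction. -/
lemma derivation_eq_zero (c : Coord O p q V) (d : ZMod 2)
    (D : ∀ W : Opens X, W ≤ V → (O.sec W →ₗ[ℝ] O.sec W))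
    (hmul : ∀ W h i (s t : O.sec W), s ∈ O.gr W i →
      D W h (s * t) = D W h s * t + sgn (d * i) • (s * D W h t))
    (hres : ∀ W h (s : O.sec V), O.res h (D V le_rfl s) = D W h (O.res h s))
    (hcoord : ∀ W h b, D W h ((c.restrict h).coord b) = 0) (s : O.sec V) :
    D V le_rfl s = 0 := by
  have hone : ∀ W : Opens X, (1 : O.sec W) ∈ O.gr W 0 := fun W => SetLike.one_mem_graded (O.gr W)
  have h1 : ∀ W h, D W h 1 = 0 := by
    intro W h
    have := hmul W h 0 1 1 (hone W)
    simpa [sgn_zero] using this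
  have halg : ∀ W h r, D W h (algebraMap ℝ _ r) = 0 := by
    intro W h r
    rw [Algebra.algebraMap_eq_smul_one, map_smul, h1, smul_zero]
  have hl : ∀ l : Gr q, D V le_rfl (c.isoV (1 ⊗ₜ l)) = 0 := by
    intro l
    induction l using gr_induction with
    | h0 r =>
      have : c.isoV (1 ⊗ₜ algebraMap ℝ (Gr q) r) = algebraMap ℝ _ r := by
        rw [← c.isoV.commutes, Algebra.algebraMap_eq_smul_one, TensorProduct.tmul_smul,
          Algebra.algebraMap_eq_smul_one]
        rfl
      rw [this, halg]
    | hadd x y hx hy => rw [TensorProduct.tmul_add, map_add, map_add, hx, hy, add_zero]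
    | hmul x m hx =>
      have e : c.isoV (1 ⊗ₜ (ExteriorAlgebra.ι ℝ m * x)) =
          c.isoV (1 ⊗ₜ ExteriorAlgebra.ι ℝ m) * c.isoV (1 ⊗ₜ x) := by
        rw [← map_mul, Algebra.TensorProduct.tmul_mul_tmul, one_mul]
      have hm : D V le_rfl (c.isoV (1 ⊗ₜ ExteriorAlgebra.ι ℝ m)) = 0 := by
        rw [← Finset.univ_sum_single m, map_sum, TensorProduct.tmul_sum, map_sum, map_sum]
        refine Finset.sum_eq_zero fun b _ => ?_
        have : (Pi.single b (m b) : Fin q → ℝ) = m b • Pi.single b 1 := by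
          ext i; simp [Pi.single_apply]
        rw [this, map_smul, TensorProduct.tmul_smul, map_smul, map_smul]
        have h2 := hcoord V le_rfl (.inr b)
        have h3 : (c.restrict le_rfl).coord (.inr b) =
          c.isoV (1 ⊗ₜ ExteriorAlgebra.ι ℝ (Pi.single b 1)) := rfl
        rw [h3] at h2
        rw [h2, smul_zero]
      rw [e, hmul V le_rfl 1 _ _ (c.iso_gr V le_rfl 1 _ _ (ι_mem_grPart m)), hm, hx, zero_mul,
        mul_zero, zero_add, smul_zero]
  have hf : ∀ f : smoothFun c.x V, D V le_rfl (c.emb f) = 0 := by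
    intro f
    refine c.ev_ext fun u => ?_
    rw [map_zero]
    obtain ⟨g, hg, hfg⟩ := f.2
    obtain ⟨t, k, ht, hut, -, hk, hgk⟩ := hadamard g c.isOpen_image hg
      (⟨u.1, u.2, rfl⟩ : c.x u ∈ c.x '' (V : Set X))
    let W : Opens X := ⟨Subtype.val '' {v : V | c.x v ∈ t},
      V.isOpen.isOpenMap_subtype_val _ (ht.preimage c.isOpenEmbedding.continuous)⟩
    have hW : W ≤ V := by
      rintro _ ⟨v, _, rfl⟩
      exact v.2
    have hWt : ∀ v : W, c.x v ∈ t := by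
      rintro ⟨_, v, hv, rfl⟩
      exact hv
    have hu : u.1 ∈ W := ⟨u, hut, rfl⟩
    let c' := c.restrict hW
    let F : Fin p → smoothFun c'.x W := fun b =>
      ⟨fun v => k b (c'.x v), k b, (hk b).contDiffOn, fun _ => rfl⟩
    have hcoordW : ∀ b : Fin p, c'.coord (.inl b) = c'.emb (smoothCoord c'.x W b) := fun _ => rfl
    have key : O.res hW (c.emb f) = algebraMap ℝ _ (g (c.x u)) +
        ∑ b, (c'.coord (.inl b) - algebraMap ℝ _ (c.x u b)) * c'.emb (F b) := by
      let f' : smoothFun c'.x W := smoothRes c.x hW f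
      have e1 : O.res hW (c.emb f) = c'.emb f' := c.res_iso hW f 1
      have e2 : f' = algebraMap ℝ _ (g (c.x u)) +
          ∑ b, (smoothCoord c'.x W b - algebraMap ℝ _ (c.x u b)) * F b := by
        ext v
        have h1 : f'.1 v = g (c.x v) := hfg ⟨v.1, hW v.2⟩
        have h2 := hgk _ (hWt v)
        change f'.1 v = _
        rw [h1, h2]
        simp only [Subalgebra.coe_add, Pi.add_apply]
        congr 1
        rw [AddSubmonoidClass.coe_finsetSum, Finset.sum_apply]
        rfl
      rw [e1, e2, map_add, map_sum, AlgHom.commutes]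
      congr 1
      refine Finset.sum_congr rfl fun b _ => ?_
      rw [map_mul, map_sub, AlgHom.commutes, hcoordW]
    -- An even coordinate has no nilpotent part, so this difference vanishes at `u` in the whole
    -- Grassmann algebra and not merely in the body.
    have hev : ∀ b : Fin p, c'.ev ⟨u.1, hu⟩ (c'.coord (.inl b) - algebraMap ℝ _ (c.x u b)) = 0 := by
      intro b
      rw [map_sub, AlgHom.commutes, hcoordW, emb_apply, ev_iso, sub_eq_zero]
      exact (Algebra.algebraMap_eq_smul_one _).symm
    have hmem : ∀ b : Fin p, c'.coord (.inl b) - algebraMap ℝ _ (c.x u b) ∈ O.gr W 0 := fun b =>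
      Submodule.sub_mem _ (c'.coord_mem (.inl b)) (SetLike.algebraMap_mem_graded (O.gr W) _)
    have h2 : c.ev u (D V le_rfl (c.emb f)) = c'.ev ⟨u.1, hu⟩ (O.res hW (D V le_rfl (c.emb f))) :=
      (c.ev_res hW ⟨u.1, hu⟩ _).symm
    rw [h2, hres, key, map_add, halg, zero_add, map_sum, map_sum]
    refine Finset.sum_eq_zero fun b _ => ?_
    rw [hmul W hW 0 _ _ (hmem b), map_sub, hcoord, halg, sub_zero, zero_mul, zero_add, map_smul,
      map_mul, hev, zero_mul, smul_zero]
  induction s using c.induction with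
  | hadd s t h h' => rw [map_add, h, h', add_zero]
  | tmul f l =>
    have e : c.isoV (f ⊗ₜ l) = c.emb f * c.isoV (1 ⊗ₜ l) := by
      rw [emb_apply, ← map_mul, Algebra.TensorProduct.tmul_mul_tmul, one_mul, mul_one]
    rw [e, hmul V le_rfl 0 _ _ (c.emb_mem f), hf, hl, zero_mul, mul_zero, zero_add, mul_zero,
        smul_zero]

/-- The Jacobian matrix of two systems of coordinates. -/
noncomputable def jacMat (c c' : Coord O p q V) : Matrix (Idx p q) (Idx p q) (O.sec V) :=
  Matrix.of fun a b => c.pd a (c'.coord b)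

lemma jacMat_mem (c c' : Coord O p q V) (a b : Idx p q) :
    c.jacMat c' a b ∈ O.gr V (par a + par b) := by
  rw [add_comm]
  exact c.pd_mem a (c'.coord_mem b)

lemma res_jacMat (c c' : Coord O p q V) {U : Opens X} (h : U ≤ V) (a b : Idx p q) :
    O.res h (c.jacMat c' a b) = (c.restrict h).jacMat (c'.restrict h) a b := by
  change O.res h (c.pd a (c'.coord b)) = _
  rw [res_pd, res_coord]
  rfl

/-- Both sides are graded derivations of parity `par a`, and they agree on the coordinates of `c'`.
-/
lemma chain_rule (c c' : Coord O p q V) (a : Idx p q) (s : O.sec V) :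
    c.pd a s = ∑ b, c.jacMat c' a b * c'.pd b s := by
  let D : ∀ W : Opens X, W ≤ V → (O.sec W →ₗ[ℝ] O.sec W) := fun W h =>
    (c.restrict h).pd a - ∑ b, (LinearMap.mulLeft ℝ ((c.restrict h).jacMat (c'.restrict h) a b)).comp
      ((c'.restrict h).pd b)
  have hD : ∀ W h s, D W h s = (c.restrict h).pd a s -
      ∑ b, (c.restrict h).jacMat (c'.restrict h) a b * (c'.restrict h).pd b s := by
    intro W h s
    simp [D, LinearMap.sum_apply]
  have := derivation_eq_zero c' (par a) D ?_ ?_ ?_ s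
  · rw [hD] at this
    exact sub_eq_zero.1 this
  · intro W h i s t hs
    simp only [hD]
    rw [pd_mul _ _ hs]
    have : ∀ b, (c.restrict h).jacMat (c'.restrict h) a b * (c'.restrict h).pd b (s * t) =
        (c.restrict h).jacMat (c'.restrict h) a b * (c'.restrict h).pd b s * t +
        sgn (par a * i) • (s * ((c.restrict h).jacMat (c'.restrict h) a b *
          (c'.restrict h).pd b t)) := by
      intro b
      rw [pd_mul _ _ hs, mul_add, mul_assoc, mul_smul_comm, ← mul_assoc _ s, ← mul_assoc s,
        O.supercomm W _ _ _ _ ((c.restrict h).jacMat_mem (c'.restrict h) a b) hs, smul_mul_assoc,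
        smul_smul, ← sgn_add]
      congr 3
      generalize par a = x
      generalize par b = y
      clear * -
      revert x y i
      decide
    simp only [this, Finset.sum_add_distrib, sub_mul, mul_sub, Finset.sum_mul, Finset.mul_sum,
      smul_sub, Finset.smul_sum]
    abel
  · intro W h s
    simp only [hD, map_sub, map_sum, map_mul, res_pd, res_jacMat]
    rfl
  · intro W h b
    simp only [hD, pd_coord, mul_ite, mul_one, mul_zero, Finset.sum_ite_eq', Finset.mem_univ,
      if_true]
    exact sub_self _

lemma jacMat_mul (c c' c'' : Coord O p q V) :
    c.jacMat c'' = c.jacMat c' * c'.jacMat c'' := by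
  ext a b
  exact c.chain_rule c' a _

lemma jacMat_self (c : Coord O p q V) : c.jacMat c = 1 := by
  ext a b
  exact (c.pd_coord a b).trans (Matrix.one_apply).symm

end Coord

end SuperDensity

namespace SuperDensity

/-! ### Determinants -/

section Jacobi

variable {R A n : Type*} [CommRing R] [Ring A] [Fintype n] [DecidableEq n]

omit [Fintype n] in
lemma leibniz_prod (ι : R →+* A) (δ : R →+ A) (hι : ∀ x a, ι x * a = a * ι x)
    (hδ : ∀ x y, δ (x * y) = δ x * ι y + ι x * δ y) (s : Finset n) (f : n → R) :
    δ (∏ i ∈ s, f i) = ∑ i ∈ s, ι (∏ j ∈ s.erase i, f j) * δ (f i) := by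
  have h1 : δ 1 = 0 := by
    have := hδ 1 1
    simpa using this
  induction s using Finset.induction_on with
  | empty => simp [h1]
  | insert a s ha ih =>
    rw [Finset.prod_insert ha, hδ, ih, Finset.sum_insert ha, Finset.erase_insert ha, ← hι,
      Finset.mul_sum]
    congr 1
    refine Finset.sum_congr rfl fun i hi => ?_
    have hia : i ≠ a := fun h => ha (h ▸ hi)
    rw [Finset.erase_insert_of_ne hia.symm, Finset.prod_insert (by simp [ha]), map_mul, mul_assoc]

/-- The derivation takes values in a possibly noncommutative ring in which `R` is central: odd
derivatives of even functions are odd, so the classical formula over a commutative ring does not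
apply directly. Leibniz' rule is applied to each term of the permutation expansion, and the
cofactors are collected. -/
lemma jacobi_det (ι : R →+* A) (δ : R →+ A) (hι : ∀ x a, ι x * a = a * ι x)
    (hδ : ∀ x y, δ (x * y) = δ x * ι y + ι x * δ y) (M : Matrix n n R) :
    δ M.det = ∑ i, ∑ k, ι (M.adjugate i k) * δ (M k i) := by
  have hadj : ∀ i k, M.adjugate i k = ∑ σ : Equiv.Perm n, (Equiv.Perm.sign σ : ℤ) •
      if σ i = k then ∏ j ∈ Finset.univ.erase i, M (σ j) j else 0 := by
    intro i k
    rw [← Matrix.transpose_transpose M, ← Matrix.adjugate_transpose, Matrix.transpose_apply,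
      Matrix.transpose_transpose, Matrix.adjugate_apply, ← Matrix.det_transpose,
      Matrix.updateRow_transpose, Matrix.transpose_transpose, Matrix.det_apply]
    refine Finset.sum_congr rfl fun σ _ => ?_
    rw [Units.smul_def]
    congr 1
    rw [← Finset.mul_prod_erase Finset.univ _ (Finset.mem_univ i), Matrix.updateCol_self,
      Pi.single_apply, ite_mul, one_mul, zero_mul]
    congr 1
    refine Finset.prod_congr rfl fun j hj => ?_
    rw [Matrix.updateCol_ne (Finset.ne_of_mem_erase hj)]
  simp_rw [hadj, Matrix.det_apply, map_sum, Units.smul_def, map_zsmul, leibniz_prod ι δ hι hδ,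
    Finset.sum_mul, Finset.smul_sum]
  rw [Finset.sum_comm]
  refine Finset.sum_congr rfl fun i _ => ?_
  rw [Finset.sum_comm]
  refine Finset.sum_congr rfl fun σ _ => ?_
  rw [Finset.sum_eq_single (σ i)]
  · simp [mul_assoc]
  · intro k _ hk
    simp [hk.symm]
  · simp

end Jacobi

lemma isUnit_det_one_add {R n : Type*} [CommRing R] [Fintype n] [DecidableEq n] (N : Matrix n n R)
    (hN : ∀ i j, IsNilpotent (N i j)) : IsUnit (1 + N).det := by
  have h : (1 + N).det - 1 ∈ nilradical R := by
    rw [← Ideal.Quotient.eq_zero_iff_mem, map_sub, map_one, RingHom.map_det, map_add, map_one]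
    have : (Ideal.Quotient.mk (nilradical R)).mapMatrix N = 0 := by
      ext i j
      exact Ideal.Quotient.eq_zero_iff_mem.2 (hN i j)
    rw [this, add_zero, Matrix.det_one, sub_self]
  have := IsNilpotent.isUnit_one_add (mem_nilradical.1 h)
  rwa [add_sub_cancel] at this

/-! ### The Berezinian -/

section Ber

variable {X : Type u} [TopologicalSpace X] (O : SuperSheaf.{u, v} X) (U : Opens X)

/-- The inclusion of the even sections. -/
def evenIncl : O.gr U 0 →+* O.sec U where
  toFun := Subtype.val
  map_one' := rfl
  map_mul' _ _ := rfl
  map_zero' := rfl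
  map_add' _ _ := rfl

variable {O U}

local notation "ι₀" => evenIncl O U

lemma evenIncl_injective : Function.Injective ι₀ := Subtype.val_injective

lemma evenIncl_comm (x : O.gr U 0) (a : O.sec U) : ι₀ x * a = a * ι₀ x :=
  (Coord.even_commute x.2 a).eq

lemma evenPart_incl (x : O.gr U 0) : evenPart O (ι₀ x) = x := by
  rw [evenPart]
  exact Subtype.ext (DirectSum.decompose_of_mem_same (O.gr U) x.2)

variable {m n k : Type*} [Fintype m] [Fintype n] [Fintype k] [DecidableEq m] [DecidableEq n]

/-- A matrix all of whose entries have parity `i`. -/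
def MatGr (i : ZMod 2) (M : Matrix m n (O.sec U)) : Prop := ∀ a b, M a b ∈ O.gr U i

omit [Fintype m] [Fintype k] [DecidableEq m] [DecidableEq n] in
lemma MatGr.mul {i j l : ZMod 2} {M : Matrix m n (O.sec U)} {N : Matrix n k (O.sec U)}
    (hM : MatGr i M) (hN : MatGr j N) (h : i + j = l) : MatGr l (M * N) := fun a b => by
  rw [Matrix.mul_apply]
  exact Submodule.sum_mem _ fun c _ => graded_mul_mem (O.gr U) (hM a c) (hN c b) h

omit [Fintype m] [Fintype n] [DecidableEq m] [DecidableEq n] in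
lemma MatGr.add {i : ZMod 2} {M N : Matrix m n (O.sec U)}
    (hM : MatGr i M) (hN : MatGr i N) : MatGr i (M + N) := fun a b =>
  Submodule.add_mem _ (hM a b) (hN a b)

omit [Fintype m] [Fintype n] [DecidableEq m] [DecidableEq n] in
lemma MatGr.sub {i : ZMod 2} {M N : Matrix m n (O.sec U)}
    (hM : MatGr i M) (hN : MatGr i N) : MatGr i (M - N) := fun a b =>
  Submodule.sub_mem _ (hM a b) (hN a b)

omit [Fintype m] in
lemma MatGr.one : MatGr 0 (1 : Matrix m m (O.sec U)) := fun a b => by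
  rw [Matrix.one_apply]
  split_ifs
  · exact SetLike.one_mem_graded (O.gr U)
  · exact Submodule.zero_mem _

omit [Fintype m] [Fintype n] [DecidableEq m] [DecidableEq n] in
lemma matGr_incl (M : Matrix m n (O.gr U 0)) : MatGr 0 (M.map ι₀) := fun a b => (M a b).2

omit [Fintype m] [Fintype n] [DecidableEq m] [DecidableEq n] in
lemma MatGr.exists_incl {M : Matrix m n (O.sec U)} (hM : MatGr 0 M) :
    ∃ N : Matrix m n (O.gr U 0), N.map ι₀ = M :=
  ⟨fun a b => ⟨M a b, hM a b⟩, rfl⟩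

omit [Fintype m] [Fintype n] [DecidableEq m] [DecidableEq n] in
lemma incl_inj {M N : Matrix m n (O.gr U 0)} (h : M.map ι₀ = N.map ι₀) : M = N :=
  Matrix.map_injective evenIncl_injective h

lemma odd_mul_odd_sq {s t : O.sec U} (hs : s ∈ O.gr U 1) (ht : t ∈ O.gr U 1) :
    (s * t) * (s * t) = 0 := by
  have h := O.supercomm U 1 1 t t ht ht
  have h0 : t * t = 0 := by
    rw [mul_one, sgn_one, neg_one_smul] at h
    have h2 : (2 : ℝ) • (t * t) = 0 := by
      rw [two_smul]
      nth_rw 1 [h]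
      exact neg_add_cancel _
    exact (smul_eq_zero_iff_right (by norm_num : (2 : ℝ) ≠ 0)).1 h2
  rw [mul_assoc, ← mul_assoc t, O.supercomm U 1 1 t s ht hs, smul_mul_assoc, mul_assoc s, h0,
    mul_zero, smul_zero, mul_zero]

omit [Fintype m] [DecidableEq m] [DecidableEq n] in
lemma nilpotent_of_odd_mul_odd {b : Matrix m n (O.sec U)} {c : Matrix n m (O.sec U)}
    (hb : MatGr 1 b) (hc : MatGr 1 c) {N : Matrix m m (O.gr U 0)} (hN : N.map ι₀ = b * c) (i j : m) :
    IsNilpotent (N i j) := by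
  have : N i j = ∑ k, (⟨b i k * c k j, graded_mul_mem (O.gr U) (hb i k) (hc k j) rfl⟩ :
      O.gr U 0) := by
    apply evenIncl_injective
    rw [map_sum]
    exact congrFun (congrFun hN i) j
  rw [this, ← mem_nilradical]
  refine Ideal.sum_mem _ fun k _ => mem_nilradical.2 ⟨2, ?_⟩
  rw [pow_two]
  exact Subtype.ext (odd_mul_odd_sq (hb i k) (hc k j))

omit [DecidableEq n] in
lemma isUnit_det_of_odd {b : Matrix m n (O.sec U)} {c : Matrix n m (O.sec U)}
    (hb : MatGr 1 b) (hc : MatGr 1 c) {M : Matrix m m (O.gr U 0)} (hM : M.map ι₀ = 1 + b * c) :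
    IsUnit M.det := by
  have : (M - 1).map ι₀ = b * c := by
    rw [Matrix.map_sub _ (map_sub _), hM, Matrix.map_one _ (map_zero _) (map_one _),
      add_sub_cancel_left]
  have h := isUnit_det_one_add (M - 1) (nilpotent_of_odd_mul_odd hb hc this)
  rwa [add_sub_cancel] at h

/-- Both matrices are rank-one perturbations of the identity, with determinants `1 + b j i * s` and
`1 + s * b j i`. The odd factors anticommute, so the product is 1 minus the square of a product of
two odd elements, which is zero. -/
lemma det_mul_det_single {b : Matrix m n (O.sec U)} (hb : MatGr 1 b) {s : O.sec U}
    (hs : s ∈ O.gr U 1) (i : n) (j : m) {M : Matrix m m (O.gr U 0)} {N : Matrix n n (O.gr U 0)}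
    (hM : M.map ι₀ = 1 + b * Matrix.single i j s) (hN : N.map ι₀ = 1 + Matrix.single i j s * b) :
    M.det * N.det = 1 := by
  have hbs : ∀ k, b k i * s ∈ O.gr U 0 := fun k => graded_mul_mem (O.gr U) (hb k i) hs rfl
  have hsb : ∀ k, s * b j k ∈ O.gr U 0 := fun k => graded_mul_mem (O.gr U) hs (hb j k) rfl
  have h1 : M = 1 + Matrix.replicateCol Unit (fun k => (⟨b k i * s, hbs k⟩ : O.gr U 0)) *
      Matrix.replicateRow Unit (Pi.single j (1 : O.gr U 0)) := by
    apply incl_inj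
    rw [hM, Matrix.map_add _ (map_add _), Matrix.map_one _ (map_zero _) (map_one _)]
    congr 1
    ext k l
    simp only [Matrix.map_apply, Matrix.mul_apply, Finset.univ_unique, Finset.sum_singleton,
      Matrix.replicateCol_apply, Matrix.replicateRow_apply, Matrix.single_apply, map_mul,
      Pi.single_apply]
    by_cases h : l = j
    · subst h; simp; rfl
    · simp [h, Ne.symm h]
  have h2 : N = 1 + Matrix.replicateCol Unit (Pi.single i (1 : O.gr U 0)) *
      Matrix.replicateRow Unit (fun k => (⟨s * b j k, hsb k⟩ : O.gr U 0)) := by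
    apply incl_inj
    rw [hN, Matrix.map_add _ (map_add _), Matrix.map_one _ (map_zero _) (map_one _)]
    congr 1
    ext k l
    simp only [Matrix.map_apply, Matrix.mul_apply, Finset.univ_unique, Finset.sum_singleton,
      Matrix.replicateCol_apply, Matrix.replicateRow_apply, Matrix.single_apply, map_mul,
      Pi.single_apply]
    by_cases h : k = i
    · subst h; simp; rfl
    · simp [h, Ne.symm h]
  rw [h1, h2, Matrix.det_one_add_replicateCol_mul_replicateRow,
    Matrix.det_one_add_replicateCol_mul_replicateRow, single_one_dotProduct,
    dotProduct_single_one]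
  apply evenIncl_injective
  have e1 : ι₀ (⟨b j i * s, hbs j⟩ : O.gr U 0) = - (s * b j i) := by
    have := O.supercomm U 1 1 _ _ (hb j i) hs
    rwa [mul_one, sgn_one, neg_one_smul] at this
  have e2 : ι₀ (⟨s * b j i, hsb i⟩ : O.gr U 0) = s * b j i := rfl
  rw [map_mul, map_add, map_add, map_one, e1, e2]
  have := odd_mul_odd_sq hs (hb j i)
  simp only [add_mul, mul_add, neg_mul, this]
  simp

/-- The odd counterpart of `det (1 + bc) = det (1 + cb)`: anticommutation turns equality into
inversion. The matrix `c` is built up one entry at a time; with `K = (1 + c'b)⁻¹` the factorisations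
`1 + b(c' + e) = (1 + bc')(1 + bKe)` and `1 + (c' + e)b = (1 + ebK)(1 + c'b)` reduce each step to a
single entry. -/
lemma det_one_add_mul_det_one_add {b : Matrix m n (O.sec U)} {c : Matrix n m (O.sec U)}
    (hb : MatGr 1 b) (hc : MatGr 1 c) {M : Matrix m m (O.gr U 0)} {N : Matrix n n (O.gr U 0)}
    (hM : M.map ι₀ = 1 + b * c) (hN : N.map ι₀ = 1 + c * b) : M.det * N.det = 1 := by
  have key : ∀ s : Finset (n × m), ∀ (M : Matrix m m (O.gr U 0)) (N : Matrix n n (O.gr U 0)),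
      M.map ι₀ = 1 + b * (∑ z ∈ s, Matrix.single z.1 z.2 (c z.1 z.2)) →
      N.map ι₀ = 1 + (∑ z ∈ s, Matrix.single z.1 z.2 (c z.1 z.2)) * b → M.det * N.det = 1 := by
    intro s
    induction s using Finset.induction_on with
    | empty =>
      intro M N hM hN
      rw [Finset.sum_empty, Matrix.mul_zero, add_zero] at hM
      rw [Finset.sum_empty, Matrix.zero_mul, add_zero] at hN
      have h1 : M = 1 := incl_inj (by rw [hM, Matrix.map_one _ (map_zero _) (map_one _)])
      have h2 : N = 1 := incl_inj (by rw [hN, Matrix.map_one _ (map_zero _) (map_one _)])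
      rw [h1, h2, Matrix.det_one, Matrix.det_one, one_mul]
    | insert z s hz ih =>
      intro M N hM hN
      rw [Finset.sum_insert hz] at hM hN
      set c' := ∑ z ∈ s, Matrix.single z.1 z.2 (c z.1 z.2) with hc'
      set e := Matrix.single z.1 z.2 (c z.1 z.2) with he
      have hgc' : MatGr 1 c' := fun i j => by
        rw [hc', Matrix.sum_apply]
        refine Submodule.sum_mem _ fun w _ => ?_
        rw [Matrix.single_apply]
        split_ifs
        · exact hc _ _
        · exact Submodule.zero_mem _
      have hge : MatGr 1 e := fun i j => by
        rw [he, Matrix.single_apply]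
        split_ifs
        · exact hc _ _
        · exact Submodule.zero_mem _
      obtain ⟨M', hM'⟩ := (MatGr.one.add (hb.mul hgc' rfl) : MatGr 0 (1 + b * c')).exists_incl
      obtain ⟨N', hN'⟩ := (MatGr.one.add (hgc'.mul hb rfl) : MatGr 0 (1 + c' * b)).exists_incl
      have uN := isUnit_det_of_odd hgc' hb hN'
      set K := (N'⁻¹).map ι₀ with hK
      have hKN : K * (1 + c' * b) = 1 := by
        rw [← hN', hK, ← Matrix.map_mul, Matrix.nonsing_inv_mul _ uN,
          Matrix.map_one _ (map_zero _) (map_one _)]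
      have hNK : (1 + c' * b) * K = 1 := by
        rw [← hN', hK, ← Matrix.map_mul, Matrix.mul_nonsing_inv _ uN,
          Matrix.map_one _ (map_zero _) (map_one _)]
      have hgb' : MatGr 1 (b * K) := hb.mul (matGr_incl _) rfl
      obtain ⟨M'', hM''⟩ := (MatGr.one.add (hgb'.mul hge rfl) : MatGr 0 (1 + b * K * e)).exists_incl
      obtain ⟨N'', hN''⟩ := (MatGr.one.add (hge.mul hgb' rfl) : MatGr 0 (1 + e * (b * K))).exists_incl
      have e1 : M = M' * M'' := by
        apply incl_inj
        rw [Matrix.map_mul, hM, hM', hM'']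
        have : (1 + b * c') * (b * K * e) = b * ((1 + c' * b) * K) * e := by
          simp only [Matrix.add_mul, Matrix.mul_add, Matrix.mul_assoc, Matrix.one_mul]
        rw [Matrix.mul_add (1 + b * c'), this, hNK]
        simp only [Matrix.mul_add, Matrix.mul_one]
        abel
      have e2 : N = N'' * N' := by
        apply incl_inj
        rw [Matrix.map_mul, hN, hN', hN'', Matrix.add_mul 1 (e * (b * K)), Matrix.one_mul,
          Matrix.mul_assoc e, Matrix.mul_assoc b, hKN]
        simp only [Matrix.add_mul, Matrix.mul_one]
        abel
      rw [e1, e2, Matrix.det_mul, Matrix.det_mul]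
      have h1 := ih M' N' hM' hN'
      have h2 := det_mul_det_single hgb' (hc z.1 z.2) z.1 z.2 hM'' hN''
      calc M'.det * M''.det * (N''.det * N'.det) =
          (M'.det * N'.det) * (M''.det * N''.det) := by ring
        _ = 1 := by rw [h1, h2, one_mul]
  have hsum : ∑ z : n × m, Matrix.single z.1 z.2 (c z.1 z.2) = c := by
    rw [Fintype.sum_prod_type]
    exact (Matrix.matrix_eq_sum_single c).symm
  refine key Finset.univ M N ?_ ?_
  · rw [hsum, hM]
  · rw [hsum, hN]

variable {p q : ℕ}

/-- Even supermatrices. -/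
def SuperMat (A : Matrix (Idx p q) (Idx p q) (O.sec U)) : Prop :=
  ∀ a b, A a b ∈ O.gr U (par a + par b)

/-- Removes the projections to even parts from the definition of `ber`: any matrices over the
commutative ring of even sections that represent the two blocks may be used. -/
lemma ber_eq {A : Matrix (Idx p q) (Idx p q) (O.sec U)}
    {H : Matrix (Fin p) (Fin p) (O.gr U 0)} {D : Matrix (Fin q) (Fin q) (O.gr U 0)}
    (hD : D.map ι₀ = A.toBlocks₂₂)
    (hH : H.map ι₀ = A.toBlocks₁₁ - A.toBlocks₁₂ * (D⁻¹).map ι₀ * A.toBlocks₂₁) :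
    ber O A = ι₀ (H.det * Ring.inverse D.det) := by
  have h1 : (fun i j => evenPart O (A (.inr i) (.inr j)) : Matrix (Fin q) (Fin q) (O.gr U 0)) = D := by
    ext i j : 2
    have : A (.inr i) (.inr j) = ι₀ (D i j) := (congrFun (congrFun hD i) j).symm
    rw [this, evenPart_incl]
  have h2 : (fun i j => evenPart O (A (.inl i) (.inl j) -
      ∑ k, ∑ l, A (.inl i) (.inr k) * ((D⁻¹ k l : O.gr U 0) : O.sec U) * A (.inr l) (.inl j)) :
      Matrix (Fin p) (Fin p) (O.gr U 0)) = H := by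
    ext i j : 2
    have : A (.inl i) (.inl j) -
        ∑ k, ∑ l, A (.inl i) (.inr k) * ((D⁻¹ k l : O.gr U 0) : O.sec U) * A (.inr l) (.inl j) =
        ι₀ (H i j) := by
      have := congrFun (congrFun hH i) j
      rw [Matrix.map_apply] at this
      rw [this, Matrix.sub_apply, Matrix.mul_apply]
      simp only [Matrix.mul_apply, Finset.sum_mul]
      rw [Finset.sum_comm]
      rfl
    rw [this, evenPart_incl]
  rw [ber]
  simp only [h1, h2]
  rfl

end Ber

end SuperDensity

namespace SuperDensity

/-! ### Multiplicativity of the Berezinian. -/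

section BerMul

variable {X : Type u} [TopologicalSpace X] {O : SuperSheaf.{u, v} X} {U : Opens X} {p q : ℕ}

local notation "ι₀" => evenIncl O U

lemma toBlocks_mul₁₁ {m n A : Type*} [Fintype m] [Fintype n] [Ring A] (M N : Matrix (m ⊕ n) (m ⊕ n) A) :
    (M * N).toBlocks₁₁ = M.toBlocks₁₁ * N.toBlocks₁₁ + M.toBlocks₁₂ * N.toBlocks₂₁ := by
  ext i j; simp [Matrix.toBlocks₁₁, Matrix.toBlocks₁₂, Matrix.toBlocks₂₁, Matrix.mul_apply]

lemma toBlocks_mul₁₂ {m n A : Type*} [Fintype m] [Fintype n] [Ring A] (M N : Matrix (m ⊕ n) (m ⊕ n) A) :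
    (M * N).toBlocks₁₂ = M.toBlocks₁₁ * N.toBlocks₁₂ + M.toBlocks₁₂ * N.toBlocks₂₂ := by
  ext i j; simp [Matrix.toBlocks₁₁, Matrix.toBlocks₁₂, Matrix.toBlocks₂₂, Matrix.mul_apply]

lemma toBlocks_mul₂₁ {m n A : Type*} [Fintype m] [Fintype n] [Ring A] (M N : Matrix (m ⊕ n) (m ⊕ n) A) :
    (M * N).toBlocks₂₁ = M.toBlocks₂₁ * N.toBlocks₁₁ + M.toBlocks₂₂ * N.toBlocks₂₁ := by
  ext i j; simp [Matrix.toBlocks₁₁, Matrix.toBlocks₂₂, Matrix.toBlocks₂₁, Matrix.mul_apply]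

lemma toBlocks_mul₂₂ {m n A : Type*} [Fintype m] [Fintype n] [Ring A] (M N : Matrix (m ⊕ n) (m ⊕ n) A) :
    (M * N).toBlocks₂₂ = M.toBlocks₂₁ * N.toBlocks₁₂ + M.toBlocks₂₂ * N.toBlocks₂₂ := by
  ext i j; simp [Matrix.toBlocks₂₂, Matrix.toBlocks₁₂, Matrix.toBlocks₂₁, Matrix.mul_apply]

variable {A B : Matrix (Idx p q) (Idx p q) (O.sec U)}

lemma SuperMat.gr₁₁ (hA : SuperMat A) : MatGr 0 A.toBlocks₁₁ := fun i j => hA (.inl i) (.inl j)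

lemma SuperMat.gr₁₂ (hA : SuperMat A) : MatGr 1 A.toBlocks₁₂ := fun i j => hA (.inl i) (.inr j)

lemma SuperMat.gr₂₁ (hA : SuperMat A) : MatGr 1 A.toBlocks₂₁ := fun i j => hA (.inr i) (.inl j)

lemma SuperMat.gr₂₂ (hA : SuperMat A) : MatGr 0 A.toBlocks₂₂ := fun i j => hA (.inr i) (.inr j)

lemma map_inv_mul {m : Type*} [Fintype m] [DecidableEq m] {M : Matrix m m (O.gr U 0)}
    (h : IsUnit M.det) : (M⁻¹).map ι₀ * M.map ι₀ = 1 := by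
  rw [← Matrix.map_mul, Matrix.nonsing_inv_mul _ h, Matrix.map_one _ (map_zero _) (map_one _)]

lemma map_mul_inv {m : Type*} [Fintype m] [DecidableEq m] {M : Matrix m m (O.gr U 0)}
    (h : IsUnit M.det) : M.map ι₀ * (M⁻¹).map ι₀ = 1 := by
  rw [← Matrix.map_mul, Matrix.mul_nonsing_inv _ h, Matrix.map_one _ (map_zero _) (map_one _)]

lemma SuperMat.exists_blocks (hA : SuperMat A) :
    ∃ (H : Matrix (Fin p) (Fin p) (O.gr U 0)) (D : Matrix (Fin q) (Fin q) (O.gr U 0)),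
      D.map ι₀ = A.toBlocks₂₂ ∧
      H.map ι₀ = A.toBlocks₁₁ - A.toBlocks₁₂ * (D⁻¹).map ι₀ * A.toBlocks₂₁ := by
  obtain ⟨D, hD⟩ := hA.gr₂₂.exists_incl
  obtain ⟨H, hH⟩ := (hA.gr₁₁.sub (((hA.gr₁₂.mul (matGr_incl D⁻¹) rfl).mul hA.gr₂₁ rfl :
    MatGr 0 (A.toBlocks₁₂ * (D⁻¹).map ι₀ * A.toBlocks₂₁)))).exists_incl
  exact ⟨H, D, hD, hH⟩

/-- The lower right block of `A * B = 1` says that `D * D'` is the identity plus a product of two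
odd matrices, and such a matrix has invertible determinant. -/
lemma SuperMat.isUnit_block (hA : SuperMat A) (hB : SuperMat B) (h : A * B = 1)
    {D : Matrix (Fin q) (Fin q) (O.gr U 0)} (hD : D.map ι₀ = A.toBlocks₂₂) : IsUnit D.det := by
  obtain ⟨D', hD'⟩ := hB.gr₂₂.exists_incl
  have h1 := toBlocks_mul₂₂ A B
  rw [h] at h1
  have h2 : (1 : Matrix (Idx p q) (Idx p q) (O.sec U)).toBlocks₂₂ = 1 := by
    ext i j; simp [Matrix.toBlocks₂₂, Matrix.one_apply]
  have hneg : MatGr 1 (-A.toBlocks₂₁) := fun i j => Submodule.neg_mem _ (hA.gr₂₁ i j)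
  have h3 : (D * D').map ι₀ = 1 + (-A.toBlocks₂₁) * B.toBlocks₁₂ := by
    rw [Matrix.map_mul, hD, hD', ← h2, h1, Matrix.neg_mul]
    abel
  have := isUnit_det_of_odd hneg hB.gr₁₂ h3
  rw [Matrix.det_mul] at this
  exact isUnit_of_mul_isUnit_left this

lemma ber_one : ber O (1 : Matrix (Idx p q) (Idx p q) (O.sec U)) = 1 := by
  have h1 : ((1 : Matrix (Fin q) (Fin q) (O.gr U 0))).map ι₀ =
      (1 : Matrix (Idx p q) (Idx p q) (O.sec U)).toBlocks₂₂ := by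
    rw [Matrix.map_one _ (map_zero _) (map_one _)]
    ext i j; simp [Matrix.toBlocks₂₂, Matrix.one_apply]
  have h2 : ((1 : Matrix (Fin p) (Fin p) (O.gr U 0))).map ι₀ =
      (1 : Matrix (Idx p q) (Idx p q) (O.sec U)).toBlocks₁₁ -
      (1 : Matrix (Idx p q) (Idx p q) (O.sec U)).toBlocks₁₂ *
        ((1 : Matrix (Fin q) (Fin q) (O.gr U 0))⁻¹).map ι₀ *
      (1 : Matrix (Idx p q) (Idx p q) (O.sec U)).toBlocks₂₁ := by
    have : (1 : Matrix (Idx p q) (Idx p q) (O.sec U)).toBlocks₁₂ = 0 := by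
      ext i j; simp [Matrix.toBlocks₁₂]
    rw [this, Matrix.zero_mul, Matrix.zero_mul, sub_zero, Matrix.map_one _ (map_zero _) (map_one _)]
    ext i j; simp [Matrix.toBlocks₁₁, Matrix.one_apply]
  rw [ber_eq h1 h2, Matrix.det_one, Matrix.det_one, Ring.inverse_one, one_mul, map_one]

lemma ber_mem : ber O A ∈ O.gr U 0 := Subtype.property _

/-- The Schur complement of a product. Writing `C = Dc`, `B' = bE`, `A = H + Bc` and `A' = H' +
bC'`, the lower right block of the product becomes `DNE` with `N = 1 + cb`. Its inverse cancels
against the off-diagonal blocks, and only `H(1 - bN⁻¹c)H'` remains. -/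
lemma schur_mul {m n R : Type*} [Fintype m] [Fintype n] [DecidableEq m] [DecidableEq n] [Ring R]
    {A A' H H' : Matrix m m R} {B B' b : Matrix m n R} {C C' c : Matrix n m R}
    {D Di E Ei N Ni : Matrix n n R} (hD : Di * D = 1) (hD' : D * Di = 1) (hE' : Ei * E = 1)
    (hE : E * Ei = 1) (hN : N * Ni = 1) (hN' : Ni * N = 1) (hc : c = Di * C) (hb : b = B' * Ei)
    (hNb : N = 1 + c * b) (hH : H = A - B * Di * C) (hH' : H' = A' - B' * Ei * C') :
    (A * A' + B * C') - (A * B' + B * E) * (Ei * Ni * Di) * (C * A' + D * C') =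
      H * (1 - b * Ni * c) * H' := by
  have eC : C = D * c := by rw [hc, ← Matrix.mul_assoc, hD', Matrix.one_mul]
  have eB : B' = b * E := by rw [hb, Matrix.mul_assoc, hE', Matrix.mul_one]
  have eA : A = H + B * c := by rw [hH, hc, Matrix.mul_assoc, sub_add_cancel]
  have eA' : A' = H' + b * C' := by rw [hH', hb, sub_add_cancel]
  have e1 : A * B' + B * E = (H * b + B * N) * E := by
    rw [eA, eB, hNb]
    simp only [Matrix.add_mul, Matrix.mul_add, Matrix.mul_assoc, Matrix.mul_one]
    abel
  have e2 : C * A' + D * C' = D * (c * H' + N * C') := by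
    rw [eA', eC, hNb]
    simp only [Matrix.add_mul, Matrix.mul_add, Matrix.mul_assoc, Matrix.one_mul]
    abel
  have e3 : (A * B' + B * E) * (Ei * Ni * Di) * (C * A' + D * C') =
      (H * b + B * N) * Ni * (c * H' + N * C') := by
    rw [e1, e2]
    calc (H * b + B * N) * E * (Ei * Ni * Di) * (D * (c * H' + N * C')) =
        (H * b + B * N) * (E * Ei) * Ni * (Di * D) * (c * H' + N * C') := by
          simp only [Matrix.mul_assoc]
      _ = _ := by rw [hE, hD, Matrix.mul_one, Matrix.mul_one]
  have e4 : (H * b + B * N) * Ni * (c * H' + N * C') =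
      H * (b * Ni * c) * H' + H * b * C' + B * c * H' + B * N * C' := by
    have : (H * b + B * N) * Ni * (c * H' + N * C') = H * (b * Ni * c) * H' +
        H * b * (Ni * N) * C' + B * (N * Ni) * c * H' + B * (N * Ni) * N * C' := by
      simp only [Matrix.add_mul, Matrix.mul_add, Matrix.mul_assoc]
      abel
    rw [this, hN, hN', Matrix.mul_one, Matrix.mul_one]
  rw [e3, e4, eA, eA', hNb]
  simp only [Matrix.add_mul, Matrix.mul_add, Matrix.mul_assoc, Matrix.mul_sub, Matrix.sub_mul,
    Matrix.one_mul]
  abel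

/-- By `schur_mul` the product has Schur complement `H P H'` and lower right block `D N E`. Here `P
= 1 - bN⁻¹c` is the inverse of `1 + bc`, so `det P = det N` by `det_one_add_mul_det_one_add`, and
the two extra determinants cancel in the quotient. -/
lemma ber_mul (hA : SuperMat A) (hB : SuperMat B)
    (uA : ∀ D : Matrix (Fin q) (Fin q) (O.gr U 0), D.map ι₀ = A.toBlocks₂₂ → IsUnit D.det)
    (uB : ∀ D : Matrix (Fin q) (Fin q) (O.gr U 0), D.map ι₀ = B.toBlocks₂₂ → IsUnit D.det) :
    ber O (A * B) = ber O A * ber O B := by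
  obtain ⟨H, D, hD, hH⟩ := hA.exists_blocks
  obtain ⟨H', E, hE, hH'⟩ := hB.exists_blocks
  have hDu := uA D hD
  have hEu := uB E hE
  set c := (D⁻¹).map ι₀ * A.toBlocks₂₁ with hc
  set b := B.toBlocks₁₂ * (E⁻¹).map ι₀ with hb
  have gc : MatGr 1 c := (matGr_incl _).mul hA.gr₂₁ rfl
  have gb : MatGr 1 b := hB.gr₁₂.mul (matGr_incl _) rfl
  obtain ⟨N, hN⟩ := (MatGr.one.add (gc.mul gb rfl) : MatGr 0 (1 + c * b)).exists_incl
  obtain ⟨M, hM⟩ := (MatGr.one.add (gb.mul gc rfl) : MatGr 0 (1 + b * c)).exists_incl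
  have hNu := isUnit_det_of_odd gc gb hN
  obtain ⟨P, hP⟩ := (MatGr.one.sub ((gb.mul (matGr_incl N⁻¹) rfl).mul gc rfl) :
    MatGr 0 (1 - b * (N⁻¹).map ι₀ * c)).exists_incl
  have hMN : M.det * N.det = 1 := det_one_add_mul_det_one_add gb gc hM hN
  have hMP : M * P = 1 := by
    apply incl_inj
    rw [Matrix.map_mul, hM, hP, Matrix.map_one _ (map_zero _) (map_one _)]
    have e : (1 + b * c) * (b * (N⁻¹).map ι₀ * c) = b * ((1 + c * b) * (N⁻¹).map ι₀) * c := by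
      simp only [Matrix.add_mul, Matrix.mul_add, Matrix.mul_assoc, Matrix.one_mul]
    rw [Matrix.mul_sub, e, ← hN, map_mul_inv hNu, Matrix.mul_one, Matrix.mul_one]
    abel
  have hPN : P.det = N.det := by
    have h1 : M.det * P.det = 1 := by rw [← Matrix.det_mul, hMP, Matrix.det_one]
    calc P.det = P.det * (M.det * N.det) := by rw [hMN, mul_one]
      _ = (M.det * P.det) * N.det := by ring
      _ = N.det := by rw [h1, one_mul]
  have h22 : (D * N * E).map ι₀ = (A * B).toBlocks₂₂ := by
    rw [Matrix.map_mul, Matrix.map_mul, hN, toBlocks_mul₂₂, ← hE, ← hD, hc, hb]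
    have : D.map ι₀ * (1 + (D⁻¹).map ι₀ * A.toBlocks₂₁ * (B.toBlocks₁₂ * (E⁻¹).map ι₀)) * E.map ι₀ =
        D.map ι₀ * E.map ι₀ + (D.map ι₀ * (D⁻¹).map ι₀) * A.toBlocks₂₁ * B.toBlocks₁₂ *
          ((E⁻¹).map ι₀ * E.map ι₀) := by
      simp only [Matrix.add_mul, Matrix.mul_add, Matrix.mul_assoc, Matrix.mul_one]
    rw [this, map_mul_inv hDu, map_inv_mul hEu, Matrix.one_mul, Matrix.mul_one, add_comm]
  have h11 : (H * P * H').map ι₀ = (A * B).toBlocks₁₁ - (A * B).toBlocks₁₂ *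
      ((D * N * E)⁻¹).map ι₀ * (A * B).toBlocks₂₁ := by
    rw [toBlocks_mul₁₁, toBlocks_mul₁₂, toBlocks_mul₂₁, Matrix.mul_inv_rev, Matrix.mul_inv_rev,
      Matrix.map_mul, Matrix.map_mul, Matrix.map_mul, Matrix.map_mul, hP, ← hE, ← hD,
      ← Matrix.mul_assoc ((E⁻¹).map ι₀)]
    exact (schur_mul (map_inv_mul hDu) (map_mul_inv hDu) (map_inv_mul hEu) (map_mul_inv hEu)
      (map_mul_inv hNu) (map_inv_mul hNu) hc hb hN hH hH').symm
  rw [ber_eq h22 h11, ber_eq hD hH, ber_eq hE hH', ← map_mul]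
  congr 1
  simp only [Matrix.det_mul, hPN]
  obtain ⟨d, hd⟩ := hDu
  obtain ⟨e, he⟩ := hEu
  obtain ⟨n, hn⟩ := hNu
  rw [← hd, ← he, ← hn, ← Units.val_mul, ← Units.val_mul, Ring.inverse_unit, Ring.inverse_unit,
    Ring.inverse_unit, mul_inv, mul_inv, Units.val_mul, Units.val_mul]
  calc _ = H.det * ↑d⁻¹ * (H'.det * ↑e⁻¹) * (n * ↑n⁻¹ : O.gr U 0) := by ring
    _ = _ := by rw [Units.mul_inv, mul_one]

lemma ber_mul_of_inv {A' B' : Matrix (Idx p q) (Idx p q) (O.sec U)} (hA : SuperMat A)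
    (hB : SuperMat B) (hA' : SuperMat A') (hB' : SuperMat B') (h : A * A' = 1) (h' : B * B' = 1) :
    ber O (A * B) = ber O A * ber O B :=
  ber_mul hA hB (fun _ hD => hA.isUnit_block hA' h hD) (fun _ hD => hB.isUnit_block hB' h' hD)

/-! ### The derivative of the Berezinian -/

section Deriv

variable (δ : O.sec U →+ O.sec U) (d : ZMod 2)

/-- The graded Leibniz rule for an operator of parity `d`. -/
def IsSuperDer : Prop := (∀ i, ∀ s ∈ O.gr U i, δ s ∈ O.gr U (i + d)) ∧
  ∀ i, ∀ s ∈ O.gr U i, ∀ t, δ (s * t) = δ s * t + sgn (d * i) • (s * δ t)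

variable {δ d} {m n k : Type*} [Fintype m] [Fintype n] [Fintype k]

omit [Fintype m] [Fintype k] in
lemma IsSuperDer.map_mul (h : IsSuperDer δ d) {i : ZMod 2} {M : Matrix m n (O.sec U)}
    {N : Matrix n k (O.sec U)} (hM : MatGr i M) :
    (M * N).map δ = M.map δ * N + sgn (d * i) • (M * N.map δ) := by
  ext a b
  simp only [Matrix.map_apply, Matrix.mul_apply, Matrix.add_apply, Matrix.smul_apply, map_sum,
    Finset.smul_sum, ← Finset.sum_add_distrib]
  exact Finset.sum_congr rfl fun c _ => h.2 _ _ (hM a c) _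

omit [Fintype m] [Fintype n] in
lemma IsSuperDer.map_gr (h : IsSuperDer δ d) {i j : ZMod 2} {M : Matrix m n (O.sec U)}
    (hM : MatGr i M) (hj : i + d = j) : MatGr j (M.map δ) := fun a b => hj ▸ h.1 _ _ (hM a b)

lemma trace_mul_swap {i j : ZMod 2} {M : Matrix m n (O.sec U)} {N : Matrix n m (O.sec U)}
    (hM : MatGr i M) (hN : MatGr j N) : (M * N).trace = sgn (i * j) • (N * M).trace := by
  simp only [Matrix.trace, Matrix.diag, Matrix.mul_apply, Finset.smul_sum]
  rw [Finset.sum_comm]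
  exact Finset.sum_congr rfl fun a _ => Finset.sum_congr rfl fun b _ =>
    O.supercomm U _ _ _ _ (hM b a) (hN a b)

lemma IsSuperDer.one (h : IsSuperDer δ d) : δ 1 = 0 := by
  have := h.2 0 1 (SetLike.one_mem_graded (O.gr U)) 1
  simpa [sgn_zero] using this

lemma IsSuperDer.det [DecidableEq m] (h : IsSuperDer δ d) {M : Matrix m m (O.gr U 0)}
    (hM : IsUnit M.det) :
    δ (ι₀ M.det) = ι₀ M.det * ((M⁻¹).map ι₀ * (M.map ι₀).map δ).trace := by
  have := jacobi_det ι₀ (δ.comp (ι₀ : O.gr U 0 →+ O.sec U)) evenIncl_comm (fun x y => by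
    have := h.2 0 (ι₀ x) x.2 (ι₀ y)
    rw [mul_zero, sgn_zero, one_smul] at this
    exact this) M
  refine this.trans ?_
  have hadj : M.adjugate = M.det • M⁻¹ := by
    rw [Matrix.inv_def, smul_smul, Ring.mul_inverse_cancel _ hM, one_smul]
  simp only [hadj, Matrix.trace, Matrix.diag, Matrix.mul_apply, Finset.mul_sum, Matrix.smul_apply,
    smul_eq_mul, _root_.map_mul, Matrix.map_apply, mul_assoc]
  rfl

end Deriv

end BerMul

end SuperDensity

namespace SuperDensity

/-! ### The logarithmic derivative of the Berezinian. -/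

section BerDeriv

variable {X : Type u} [TopologicalSpace X] {O : SuperSheaf.{u, v} X} {U : Opens X} {p q : ℕ}
  {A B : Matrix (Idx p q) (Idx p q) (O.sec U)} {δ : O.sec U →+ O.sec U} {d : ZMod 2}

local notation "ι₀" => evenIncl O U

lemma inverse_blocks {m n R : Type*} [Fintype m] [Fintype n] [DecidableEq m] [DecidableEq n]
    [Ring R] {A B : Matrix (m ⊕ n) (m ⊕ n) R} (hAB : A * B = 1) (hBA : B * A = 1)
    {Di : Matrix n n R} (hD : Di * A.toBlocks₂₂ = 1) (hD' : A.toBlocks₂₂ * Di = 1) :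
    B.toBlocks₁₂ = -(B.toBlocks₁₁ * A.toBlocks₁₂ * Di) ∧
    B.toBlocks₂₁ = -(Di * A.toBlocks₂₁ * B.toBlocks₁₁) ∧
    B.toBlocks₂₂ = Di + Di * A.toBlocks₂₁ * B.toBlocks₁₁ * A.toBlocks₁₂ * Di ∧
    B.toBlocks₁₁ * (A.toBlocks₁₁ - A.toBlocks₁₂ * Di * A.toBlocks₂₁) = 1 ∧
    (A.toBlocks₁₁ - A.toBlocks₁₂ * Di * A.toBlocks₂₁) * B.toBlocks₁₁ = 1 := by
  have o11 : (1 : Matrix (m ⊕ n) (m ⊕ n) R).toBlocks₁₁ = 1 := by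
    ext i j; simp [Matrix.toBlocks₁₁, Matrix.one_apply]
  have o12 : (1 : Matrix (m ⊕ n) (m ⊕ n) R).toBlocks₁₂ = 0 := by
    ext i j; simp [Matrix.toBlocks₁₂]
  have o21 : (1 : Matrix (m ⊕ n) (m ⊕ n) R).toBlocks₂₁ = 0 := by
    ext i j; simp [Matrix.toBlocks₂₁]
  have o22 : (1 : Matrix (m ⊕ n) (m ⊕ n) R).toBlocks₂₂ = 1 := by
    ext i j; simp [Matrix.toBlocks₂₂, Matrix.one_apply]
  have a11 := toBlocks_mul₁₁ A B
  have a21 := toBlocks_mul₂₁ A B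
  have a22 := toBlocks_mul₂₂ A B
  have b11 := toBlocks_mul₁₁ B A
  have b12 := toBlocks_mul₁₂ B A
  rw [hAB, o11] at a11
  rw [hAB, o21] at a21
  rw [hAB, o22] at a22
  rw [hBA, o11] at b11
  rw [hBA, o12] at b12
  have e12 : B.toBlocks₁₂ = -(B.toBlocks₁₁ * A.toBlocks₁₂ * Di) := by
    have : B.toBlocks₁₂ * A.toBlocks₂₂ = -(B.toBlocks₁₁ * A.toBlocks₁₂) :=
      (neg_eq_of_add_eq_zero_right b12.symm).symm
    rw [← Matrix.neg_mul, ← this, Matrix.mul_assoc, hD', Matrix.mul_one]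
  have e21 : B.toBlocks₂₁ = -(Di * A.toBlocks₂₁ * B.toBlocks₁₁) := by
    have : A.toBlocks₂₂ * B.toBlocks₂₁ = -(A.toBlocks₂₁ * B.toBlocks₁₁) :=
      (neg_eq_of_add_eq_zero_right a21.symm).symm
    rw [Matrix.mul_assoc, ← Matrix.mul_neg, ← this, ← Matrix.mul_assoc, hD, Matrix.one_mul]
  refine ⟨e12, e21, ?_, ?_, ?_⟩
  · have : A.toBlocks₂₂ * B.toBlocks₂₂ = 1 - A.toBlocks₂₁ * B.toBlocks₁₂ := by
      rw [a22]; abel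
    calc B.toBlocks₂₂ = Di * (A.toBlocks₂₂ * B.toBlocks₂₂) := by
          rw [← Matrix.mul_assoc, hD, Matrix.one_mul]
      _ = _ := by
          rw [this, e12, Matrix.mul_sub, Matrix.mul_one, Matrix.mul_neg, Matrix.mul_neg,
            sub_neg_eq_add]
          simp only [Matrix.mul_assoc]
  · rw [b11, e12, Matrix.mul_sub, Matrix.neg_mul, sub_eq_add_neg]
    simp only [Matrix.mul_assoc]
  · rw [a11, e21, Matrix.sub_mul, Matrix.mul_neg, sub_eq_add_neg]
    simp only [Matrix.mul_assoc]

/-- The logarithmic derivative is `tr(H⁻¹ δH) - tr(D⁻¹ δD)`. The Leibniz rule expands `δH`, the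
blocks of the inverse `B` are expressed through `H⁻¹ = B₁₁` and `D⁻¹`, and cyclic permutation of odd
factors under the trace produces the signs. -/
lemma ber_deriv_blocks (h : IsSuperDer δ d) (hA : SuperMat A) (hB : SuperMat B)
    (hAB : A * B = 1) (hBA : B * A = 1) :
    δ (ber O A) = ber O A * ((B.toBlocks₁₁ * A.toBlocks₁₁.map δ).trace +
      sgn d • (B.toBlocks₁₂ * A.toBlocks₂₁.map δ).trace +
      sgn (1 + d) • (B.toBlocks₂₁ * A.toBlocks₁₂.map δ).trace -
      (B.toBlocks₂₂ * A.toBlocks₂₂.map δ).trace) := by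
  obtain ⟨H, D, hD, hH⟩ := hA.exists_blocks
  have hDu := hA.isUnit_block hB hAB hD
  set Di := (D⁻¹).map ι₀ with hDi
  have d1 : Di * A.toBlocks₂₂ = 1 := hD ▸ map_inv_mul hDu
  have d2 : A.toBlocks₂₂ * Di = 1 := hD ▸ map_mul_inv hDu
  obtain ⟨e12, e21, e22, h1, h2⟩ := inverse_blocks hAB hBA d1 d2
  obtain ⟨K, hK⟩ := hB.gr₁₁.exists_incl
  have hHK : H * K = 1 := incl_inj (by
    rw [Matrix.map_mul, hH, hK, h2, Matrix.map_one _ (map_zero _) (map_one _)])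
  have hHu : IsUnit H.det := IsUnit.of_mul_eq_one K.det (by
    rw [← Matrix.det_mul, hHK, Matrix.det_one])
  have hKi : (H⁻¹).map ι₀ = B.toBlocks₁₁ := by
    rw [← hK, Matrix.inv_eq_right_inv hHK]
  have gDi : MatGr 0 Di := matGr_incl _
  have δDi : Di.map δ = -(Di * A.toBlocks₂₂.map δ * Di) := by
    have h3 := h.map_mul (N := Di) hA.gr₂₂
    rw [d2, mul_zero, sgn_zero, one_smul] at h3
    have h4 : (1 : Matrix (Fin q) (Fin q) (O.sec U)).map δ = 0 := by
      ext i j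
      rw [Matrix.map_apply, Matrix.one_apply]
      split_ifs
      · exact h.one
      · exact map_zero δ
    rw [h4] at h3
    have h5 : A.toBlocks₂₂ * Di.map δ = -(A.toBlocks₂₂.map δ * Di) :=
      (neg_eq_of_add_eq_zero_right h3.symm).symm
    calc Di.map δ = Di * (A.toBlocks₂₂ * Di.map δ) := by
          rw [← Matrix.mul_assoc, d1, Matrix.one_mul]
      _ = _ := by rw [h5, Matrix.mul_neg, Matrix.mul_assoc]
  have δH : (H.map ι₀).map δ = A.toBlocks₁₁.map δ - A.toBlocks₁₂.map δ * Di * A.toBlocks₂₁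
      + sgn d • (A.toBlocks₁₂ * (Di * A.toBlocks₂₂.map δ * Di) * A.toBlocks₂₁)
      - sgn d • (A.toBlocks₁₂ * Di * A.toBlocks₂₁.map δ) := by
    rw [hH, Matrix.map_sub _ (map_sub δ),
      h.map_mul (hA.gr₁₂.mul gDi rfl : MatGr 1 (A.toBlocks₁₂ * Di)), h.map_mul hA.gr₁₂, δDi, mul_one,
      Matrix.add_mul, Matrix.smul_mul, Matrix.mul_neg, Matrix.neg_mul, smul_neg]
    abel
  have tH : (B.toBlocks₁₁ * (H.map ι₀).map δ).trace - (Di * A.toBlocks₂₂.map δ).trace =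
      (B.toBlocks₁₁ * A.toBlocks₁₁.map δ).trace +
      sgn d • (B.toBlocks₁₂ * A.toBlocks₂₁.map δ).trace +
      sgn (1 + d) • (B.toBlocks₂₁ * A.toBlocks₁₂.map δ).trace -
      (B.toBlocks₂₂ * A.toBlocks₂₂.map δ).trace := by
    have g12 : MatGr (1 + d) (A.toBlocks₁₂.map δ) := h.map_gr hA.gr₁₂ rfl
    have g22 : MatGr d (A.toBlocks₂₂.map δ) := h.map_gr hA.gr₂₂ (zero_add d)
    have gDA : MatGr 1 (Di * A.toBlocks₂₁) := gDi.mul hA.gr₂₁ rfl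
    have t2 : (B.toBlocks₁₁ * (A.toBlocks₁₂.map δ * Di * A.toBlocks₂₁)).trace =
        - (sgn (1 + d) • (B.toBlocks₂₁ * A.toBlocks₁₂.map δ).trace) := by
      have := trace_mul_swap (hB.gr₁₁.mul g12 (zero_add (1 + d))) gDA
      rw [mul_one] at this
      rw [e21, Matrix.neg_mul, Matrix.trace_neg, smul_neg, neg_neg]
      simp only [Matrix.mul_assoc] at this ⊢
      exact this
    have t3 : sgn d • (B.toBlocks₁₁ *
        (A.toBlocks₁₂ * (Di * A.toBlocks₂₂.map δ * Di) * A.toBlocks₂₁)).trace =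
        (Di * A.toBlocks₂₂.map δ).trace - (B.toBlocks₂₂ * A.toBlocks₂₂.map δ).trace := by
      have := trace_mul_swap ((((hB.gr₁₁.mul hA.gr₁₂ (zero_add 1)).mul gDi (add_zero 1)).mul g22
        rfl)) gDA
      rw [mul_one] at this
      rw [e22, Matrix.add_mul, Matrix.trace_add]
      simp only [Matrix.mul_assoc] at this ⊢
      rw [this, smul_smul, ← sgn_add, show d + (1 + d) = 1 by clear * -; revert d; decide, sgn_one]
      module
    have t4 : (B.toBlocks₁₁ * (A.toBlocks₁₂ * Di * A.toBlocks₂₁.map δ)).trace =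
        - (B.toBlocks₁₂ * A.toBlocks₂₁.map δ).trace := by
      rw [e12, Matrix.neg_mul, Matrix.trace_neg, neg_neg]
      simp only [Matrix.mul_assoc]
    rw [δH, Matrix.mul_sub, Matrix.mul_add, Matrix.mul_sub, Matrix.trace_sub, Matrix.trace_add,
      Matrix.trace_sub, Matrix.mul_smul, Matrix.mul_smul, Matrix.trace_smul, Matrix.trace_smul,
      t2, t3, t4]
    module
  have hber := ber_eq hD hH
  -- The derivation is applied to this product, so that no inverse of a determinant has to be
  -- differentiated.
  have k1 : ber O A * ι₀ D.det = ι₀ H.det := by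
    rw [hber, ← map_mul, mul_assoc, Ring.inverse_mul_cancel _ hDu, mul_one]
  have k2 := congrArg δ k1
  rw [h.2 0 _ ber_mem, mul_zero, sgn_zero, one_smul, h.det hHu, h.det hDu, hKi, hD, ← k1] at k2
  have hu : IsUnit (ι₀ D.det) := hDu.map ι₀
  rw [← tH, ← hu.mul_left_inj, eq_sub_of_add_eq k2, mul_sub, sub_mul]
  congr 1
  · rw [mul_assoc, mul_assoc, evenIncl_comm]
  · rw [mul_assoc, evenIncl_comm]

/-- The four block traces of `ber_deriv_blocks` assembled into one supertrace over all indices. -/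
lemma ber_deriv (h : IsSuperDer δ d) (hA : SuperMat A) (hB : SuperMat B)
    (hAB : A * B = 1) (hBA : B * A = 1) :
    δ (ber O A) = ber O A * ∑ a, ∑ b,
      sgn (par a * (d + 1) + d * par b) • (B a b * δ (A b a)) := by
  rw [ber_deriv_blocks h hA hB hAB hBA]
  congr 1
  simp only [Fintype.sum_sum_type, par, Sum.elim_inl, Sum.elim_inr, zero_mul, mul_zero, mul_one,
    zero_add, add_zero, one_mul, sgn_zero, one_smul, Finset.sum_add_distrib]
  have e : sgn (d + 1 + d) = -1 := by
    rw [show d + 1 + d = 1 by clear * -; revert d; decide, sgn_one]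
  rw [e, add_comm d 1]
  simp only [← Finset.smul_sum, neg_one_smul, Finset.sum_neg_distrib]
  simp only [Matrix.trace, Matrix.diag, Matrix.mul_apply]
  rw [sub_eq_add_neg, add_right_comm _ (sgn d • _) (sgn (1 + d) • _), add_assoc]
  rfl

end BerDeriv

end SuperDensity

namespace SuperDensity

/-! ### Real powers of superfunctions -/

section RealPowers

lemma hasDerivAt_abs_rpow (w : ℝ) {t : ℝ} (ht : t ≠ 0) :
    HasDerivAt (fun t : ℝ => |t| ^ w) (w * |t| ^ w / t) t := by
  have e : ∀ t : ℝ, t ≠ 0 → |t| ^ w = Real.exp (Real.log t * w) := fun t ht => by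
    rw [Real.rpow_def_of_pos (abs_pos.2 ht), Real.log_abs]
  have he : (fun t : ℝ => |t| ^ w) =ᶠ[nhds t] fun t => Real.exp (Real.log t * w) := by
    filter_upwards [isOpen_ne.mem_nhds ht] with x hx
    exact e x hx
  have h := (((Real.hasDerivAt_log ht).mul_const w).exp).congr_of_eventuallyEq he
  refine h.congr_deriv ?_
  rw [← e t ht]
  field_simp

/-- The derivatives of `|t|^w`. -/
noncomputable def powDeriv (w : ℝ) (k : ℕ) : ℝ → ℝ := iteratedDeriv k fun t : ℝ => |t| ^ w

lemma powDeriv_eq (w : ℝ) (k : ℕ) {t : ℝ} (ht : t ≠ 0) :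
    powDeriv w k t = (∏ i ∈ Finset.range k, (w - i)) * (|t| ^ w * (t ^ k)⁻¹) := by
  induction k generalizing t with
  | zero => simp [powDeriv]
  | succ k ih =>
    have h1 : powDeriv w (k + 1) t = deriv (powDeriv w k) t := by
      rw [powDeriv, iteratedDeriv_succ]
      rfl
    have h2 : powDeriv w k =ᶠ[nhds t]
        fun t => (∏ i ∈ Finset.range k, (w - i)) * (|t| ^ w * (t ^ k)⁻¹) := by
      filter_upwards [isOpen_ne.mem_nhds ht] with x hx
      exact ih hx
    have h3 := ((hasDerivAt_abs_rpow w ht).mul ((hasDerivAt_pow k t).inv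
      (pow_ne_zero k ht))).const_mul (∏ i ∈ Finset.range k, (w - i))
    rw [h1, h2.deriv_eq]
    refine (HasDerivAt.deriv h3).trans ?_
    rw [Finset.prod_range_succ, Pi.inv_apply]
    rw [mul_assoc]
    congr 1
    rcases k with _ | k
    · simp; field_simp
    · simp only [Nat.cast_add, Nat.cast_one, Nat.add_sub_cancel, pow_succ]
      field_simp
      ring

lemma mul_powDeriv_succ (w : ℝ) (k : ℕ) {t : ℝ} (ht : t ≠ 0) :
    t * powDeriv w (k + 1) t = (w - k) * powDeriv w k t := by
  rw [powDeriv_eq w _ ht, powDeriv_eq w _ ht, Finset.prod_range_succ, pow_succ]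
  field_simp

lemma contDiffOn_powDeriv (w : ℝ) (k : ℕ) : ContDiffOn ℝ ∞ (powDeriv w k) {0}ᶜ := by
  have : ContDiffOn ℝ ∞
      (fun t : ℝ => (∏ i ∈ Finset.range k, (w - i)) * (Real.exp (Real.log t * w) * (t ^ k)⁻¹))
      {0}ᶜ := by
    refine contDiffOn_const.mul (ContDiffOn.mul ?_ ?_)
    · exact ((Real.contDiffOn_log.mono (fun t ht => ht)).mul contDiffOn_const).exp
    · exact (contDiffOn_id.pow k).inv fun t ht => pow_ne_zero k ht
  refine this.congr fun t ht => ?_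
  rw [powDeriv_eq w k ht, Real.rpow_def_of_pos (abs_pos.2 ht), Real.log_abs]

lemma hasDerivAt_powDeriv (w : ℝ) (k : ℕ) {t : ℝ} (ht : t ≠ 0) :
    HasDerivAt (powDeriv w k) (powDeriv w (k + 1) t) t := by
  have h1 : powDeriv w (k + 1) t = deriv (powDeriv w k) t := by
    rw [powDeriv, iteratedDeriv_succ]
    rfl
  rw [h1]
  exact (((contDiffOn_powDeriv w k).contDiffAt
    (isOpen_compl_singleton.mem_nhds ht)).differentiableAt (by simp)).hasDerivAt

end RealPowers

/-! ### Real powers of even invertible superfunctions through Taylor expansion. -/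

namespace Coord

variable {X : Type u} [TopologicalSpace X] {O : SuperSheaf.{u, v} X} {p q : ℕ} {V : Opens X}

lemma lift_eq (c : Coord O p q V) (f : smoothFun c.x V) : c.lift f.1 = c.emb f := by
  rw [lift, toSmooth, dif_pos f.2]
  rfl

lemma pd_mul_even (c : Coord O p q V) (a : Idx p q) {s : O.sec V} (hs : s ∈ O.gr V 0)
    (t : O.sec V) : c.pd a (s * t) = c.pd a s * t + s * c.pd a t := by
  rw [c.pd_mul a hs, mul_zero, sgn_zero, one_smul]

lemma pow_even {s : O.sec V} (hs : s ∈ O.gr V 0) (k : ℕ) : s ^ k ∈ O.gr V 0 := by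
  induction k with
  | zero => exact (pow_zero s).symm ▸ SetLike.one_mem_graded (O.gr V)
  | succ k ih => exact (pow_succ s k).symm ▸ graded_mul_mem (O.gr V) ih hs rfl

lemma pd_pow (c : Coord O p q V) (a : Idx p q) {s : O.sec V} (hs : s ∈ O.gr V 0) (k : ℕ) :
    c.pd a (s ^ (k + 1)) = ((k + 1 : ℕ) : ℝ) • (s ^ k * c.pd a s) := by
  induction k with
  | zero => simp
  | succ k ih =>
    rw [pow_succ' s (k + 1), c.pd_mul_even a hs, ih, mul_smul_comm, ← mul_assoc, ← pow_succ',
      ((even_commute (pow_even hs (k + 1))) (c.pd a s)).eq, Nat.cast_succ (k + 1), add_smul,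
      one_smul, add_comm]

/-- The coefficients of the Taylor expansion of `|s|^w`. -/
noncomputable def powCoeff (c : Coord O p q V) (w : ℝ) (s : O.sec V) (k : ℕ) : O.sec V :=
  c.lift fun u => powDeriv w k ((c.body s).1 u)

/-- The nilpotent part of a superfunction. -/
noncomputable def soul (c : Coord O p q V) (s : O.sec V) : O.sec V := s - c.emb (c.body s)

lemma absPow_eq (c : Coord O p q V) (w : ℝ) (s : O.sec V) :
    c.absPow w s = ∑ k ∈ Finset.range (q + 1),
      ((k.factorial : ℝ)⁻¹) • (c.powCoeff w s k * c.soul s ^ k) := by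
  simp only [absPow, powCoeff, soul, lift_eq]
  rfl

lemma soul_mem (c : Coord O p q V) {s : O.sec V} (hs : s ∈ O.gr V 0) : c.soul s ∈ O.gr V 0 :=
  Submodule.sub_mem _ hs (c.emb_mem _)

lemma bodyFun_soul (c : Coord O p q V) (s : O.sec V) : c.bodyFun (c.soul s) = 0 := by
  rw [soul, map_sub, bodyFun_emb, body_eq, sub_self]

lemma soul_pow (c : Coord O p q V) {s : O.sec V} (hs : s ∈ O.gr V 0) {n : ℕ} (hn : n ≠ 0)
    (hq : q ≤ n) : c.soul s ^ n = 0 :=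
  c.ev_ext fun u => by
    rw [map_pow, map_zero]
    exact even_pow_eq_zero (c.ev_mem u (c.soul_mem hs)) (congrFun (c.bodyFun_soul s) u) hn hq

/-- This is the top term by which the derivative of the Taylor sum truncated at `q` could differ
from the truncated Taylor sum of the derivative. For `q = 0` the soul itself is zero; otherwise its
`q`-th power is. -/
lemma soul_pow_mul_pd (c : Coord O p q V) {s : O.sec V} (hs : s ∈ O.gr V 0) (a : Idx p q) :
    c.soul s ^ q * c.pd a (c.soul s) = 0 := by
  by_cases hq : q = 0
  · have := c.soul_pow hs one_ne_zero (by omega)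
    rw [pow_one] at this
    rw [this, map_zero, mul_zero]
  · rw [c.soul_pow hs hq le_rfl, zero_mul]

variable (c : Coord O p q V) {s : O.sec V}

lemma body_ne_zero (hu : IsUnit s) (u : V) : (c.body s).1 u ≠ 0 := by
  rw [body_eq]
  exact c.bodyFun_ne_zero_of_isUnit hu u

lemma powCoeff_eq (hu : IsUnit s) (w : ℝ) (k : ℕ) : ∃ f : smoothFun c.x V,
    c.powCoeff w s k = c.emb f ∧ ∀ u, f.1 u = powDeriv w k ((c.body s).1 u) := by
  have := comp_mem_smoothFun c.x (c.body s) (contDiffOn_powDeriv w k) (c.body_ne_zero hu)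
  exact ⟨⟨_, this⟩, c.lift_eq ⟨_, this⟩, fun _ => rfl⟩

lemma powCoeff_mem (hu : IsUnit s) (w : ℝ) (k : ℕ) : c.powCoeff w s k ∈ O.gr V 0 := by
  obtain ⟨f, hf, -⟩ := c.powCoeff_eq hu w k
  rw [hf]
  exact c.emb_mem f

lemma pd_powCoeff (hu : IsUnit s) (w : ℝ) (k : ℕ) (a : Idx p q) :
    c.pd a (c.powCoeff w s k) = c.powCoeff w s (k + 1) * c.pd a (c.emb (c.body s)) := by
  obtain ⟨f, hf, hfu⟩ := c.powCoeff_eq hu w k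
  obtain ⟨f', hf', hfu'⟩ := c.powCoeff_eq hu w (k + 1)
  rw [hf, hf']
  cases a with
  | inl a =>
    rw [emb_apply, emb_apply, emb_apply, pd_inl, pd_inl, ← map_mul,
      Algebra.TensorProduct.tmul_mul_tmul, mul_one]
    congr 2
    ext u
    have := smoothPd_comp c.x c.isOpen_image a (c.body s) f (powDeriv w k) (powDeriv w (k + 1))
      (fun u => hasDerivAt_powDeriv w k (c.body_ne_zero hu u)) hfu u
    rw [this, ← hfu']
    rfl
  | inr b =>
    rw [emb_apply, emb_apply, emb_apply, pd_inr, pd_inr, contr_one, TensorProduct.tmul_zero,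
      TensorProduct.tmul_zero, map_zero, mul_zero]

lemma body_mul_powCoeff (hu : IsUnit s) (w : ℝ) (k : ℕ) :
    c.emb (c.body s) * c.powCoeff w s (k + 1) = (w - k) • c.powCoeff w s k := by
  obtain ⟨f, hf, hfu⟩ := c.powCoeff_eq hu w k
  obtain ⟨f', hf', hfu'⟩ := c.powCoeff_eq hu w (k + 1)
  rw [hf, hf', ← map_mul, ← map_smul]
  congr 1
  ext u
  change (c.body s).1 u * f'.1 u = (w - k) * f.1 u
  rw [hfu, hfu', mul_powDeriv_succ w k (c.body_ne_zero hu u)]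

lemma absPow_mem (hs : s ∈ O.gr V 0) (hu : IsUnit s) (w : ℝ) : c.absPow w s ∈ O.gr V 0 := by
  rw [absPow_eq]
  exact Submodule.sum_mem _ fun k _ => Submodule.smul_mem _ _
    (graded_mul_mem (O.gr V) (c.powCoeff_mem hu w k) (pow_even (c.soul_mem hs) k) rfl)

lemma bodyFun_absPow (hu : IsUnit s) (w : ℝ) (u : V) :
    c.bodyFun (c.absPow w s) u = |c.bodyFun s u| ^ w := by
  obtain ⟨f, hf, hfu⟩ := c.powCoeff_eq hu w 0
  rw [absPow_eq, Finset.sum_range_succ', map_add, map_sum]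
  have : ∀ k ∈ Finset.range q, c.bodyFun ((((k + 1).factorial : ℝ)⁻¹) •
      (c.powCoeff w s (k + 1) * c.soul s ^ (k + 1))) = 0 := fun k _ => by
    rw [map_smul, map_mul, map_pow, bodyFun_soul, pow_succ, mul_zero, mul_zero, smul_zero]
  rw [Finset.sum_eq_zero this, zero_add, hf, Nat.factorial_zero, Nat.cast_one, inv_one, one_smul,
    pow_zero, mul_one, bodyFun_emb, hfu, body_eq]
  simp [powDeriv]

lemma isUnit_absPow (hu : IsUnit s) (w : ℝ) : IsUnit (c.absPow w s) :=
  c.isUnit_of_bodyFun_ne_zero fun u => by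
    rw [c.bodyFun_absPow hu]
    exact (Real.rpow_pos_of_pos (abs_pos.2 (c.bodyFun_ne_zero_of_isUnit hu u)) w).ne'

/-- The differential equation `s ∂(|s|^w) = w |s|^w ∂s`. Differentiating the Taylor sum of `F =
|t|^w` term by term gives `T * ∂s`, where `T` is the Taylor sum of `F'`. The identities `t F^{(k+1)}
= (w - k) F^{(k)}` for the body, together with the shift of index caused by multiplying with the
soul, give `s * T = w |s|^w`. -/
lemma mul_pd_absPow (hs : s ∈ O.gr V 0) (hu : IsUnit s) (w : ℝ) (a : Idx p q) :
    s * c.pd a (c.absPow w s) = w • (c.absPow w s * c.pd a s) := by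
  set n := c.soul s with hn
  set b := c.emb (c.body s) with hb
  have hsn : s = b + n := by rw [hn, soul, add_sub_cancel]
  set F := c.powCoeff w s with hF
  have hFm : ∀ k, F k ∈ O.gr V 0 := c.powCoeff_mem hu w
  have hnm : n ∈ O.gr V 0 := c.soul_mem hs
  have hbm : b ∈ O.gr V 0 := c.emb_mem _
  have hcomm : ∀ {x : O.sec V}, x ∈ O.gr V 0 → ∀ y, x * y = y * x := fun hx y => even_commute hx y
  let T : O.sec V := ∑ k ∈ Finset.range (q + 1), ((k.factorial : ℝ)⁻¹) • (F (k + 1) * n ^ k)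
  have h1 : c.pd a (c.absPow w s) = T * c.pd a s := by
    have e0 : ∀ k, c.pd a (F k * n ^ k) = F (k + 1) * n ^ k * c.pd a b + F k * c.pd a (n ^ k) := by
      intro k
      rw [c.pd_mul_even a (hFm k), hF, c.pd_powCoeff hu, mul_assoc, mul_assoc,
        hcomm (pow_even hnm k)]
    have e1 : c.pd a (c.absPow w s) = T * c.pd a b +
        ∑ k ∈ Finset.range (q + 1), ((k.factorial : ℝ)⁻¹) • (F k * c.pd a (n ^ k)) := by
      rw [absPow_eq, map_sum, Finset.sum_mul, ← Finset.sum_add_distrib]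
      refine Finset.sum_congr rfl fun k _ => ?_
      rw [map_smul, e0, smul_add, smul_mul_assoc]
    have e2 : ∑ k ∈ Finset.range (q + 1), ((k.factorial : ℝ)⁻¹) • (F k * c.pd a (n ^ k)) =
        T * c.pd a n := by
      rw [Finset.sum_range_succ', pow_zero, c.pd_one, mul_zero, smul_zero, add_zero,
        Finset.sum_mul, Finset.sum_range_succ, smul_mul_assoc _ _ (c.pd a n), mul_assoc,
        hn, c.soul_pow_mul_pd hs, mul_zero, smul_zero, add_zero]
      refine Finset.sum_congr rfl fun k _ => ?_
      rw [c.pd_pow a (c.soul_mem hs), mul_smul_comm, smul_smul, smul_mul_assoc, mul_assoc,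
        Nat.factorial_succ]
      congr 1
      push_cast
      field_simp
    rw [e1, e2, ← mul_add, ← map_add, ← hsn]
  have h2 : s * T = w • c.absPow w s := by
    have e1 : b * T = ∑ k ∈ Finset.range (q + 1),
        (((k.factorial : ℝ)⁻¹) * (w - k)) • (F k * n ^ k) := by
      rw [Finset.mul_sum]
      refine Finset.sum_congr rfl fun k _ => ?_
      rw [mul_smul_comm, ← mul_assoc, c.body_mul_powCoeff hu, smul_mul_assoc, smul_smul]
    have e2 : n * T = ∑ k ∈ Finset.range (q + 1),
        (((k.factorial : ℝ)⁻¹) * k) • (F k * n ^ k) := by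
      have e3 : n * T = ∑ k ∈ Finset.range (q + 1),
          ((((k + 1).factorial : ℝ)⁻¹) * (k + 1 : ℕ)) • (F (k + 1) * n ^ (k + 1)) := by
        rw [Finset.mul_sum]
        refine Finset.sum_congr rfl fun k _ => ?_
        rw [mul_smul_comm, ← mul_assoc, hcomm hnm, mul_assoc, pow_succ', Nat.factorial_succ]
        congr 1
        push_cast
        field_simp
      rw [e3, Finset.sum_range_succ, c.soul_pow hs (by omega) (by omega), mul_zero, smul_zero,
        add_zero, Finset.sum_range_succ']
      simp
    rw [absPow_eq]
    nth_rw 1 [hsn]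
    rw [add_mul, e1, e2, ← Finset.sum_add_distrib, Finset.smul_sum]
    refine Finset.sum_congr rfl fun k _ => ?_
    rw [← add_smul, smul_smul]
    congr 1
    ring
  rw [h1, ← mul_assoc, h2, smul_mul_assoc]

lemma eq_one_of_pd_odd {z : O.sec V} (h : ∀ b, c.pd (.inr b) z = 0)
    (hb : ∀ u, c.bodyFun z u = 1) : z = 1 :=
  c.ev_ext fun u => by
    have := eq_algebraMap_of_contr_eq_zero (x := c.ev u z) fun b => by
      rw [← ev_pd_inr, h, map_zero]
    have h1 : aug (c.ev u z) = 1 := hb u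
    rw [this, h1, map_one, map_one]

lemma absPow_neg_mul (hs : s ∈ O.gr V 0) (hu : IsUnit s) (w : ℝ) {E : O.sec V}
    (hE : E ∈ O.gr V 0) (h : ∀ b, s * c.pd (.inr b) E = w • (E * c.pd (.inr b) s))
    (hb : ∀ u, c.bodyFun E u = |c.bodyFun s u| ^ w) : c.absPow (-w) s * E = 1 := by
  refine c.eq_one_of_pd_odd (fun b => ?_) fun u => ?_
  · have hP := c.absPow_mem hs hu (-w)
    rw [← hu.mul_right_inj, mul_zero, c.pd_mul_even _ hP, mul_add, ← mul_assoc,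
      c.mul_pd_absPow hs hu, ← mul_assoc, (even_commute hs (c.absPow (-w) s)).eq, mul_assoc _ s, h,
      mul_smul_comm, smul_mul_assoc, mul_assoc, (even_commute hE _).eq, neg_smul, neg_add_cancel]
  · have hne := c.bodyFun_ne_zero_of_isUnit hu u
    rw [map_mul, Pi.mul_apply, hb, c.bodyFun_absPow hu, ← Real.rpow_add (abs_pos.2 hne),
      neg_add_cancel, Real.rpow_zero]

/-- By `absPow_neg_mul`, both `E` and `absPow w s` are inverse to `absPow (-w) s`: the product has
vanishing odd derivatives and body 1, hence equals 1. With this characterisation, multiplicativity,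
additivity of exponents, independence of the chart and compatibility with restriction need no
manipulation of Taylor sums. -/
lemma absPow_unique (hs : s ∈ O.gr V 0) (hu : IsUnit s) (w : ℝ) {E : O.sec V}
    (hE : E ∈ O.gr V 0) (h : ∀ b, s * c.pd (.inr b) E = w • (E * c.pd (.inr b) s))
    (hb : ∀ u, c.bodyFun E u = |c.bodyFun s u| ^ w) : c.absPow w s = E := by
  have h1 := c.absPow_neg_mul hs hu w hE h hb
  have h2 := c.absPow_neg_mul hs hu w (c.absPow_mem hs hu w)
    (fun b => c.mul_pd_absPow hs hu w _) (c.bodyFun_absPow hu w)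
  exact (c.isUnit_absPow hu (-w)).mul_left_cancel (h2.trans h1.symm)

lemma absPow_one_base (w : ℝ) : c.absPow w 1 = 1 :=
  c.absPow_unique (SetLike.one_mem_graded (O.gr V)) isUnit_one w (SetLike.one_mem_graded (O.gr V))
    (fun b => by rw [c.pd_one, mul_zero, smul_zero]) fun u => by
      rw [map_one, Pi.one_apply, abs_one, Real.one_rpow]

lemma absPow_zero (hs : s ∈ O.gr V 0) (hu : IsUnit s) : c.absPow 0 s = 1 :=
  c.absPow_unique hs hu 0 (SetLike.one_mem_graded (O.gr V))
    (fun b => by rw [c.pd_one, mul_zero, zero_smul]) fun u => by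
      rw [map_one, Pi.one_apply, Real.rpow_zero]

lemma absPow_add (hs : s ∈ O.gr V 0) (hu : IsUnit s) (w w' : ℝ) :
    c.absPow (w + w') s = c.absPow w s * c.absPow w' s := by
  have h := c.absPow_mem hs hu w
  have h' := c.absPow_mem hs hu w'
  refine c.absPow_unique hs hu _ (graded_mul_mem (O.gr V) h h' rfl) (fun b => ?_) fun u => ?_
  · rw [c.pd_mul_even _ h, mul_add, ← mul_assoc, c.mul_pd_absPow hs hu, ← mul_assoc s,
      (even_commute hs (c.absPow w s)).eq, mul_assoc _ s, c.mul_pd_absPow hs hu, mul_smul_comm,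
      smul_mul_assoc, mul_assoc, (even_commute h' _).eq.symm, mul_assoc, ← add_smul]
  · rw [map_mul, Pi.mul_apply, c.bodyFun_absPow hu, c.bodyFun_absPow hu,
      ← Real.rpow_add (abs_pos.2 (c.bodyFun_ne_zero_of_isUnit hu u))]

lemma absPow_mul {t : O.sec V} (hs : s ∈ O.gr V 0) (hu : IsUnit s) (ht : t ∈ O.gr V 0)
    (hu' : IsUnit t) (w : ℝ) : c.absPow w (s * t) = c.absPow w s * c.absPow w t := by
  have h := c.absPow_mem hs hu w
  have h' := c.absPow_mem ht hu' w
  refine c.absPow_unique (graded_mul_mem (O.gr V) hs ht rfl) (hu.mul hu') _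
    (graded_mul_mem (O.gr V) h h' rfl) (fun b => ?_) fun u => ?_
  · rw [c.pd_mul_even _ h, c.pd_mul_even _ hs]
    have e1 : s * t * (c.pd (.inr b) (c.absPow w s) * c.absPow w t) =
        (s * c.pd (.inr b) (c.absPow w s)) * (t * c.absPow w t) := by
      rw [(even_commute hs t).eq, mul_assoc, ← mul_assoc s, (even_commute ht _).eq, mul_assoc,
        (even_commute ht (c.absPow w t)).eq]
    have e2 : s * t * (c.absPow w s * c.pd (.inr b) (c.absPow w t)) =
        s * c.absPow w s * (t * c.pd (.inr b) (c.absPow w t)) := by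
      rw [mul_assoc, ← mul_assoc t, (even_commute ht (c.absPow w s)).eq, mul_assoc, mul_assoc]
    rw [mul_add, e1, e2, c.mul_pd_absPow hs hu, c.mul_pd_absPow ht hu', smul_mul_assoc,
      mul_smul_comm, ← smul_add]
    congr 1
    rw [mul_add, (even_commute ht (c.absPow w t)).eq]
    congr 1
    · simp only [mul_assoc]
      rw [← mul_assoc (c.pd _ s), (even_commute h' (c.pd (.inr b) s)).eq.symm, mul_assoc]
    · rw [(even_commute hs (c.absPow w s)).eq]
      simp only [mul_assoc]
      rw [← mul_assoc s, (even_commute hs (c.absPow w t)).eq, mul_assoc]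
  · rw [map_mul, Pi.mul_apply, c.bodyFun_absPow hu, c.bodyFun_absPow hu', map_mul, Pi.mul_apply,
      abs_mul, Real.mul_rpow (abs_nonneg _) (abs_nonneg _)]

/-- The chain rule carries the differential equation from `c'` to `c`. It mixes even and odd
directions, so the equation is needed for all derivatives with respect to `c'`. -/
lemma absPow_indep (c' : Coord O p q V) (hs : s ∈ O.gr V 0) (hu : IsUnit s) (w : ℝ) :
    c.absPow w s = c'.absPow w s := by
  refine c.absPow_unique hs hu w (c'.absPow_mem hs hu w) (fun b => ?_) fun u => ?_
  · rw [c.chain_rule c', c.chain_rule c', Finset.mul_sum, Finset.mul_sum, Finset.smul_sum]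
    refine Finset.sum_congr rfl fun a _ => ?_
    rw [← mul_assoc, (even_commute hs _).eq, mul_assoc, c'.mul_pd_absPow hs hu, mul_smul_comm,
      ← mul_assoc, ← mul_assoc, (even_commute (c'.absPow_mem hs hu w) _).eq]
  · rw [c.bodyFun_indep c', c'.bodyFun_absPow hu]

lemma res_absPow {W : Opens X} (hW : W ≤ V) (hs : s ∈ O.gr V 0) (hu : IsUnit s) (w : ℝ) :
    O.res hW (c.absPow w s) = (c.restrict hW).absPow w (O.res hW s) := by
  refine ((c.restrict hW).absPow_unique (O.res_gr hW _ _ hs) (hu.map (O.res hW)) w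
    (O.res_gr hW _ _ (c.absPow_mem hs hu w)) (fun b => ?_) fun u => ?_).symm
  · rw [← res_pd, ← res_pd, ← map_mul, c.mul_pd_absPow hs hu, map_smul, map_mul]
  · rw [bodyFun_res, bodyFun_res, c.bodyFun_absPow hu]

end Coord

end SuperDensity

namespace SuperDensity

/-! ### Jacobians -/

namespace Coord

variable {X : Type u} [TopologicalSpace X] {O : SuperSheaf.{u, v} X} {p q : ℕ} {V : Opens X}
  (c c' c'' : Coord O p q V)

lemma jac_eq : c.jac c' = ber O (c.jacMat c') := rfl

lemma superMat_jacMat : SuperMat (c.jacMat c') := c.jacMat_mem c'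

lemma jacMat_mul_inv : c.jacMat c' * c'.jacMat c = 1 := by
  rw [← jacMat_mul, jacMat_self]

lemma jac_mul : c.jac c'' = c.jac c' * c'.jac c'' := by
  rw [jac_eq, jac_eq, jac_eq, c.jacMat_mul c' c'']
  exact ber_mul_of_inv (c.superMat_jacMat c') (c'.superMat_jacMat c'') (c'.superMat_jacMat c)
    (c''.superMat_jacMat c') (c.jacMat_mul_inv c') (c'.jacMat_mul_inv c'')

lemma jac_self : c.jac c = 1 := by
  rw [jac_eq, jacMat_self, ber_one]

lemma jac_mem : c.jac c' ∈ O.gr V 0 := ber_mem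

lemma isUnit_jac : IsUnit (c.jac c') := by
  refine ⟨⟨c.jac c', c'.jac c, ?_, ?_⟩, rfl⟩ <;> rw [← jac_mul, jac_self]

/-- Restriction of even sections. -/
def resEven (O : SuperSheaf.{u, v} X) {W : Opens X} (h : W ≤ V) : O.gr V 0 →+* O.gr W 0 where
  toFun s := ⟨O.res h s, O.res_gr h _ _ s.2⟩
  map_one' := Subtype.ext (map_one (O.res h))
  map_mul' s t := Subtype.ext (map_mul (O.res h) s.1 t.1)
  map_zero' := Subtype.ext (map_zero (O.res h))
  map_add' s t := Subtype.ext (map_add (O.res h) s.1 t.1)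

lemma res_jac {W : Opens X} (h : W ≤ V) :
    O.res h (c.jac c') = (c.restrict h).jac (c'.restrict h) := by
  obtain ⟨H, D, hD, hH⟩ := (c.superMat_jacMat c').exists_blocks
  have hDu := (c.superMat_jacMat c').isUnit_block (c'.superMat_jacMat c) (c.jacMat_mul_inv c') hD
  have hmat : (c.restrict h).jacMat (c'.restrict h) = (c.jacMat c').map (O.res h) := by
    ext a b
    exact (c.res_jacMat c' h a b).symm
  have hcomp : ∀ {m n : Type} (N : Matrix m n (O.gr V 0)),
      (N.map (resEven O h)).map (evenIncl O W) = (N.map (evenIncl O V)).map (O.res h) :=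
    fun N => rfl
  have hDi : (D.map (resEven O h))⁻¹ = (D⁻¹).map (resEven O h) := by
    apply Matrix.inv_eq_right_inv
    rw [← Matrix.map_mul, Matrix.mul_nonsing_inv _ hDu, Matrix.map_one _ (map_zero _) (map_one _)]
  have h22 : (D.map (resEven O h)).map (evenIncl O W) =
      ((c.restrict h).jacMat (c'.restrict h)).toBlocks₂₂ := by
    rw [hcomp, hD, hmat]
    rfl
  have h11 : (H.map (resEven O h)).map (evenIncl O W) =
      ((c.restrict h).jacMat (c'.restrict h)).toBlocks₁₁ -
      ((c.restrict h).jacMat (c'.restrict h)).toBlocks₁₂ *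
        ((D.map (resEven O h))⁻¹).map (evenIncl O W) *
      ((c.restrict h).jacMat (c'.restrict h)).toBlocks₂₁ := by
    rw [hcomp, hH, hmat, hDi, hcomp, Matrix.map_sub _ (map_sub _), Matrix.map_mul, Matrix.map_mul]
    rfl
  rw [jac_eq, jac_eq, ber_eq hD hH, ber_eq h22 h11]
  have e1 : (H.map (resEven O h)).det = resEven O h H.det := (RingHom.map_det _ _).symm
  have e2 : (D.map (resEven O h)).det = resEven O h D.det := (RingHom.map_det _ _).symm
  obtain ⟨d, hd⟩ := hDu
  have e3 : Ring.inverse (resEven O h D.det) = resEven O h (Ring.inverse D.det) := by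
    rw [← hd, Ring.inverse_unit]
    exact Ring.inverse_unit (Units.map (resEven O h).toMonoidHom d)
  rw [e1, e2, e3, ← map_mul]
  rfl

lemma isSuperDer_pd (a : Idx p q) : IsSuperDer (c.pd a : O.sec V →+ O.sec V) (par a) :=
  ⟨fun _ _ hs => c.pd_mem a hs, fun _ _ hs t => c.pd_mul a hs t⟩

/-- The logarithmic derivative of the Jacobian. -/
noncomputable def logJac (a : Idx p q) : O.sec V :=
  ∑ a', sgn (par a' * (par a + 1)) • c'.pd a' (c.jacMat c' a a')

lemma pd_jacMat_comm (a b a' : Idx p q) :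
    c.pd b (c.jacMat c' a a') = sgn (par a * par b) • c.pd a (c.jacMat c' b a') := by
  have := c.pd_comm b a (c'.coord a')
  rwa [mul_comm] at this

/-- `ber_deriv` gives the supertrace of the inverse Jacobian matrix with the derivative of the
Jacobian matrix. Mixed second derivatives of the new coordinates supercommute, so the inverse matrix
is contracted with a derivative index; by the chain rule this yields derivatives in the new
coordinates, that is, `logJac`. -/
lemma pd_jac (a : Idx p q) : c.pd a (c.jac c') = c.jac c' * c.logJac c' a := by
  have := ber_deriv (c.isSuperDer_pd a) (c.superMat_jacMat c') (c'.superMat_jacMat c)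
    (c.jacMat_mul_inv c') (c'.jacMat_mul_inv c)
  refine this.trans ?_
  rw [← jac_eq]
  congr 1
  refine Finset.sum_congr rfl fun a' _ => ?_
  rw [c'.chain_rule c, Finset.smul_sum]
  refine Finset.sum_congr rfl fun b _ => ?_
  rw [c.pd_jacMat_comm c' a b a', mul_smul_comm, smul_smul, ← sgn_add]
  rfl

lemma logJac_mem (a : Idx p q) : c.logJac c' a ∈ O.gr V (par a) := by
  refine Submodule.sum_mem _ fun a' _ => Submodule.smul_mem _ _ ?_
  have := c'.pd_mem a' (c.jacMat_mem c' a a')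
  rwa [show par a + par a' + par a' = par a by
    generalize par a = x; generalize par a' = y; clear * -; revert x y; decide] at this

lemma pd_absPow_jac (w : ℝ) (a : Idx p q) :
    c.pd a (c.absPow w (c.jac c')) = w • (c.absPow w (c.jac c') * c.logJac c' a) := by
  have hu := c.isUnit_jac c'
  rw [← hu.mul_right_inj, c.mul_pd_absPow (c.jac_mem c') hu, c.pd_jac, mul_smul_comm, ← mul_assoc,
    ← mul_assoc, (even_commute (c.jac_mem c') _).eq]

/-- In the Leibniz rule, the terms differentiating `W` collapse by the chain rule to the divergence
in the old coordinates, and the terms differentiating the Jacobian matrix are `logJac`. -/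
lemma divergence (W : Idx p q → O.sec V) :
    ∑ a', c'.pd a' (∑ a, sgn (par a' * (par a + 1)) • (c.jacMat c' a a' * W a)) =
      ∑ a, (c.pd a (W a) + c.logJac c' a * W a) := by
  have e : ∀ a' a, c'.pd a' (sgn (par a' * (par a + 1)) • (c.jacMat c' a a' * W a)) =
      c.jacMat c' a a' * c'.pd a' (W a) +
        sgn (par a' * (par a + 1)) • c'.pd a' (c.jacMat c' a a') * W a := by
    intro a' a
    rw [map_smul, c'.pd_mul a' (c.jacMat_mem c' a a'), smul_add, smul_smul, ← sgn_add,
      show par a' * (par a + 1) + par a' * (par a + par a') = 0 by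
        generalize par a = x; generalize par a' = y; clear * -; revert x y; decide,
      sgn_zero, one_smul, smul_mul_assoc, add_comm]
  simp only [map_sum, e]
  rw [Finset.sum_comm]
  refine Finset.sum_congr rfl fun a _ => ?_
  rw [Finset.sum_add_distrib, ← c.chain_rule c', ← Finset.sum_mul]
  rfl

end Coord

/-! ### Densities with a given coefficient -/

section Densities

variable {X : Type u} [TopologicalSpace X] {p q : ℕ} {M : Supermanifold.{u, v} X p q}
  {V : Opens X}

/-- The density with coefficient `s` in the coordinates `c`. -/
noncomputable def mkDensity (c : Chart M V) (w : ℝ) (s : M.sec V) : Density M w V :=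
  ⟨fun V' c' => c'.absPow w (c'.jac (c.restrict V'.2)) * M.res V'.2 s, by
    refine ⟨fun V₁ V₂ h₁ h c₁ => ?_, fun V₁ h₁ c₁ c₂ => ?_⟩
    · rw [map_mul, c₁.res_absPow h (c₁.jac_mem _) (c₁.isUnit_jac _), c₁.res_jac, M.res_res]
      rfl
    · change c₁.absPow w (c₁.jac (c.restrict h₁)) * M.res h₁ s =
        c₁.absPow w (c₁.jac c₂) * (c₂.absPow w (c₂.jac (c.restrict h₁)) * M.res h₁ s)
      rw [c₁.jac_mul c₂ (c.restrict h₁), c₁.absPow_mul (c₁.jac_mem _) (c₁.isUnit_jac _) (c₂.jac_mem _)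
        (c₂.isUnit_jac _), c₁.absPow_indep c₂ (c₂.jac_mem _) (c₂.isUnit_jac _), mul_assoc]⟩

lemma coeff_mkDensity (c : Chart M V) (w : ℝ) (s : M.sec V) : coeff c (mkDensity c w s) = s := by
  change c.absPow w (c.jac c) * M.res le_rfl s = s
  rw [c.jac_self, c.absPow_one_base, one_mul, M.res_refl]

lemma coeff_change {w : ℝ} (c c' : Chart M V) (ψ : Density M w V) :
    coeff c ψ = c.absPow w (c.jac c') * coeff c' ψ := ψ.2.2 V le_rfl c c'

lemma coeff_res {w : ℝ} {W : Opens X} (h : W ≤ V) (c : Chart M V) (ψ : Density M w V) :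
    coeff (c.restrict h) (resDensity h ψ) = M.res h (coeff c ψ) :=
  (ψ.2.1 V W le_rfl h c).symm

lemma coeff_app {w : ℝ} (L : DensityOp M w) {U : Opens X} (h : V ≤ U) (c : Chart M V)
    (ψ : Density M w U) : (L.app U ψ).1 ⟨V, h⟩ c = coeff c (L.app V (resDensity h ψ)) := by
  rw [L.app_res]
  rfl

lemma densityOp_ext {w : ℝ} {L L' : DensityOp M w}
    (h : ∀ (V : Opens X) (c : Chart M V) (ψ : Density M w V),
      coeff c (L.app V ψ) = coeff c (L'.app V ψ)) : L = L' := by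
  ext U ψ V c
  rw [coeff_app, coeff_app, h]

end Densities

end SuperDensity

namespace SuperDensity

/-! ### Second-order operators in coordinates -/

namespace Coord

variable {X : Type u} [TopologicalSpace X] {O : SuperSheaf.{u, v} X} {p q : ℕ} {V : Opens X}
  (c c' : Coord O p q V) (ε : ZMod 2)

/-- The operator `½ S^{ab} ∂_b ∂_a + T^a ∂_a + R`. -/
noncomputable def op (S : Idx p q → Idx p q → O.sec V) (T : Idx p q → O.sec V) (R : O.sec V)
    (s : O.sec V) : O.sec V :=
  (1 / 2 : ℝ) • (∑ a, ∑ b, S a b * c.pd b (c.pd a s)) + (∑ a, T a * c.pd a s) + R * s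

/-- The components of a (super)symmetric tensor of parity `ε`. -/
structure IsSymbol (S : Idx p q → Idx p q → O.sec V) : Prop where
  mem : ∀ a b, S a b ∈ O.gr V (ε + par a + par b)
  symm : ∀ a b, S a b = sgn (par a * par b) • S b a

/-- The divergence `(-1)^{a(ε+1)} ∂_a Q^a`. -/
noncomputable def dvg (Q : Idx p q → O.sec V) : O.sec V :=
  ∑ a, sgn (par a * (ε + 1)) • c.pd a (Q a)

/-- The subprincipal components `(-1)^{b(ε+1)} ∂_b S^{ba}`. -/
noncomputable def dvgS (S : Idx p q → Idx p q → O.sec V) (a : Idx p q) : O.sec V :=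
  ∑ b, sgn (par b * (ε + 1)) • c.pd b (S b a)

/-- The first-order coefficients of the canonical pencil. -/
noncomputable def canonT (S : Idx p q → Idx p q → O.sec V) (γ : Idx p q → O.sec V) (w : ℝ)
    (a : Idx p q) : O.sec V :=
  (1 / 2 : ℝ) • (c.dvgS ε S a + (2 * w - 1) • γ a)

/-- The zeroth-order coefficient of the canonical pencil. -/
noncomputable def canonR (γ : Idx p q → O.sec V) (θ : O.sec V) (w : ℝ) : O.sec V :=
  (1 / 2 : ℝ) • (w • c.dvg ε γ + (w * (w - 1)) • θ)

/-- The canonical pencil. -/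
noncomputable def canon (S : Idx p q → Idx p q → O.sec V) (γ : Idx p q → O.sec V) (θ : O.sec V)
    (w : ℝ) : O.sec V → O.sec V :=
  c.op S (c.canonT ε S γ w) (c.canonR ε γ θ w)

/-- The Lie derivative. -/
noncomputable def lie (Q : Idx p q → O.sec V) (w : ℝ) (s : O.sec V) : O.sec V :=
  (∑ a, Q a * c.pd a s) + w • (c.dvg ε Q * s)

/-- The vector `S^{ab} ℓ_b`. -/
noncomputable def raise (S : Idx p q → Idx p q → O.sec V) (ℓ : Idx p q → O.sec V) (a : Idx p q) :
    O.sec V :=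
  ∑ b, S a b * ℓ b

/-- The Laplace--Beltrami operator in terms of the logarithmic derivatives `ℓ_a` of the volume
form. -/
noncomputable def lb (S : Idx p q → Idx p q → O.sec V) (ℓ : Idx p q → O.sec V) (w : ℝ)
    (s : O.sec V) : O.sec V :=
  (1 / 2 : ℝ) • ∑ a, sgn (par a * (ε + 1)) •
    (c.pd a (raise S (fun b => c.pd b s - w • (ℓ b * s)) a) +
      (1 - w) • (ℓ a * raise S (fun b => c.pd b s - w • (ℓ b * s)) a))

variable {c c' ε} {S S' : Idx p q → Idx p q → O.sec V} {T T' : Idx p q → O.sec V} {R R' : O.sec V}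

lemma pd_pd_coord (a b d : Idx p q) : c.pd b (c.pd a (c.coord d)) = 0 := by
  rw [pd_coord]
  split_ifs
  · exact c.pd_one b
  · exact map_zero _

lemma op_one : c.op S T R 1 = R := by
  simp [op, c.pd_one]

lemma op_coord (d : Idx p q) : c.op S T R (c.coord d) = T d + R * c.coord d := by
  simp only [op, pd_pd_coord, mul_zero, Finset.sum_const_zero, smul_zero, zero_add]
  simp only [c.pd_coord, mul_ite, mul_one, mul_zero, Finset.sum_ite_eq', Finset.mem_univ, if_true]

lemma op_coord_mul (hS : ∀ a b, S a b = sgn (par a * par b) • S b a) (d e : Idx p q) :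
    c.op S T R (c.coord d * c.coord e) = S d e + (T d * c.coord e +
      sgn (par e * par d) • (T e * c.coord d)) + R * (c.coord d * c.coord e) := by
  have h1 : ∀ a, c.pd a (c.coord d * c.coord e) = (if a = d then c.coord e else 0) +
      sgn (par e * par d) • (if a = e then c.coord d else 0) := by
    intro a
    rw [c.pd_mul a (c.coord_mem d), c.pd_coord, c.pd_coord, ite_mul, one_mul, zero_mul, mul_ite,
      mul_one, mul_zero]
    congr 1
    split_ifs with h
    · rw [h]
    · rw [smul_zero, smul_zero]
  have h2 : ∀ a b, c.pd b (c.pd a (c.coord d * c.coord e)) = (if a = d then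
      (if b = e then 1 else 0) else 0) + sgn (par e * par d) • (if a = e then
      (if b = d then 1 else 0) else 0) := by
    intro a b
    rw [h1, map_add, map_smul]
    congr 1
    · by_cases h : a = d
      · rw [if_pos h, if_pos h, c.pd_coord]
      · rw [if_neg h, if_neg h, map_zero]
    · congr 1
      by_cases h : a = e
      · rw [if_pos h, if_pos h, c.pd_coord]
      · rw [if_neg h, if_neg h, map_zero]
  simp only [op, h2]
  simp only [h1, mul_add, Finset.sum_add_distrib, mul_smul_comm, mul_ite, mul_one, mul_zero]
  have e1 : (∑ a, ∑ b, if a = d then (if b = e then S a b else 0) else 0) = S d e := by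
    rw [Finset.sum_eq_single d]
    · simp
    · intro a _ ha; simp [ha]
    · simp
  have e2 : (∑ a, ∑ b, sgn (par e * par d) • if a = e then (if b = d then S a b else 0) else 0) =
      S d e := by
    rw [Finset.sum_eq_single e]
    · simp only [if_true, smul_ite, smul_zero, Finset.sum_ite_eq', Finset.mem_univ]
      rw [hS d e, mul_comm]
    · intro a _ ha; simp [ha]
    · simp
  rw [e1, e2]
  congr 2
  · module
  · simp

/-- The coefficients are read off successively from the values on 1, on a coordinate and on a
product of two coordinates. On such a product symmetry makes the two orders of differentiation
contribute equally, which cancels the factor ½. -/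
lemma op_unique (hS : ∀ a b, S a b = sgn (par a * par b) • S b a)
    (hS' : ∀ a b, S' a b = sgn (par a * par b) • S' b a)
    (h : ∀ s, c.op S T R s = c.op S' T' R' s) : S = S' ∧ T = T' ∧ R = R' := by
  have hR : R = R' := by
    have := h 1
    rwa [op_one, op_one] at this
  have hT : T = T' := by
    funext a
    have := h (c.coord a)
    rw [op_coord, op_coord, hR] at this
    exact add_right_cancel this
  refine ⟨?_, hT, hR⟩
  funext a b
  have := h (c.coord a * c.coord b)
  rw [op_coord_mul hS, op_coord_mul hS', hR, hT] at this
  exact add_right_cancel (add_right_cancel this)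

lemma canon_apply (γ : Idx p q → O.sec V) (θ : O.sec V) (w : ℝ) (s : O.sec V) :
    c.canon ε S γ θ w s = (1 / 2 : ℝ) • ((∑ a, ∑ b, S a b * c.pd b (c.pd a s)) +
      (∑ a, c.dvgS ε S a * c.pd a s) + (2 * w - 1) • (∑ a, γ a * c.pd a s) +
      w • (c.dvg ε γ * s) + (w * (w - 1)) • (θ * s)) := by
  simp only [canon, op, canonT, canonR, smul_mul_assoc, add_mul, smul_add, Finset.sum_add_distrib,
    ← Finset.smul_sum]
  abel

lemma dvg_add (Q Q' : Idx p q → O.sec V) :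
    c.dvg ε (fun a => Q a + Q' a) = c.dvg ε Q + c.dvg ε Q' := by
  simp only [dvg, map_add, smul_add, Finset.sum_add_distrib]

lemma dvg_smul (r : ℝ) (Q : Idx p q → O.sec V) :
    c.dvg ε (fun a => r • Q a) = r • c.dvg ε Q := by
  simp only [dvg, map_smul, Finset.smul_sum, smul_comm r]

lemma dvg_mem {Q : Idx p q → O.sec V} (hQ : ∀ a, Q a ∈ O.gr V (ε + par a)) :
    c.dvg ε Q ∈ O.gr V ε := by
  refine Submodule.sum_mem _ fun a _ => Submodule.smul_mem _ _ ?_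
  have := c.pd_mem a (hQ a)
  rwa [show ε + par a + par a = ε by
    generalize par a = x; clear * -; revert x ε; decide] at this

lemma dvgS_mem (hS : IsSymbol ε S) (a : Idx p q) : c.dvgS ε S a ∈ O.gr V (ε + par a) := by
  refine Submodule.sum_mem _ fun b _ => Submodule.smul_mem _ _ ?_
  have := c.pd_mem b (hS.mem b a)
  rwa [show ε + par b + par a + par b = ε + par a by
    generalize par a = x; generalize par b = y; clear * -; revert x y ε; decide] at this

lemma raise_mem (hS : IsSymbol ε S) {ℓ : Idx p q → O.sec V} (hℓ : ∀ a, ℓ a ∈ O.gr V (par a))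
    (a : Idx p q) : raise S ℓ a ∈ O.gr V (ε + par a) :=
  Submodule.sum_mem _ fun b _ => graded_mul_mem (O.gr V) (hS.mem a b) (hℓ b) (by
    generalize par a = x; generalize par b = y; clear * -; revert x y ε; decide)

lemma op_mem (hS : IsSymbol ε S) (hT : ∀ a, T a ∈ O.gr V (ε + par a)) (hR : R ∈ O.gr V ε)
    {i : ZMod 2} {s : O.sec V} (hs : s ∈ O.gr V i) : c.op S T R s ∈ O.gr V (ε + i) := by
  refine Submodule.add_mem _ (Submodule.add_mem _ (Submodule.smul_mem _ _ ?_) ?_) ?_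
  · refine Submodule.sum_mem _ fun a _ => Submodule.sum_mem _ fun b _ =>
      graded_mul_mem (O.gr V) (hS.mem a b) (c.pd_mem b (c.pd_mem a hs)) ?_
    generalize par a = x; generalize par b = y; clear * -; revert x y ε i; decide
  · refine Submodule.sum_mem _ fun a _ => graded_mul_mem (O.gr V) (hT a) (c.pd_mem a hs) ?_
    generalize par a = x; clear * -; revert x ε i; decide
  · exact graded_mul_mem (O.gr V) hR hs rfl

/-- The vector `raise S ℓ` multiplies a first derivative twice: with factor `-w` from the inner
derivative and with `1 - w` from the outer one. Together this is `-(2w - 1)`, the dependence on the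
weight required of a canonical pencil. -/
lemma lb_eq_canon (hS : IsSymbol ε S) {ℓ : Idx p q → O.sec V} (hℓ : ∀ a, ℓ a ∈ O.gr V (par a))
    (w : ℝ) (s : O.sec V) :
    c.lb ε S ℓ w s = c.canon ε S (fun a => -raise S ℓ a) (∑ a, raise S ℓ a * ℓ a) w s := by
  set Λ := raise S ℓ with hΛ
  have hΛm := raise_mem hS hℓ
  have hZ : ∀ a, raise S (fun b => c.pd b s - w • (ℓ b * s)) a =
      (∑ b, S a b * c.pd b s) - w • (Λ a * s) := by
    intro a
    simp only [raise, hΛ, mul_sub, Finset.sum_sub_distrib, Finset.sum_mul, Finset.smul_sum,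
      mul_smul_comm, mul_assoc]
  have h1 : ∀ a, sgn (par a * (ε + 1)) • c.pd a (∑ b, S a b * c.pd b s) =
      (∑ b, (sgn (par a * (ε + 1)) • c.pd a (S a b)) * c.pd b s) +
      ∑ b, S b a * c.pd a (c.pd b s) := by
    intro a
    rw [map_sum, Finset.smul_sum, ← Finset.sum_add_distrib]
    refine Finset.sum_congr rfl fun b _ => ?_
    rw [c.pd_mul a (hS.mem a b), smul_add, smul_smul, ← sgn_add, smul_mul_assoc, hS.symm b a,
      smul_mul_assoc]
    congr 3
    generalize par a = x; generalize par b = y; clear * -; revert x y ε; decide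
  have h2 : ∀ a, sgn (par a * (ε + 1)) • c.pd a (Λ a * s) =
      (sgn (par a * (ε + 1)) • c.pd a (Λ a)) * s + Λ a * c.pd a s := by
    intro a
    rw [c.pd_mul a (hΛm a), smul_add, smul_smul, ← sgn_add, smul_mul_assoc,
      show par a * (ε + 1) + par a * (ε + par a) = 0 by
        generalize par a = x; clear * -; revert x ε; decide, sgn_zero, one_smul]
  have h3 : ∑ a, sgn (par a * (ε + 1)) • (ℓ a * ∑ b, S a b * c.pd b s) =
      ∑ a, Λ a * c.pd a s := by
    simp only [Finset.mul_sum, Finset.smul_sum, hΛ, raise, Finset.sum_mul]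
    rw [Finset.sum_comm]
    refine Finset.sum_congr rfl fun b _ => Finset.sum_congr rfl fun a _ => ?_
    rw [← mul_assoc, O.supercomm V _ _ _ _ (hℓ a) (hS.mem a b), smul_mul_assoc, smul_smul,
      ← sgn_add, hS.symm b a, smul_mul_assoc, smul_mul_assoc]
    congr 2
    generalize par a = x; generalize par b = y; clear * -; revert x y ε; decide
  have h4 : ∑ a, sgn (par a * (ε + 1)) • (ℓ a * (Λ a * s)) = (∑ a, Λ a * ℓ a) * s := by
    rw [Finset.sum_mul]
    refine Finset.sum_congr rfl fun a _ => ?_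
    rw [← mul_assoc, O.supercomm V _ _ _ _ (hℓ a) (hΛm a), smul_mul_assoc, smul_smul,
      ← sgn_add, show par a * (ε + 1) + par a * (ε + par a) = 0 by
        generalize par a = x; clear * -; revert x ε; decide, sgn_zero, one_smul]
  have h5 : c.dvg ε (fun a => -Λ a) = -c.dvg ε Λ := by
    simp only [dvg, map_neg, smul_neg, Finset.sum_neg_distrib]
  have h6 : ∑ a, c.dvgS ε S a * c.pd a s =
      ∑ a, ∑ b, (sgn (par a * (ε + 1)) • c.pd a (S a b)) * c.pd b s := by
    simp only [dvgS, Finset.sum_mul]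
    rw [Finset.sum_comm]
  have h7 : ∑ a, ∑ b, S a b * c.pd b (c.pd a s) = ∑ a, ∑ b, S b a * c.pd a (c.pd b s) := by
    rw [Finset.sum_comm]
  have h8 : c.lb ε S ℓ w s = (1 / 2 : ℝ) •
      ((∑ a, sgn (par a * (ε + 1)) • c.pd a (∑ b, S a b * c.pd b s)) -
        w • (∑ a, sgn (par a * (ε + 1)) • c.pd a (Λ a * s)) +
        (1 - w) • (∑ a, sgn (par a * (ε + 1)) • (ℓ a * ∑ b, S a b * c.pd b s)) -
        ((1 - w) * w) • (∑ a, sgn (par a * (ε + 1)) • (ℓ a * (Λ a * s)))) := by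
    simp only [lb, hZ, Finset.smul_sum]
    rw [← Finset.sum_sub_distrib, ← Finset.sum_add_distrib, ← Finset.sum_sub_distrib,
      Finset.smul_sum]
    refine Finset.sum_congr rfl fun a _ => ?_
    simp only [map_sub, map_smul, mul_sub, mul_smul_comm]
    module
  rw [h8, canon_apply, h3, h4]
  simp only [h1, h2, Finset.sum_add_distrib, h5, h6, h7, ← Finset.sum_mul, neg_mul,
    Finset.sum_neg_distrib]
  rw [← dvg]
  module

/-- The cross terms of the second derivative coincide by symmetry of `S`, which absorbs the ½. The
first two summands contain the zeroth-order term twice, hence the subtraction of `R * f * s`. -/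
lemma op_mul (hS : IsSymbol ε S) (hT : ∀ a, T a ∈ O.gr V (ε + par a)) (hR : R ∈ O.gr V ε)
    {i : ZMod 2} {f : O.sec V} (hf : f ∈ O.gr V i) (s : O.sec V) :
    c.op S T R (f * s) = c.op S T R f * s + sgn (ε * i) • (f * c.op S T R s) +
      (∑ a, ∑ b, sgn (par a * i) • (S a b * c.pd b f * c.pd a s)) - R * f * s := by
  have h2 : ∀ a b, S a b * c.pd b (c.pd a (f * s)) = S a b * c.pd b (c.pd a f) * s +
      sgn (par b * i) • (S b a * c.pd a f * c.pd b s) +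
      sgn (par a * i) • (S a b * c.pd b f * c.pd a s) +
      sgn (ε * i) • (f * (S a b * c.pd b (c.pd a s))) := by
    intro a b
    have e0 : S a b * (f * c.pd b (c.pd a s)) =
        sgn ((ε + par a + par b) * i) • (f * (S a b * c.pd b (c.pd a s))) := by
      rw [← mul_assoc, O.supercomm V _ _ _ _ (hS.mem a b) hf, smul_mul_assoc, mul_assoc]
    have e1 : par b * (i + par a) = par b * i + par b * par a := mul_add _ _ _
    have e2 : par a * i + par b * i + (ε + par a + par b) * i = ε * i := by
      generalize par a = x; generalize par b = y; clear * -; revert x y ε i; decide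
    have e3 : S b a * c.pd a f * c.pd b s = sgn (par b * par a) • (S a b * c.pd a f * c.pd b s) := by
      rw [hS.symm b a, smul_mul_assoc, smul_mul_assoc]
    rw [c.pd_mul a hf, map_add, map_smul, c.pd_mul b (c.pd_mem a hf), c.pd_mul b hf, e3]
    simp only [mul_add, smul_add, mul_smul_comm, smul_smul, ← sgn_add, e0, e1]
    simp only [← add_assoc, e2, mul_assoc]
  have h1 : ∀ a, T a * c.pd a (f * s) = T a * c.pd a f * s +
      sgn (ε * i) • (f * (T a * c.pd a s)) := by
    intro a
    rw [c.pd_mul a hf, mul_add, mul_smul_comm, ← mul_assoc, ← mul_assoc (T a) f,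
      O.supercomm V _ _ _ _ (hT a) hf]
    simp only [smul_mul_assoc, smul_smul, mul_assoc, ← sgn_add]
    congr 3
    generalize par a = x; clear * -; revert x ε i; decide
  have h0 : sgn (ε * i) • (f * (R * s)) = R * f * s := by
    rw [← mul_assoc, O.supercomm V _ _ _ _ hf hR, smul_mul_assoc, smul_smul, ← sgn_add,
      show ε * i + i * ε = 0 by clear * -; revert ε i; decide, sgn_zero, one_smul]
  have h3 : ∑ a, ∑ b, sgn (par b * i) • (S b a * c.pd a f * c.pd b s) =
      ∑ a, ∑ b, sgn (par a * i) • (S a b * c.pd b f * c.pd a s) := Finset.sum_comm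
  have hA : ∑ a, ∑ b, S a b * c.pd b (c.pd a (f * s)) =
      (∑ a, ∑ b, S a b * c.pd b (c.pd a f)) * s +
      (2 : ℝ) • (∑ a, ∑ b, sgn (par a * i) • (S a b * c.pd b f * c.pd a s)) +
      sgn (ε * i) • (f * ∑ a, ∑ b, S a b * c.pd b (c.pd a s)) := by
    simp only [h2, Finset.sum_add_distrib, h3]
    simp only [Finset.sum_mul, Finset.mul_sum, Finset.smul_sum, two_smul, Finset.sum_add_distrib,
      add_assoc]
  have hB : ∑ a, T a * c.pd a (f * s) = (∑ a, T a * c.pd a f) * s +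
      sgn (ε * i) • (f * ∑ a, T a * c.pd a s) := by
    simp only [h1, Finset.sum_add_distrib, Finset.sum_mul, Finset.mul_sum, Finset.smul_sum]
  simp only [op]
  rw [hA, hB]
  simp only [mul_add, add_mul, smul_add, h0, smul_mul_assoc, mul_smul_comm]
  rw [mul_assoc R f s]
  module

end Coord

end SuperDensity

namespace SuperDensity

namespace Coord

variable {X : Type u} [TopologicalSpace X] {O : SuperSheaf.{u, v} X} {p q : ℕ} {V : Opens X}
  {c c' : Coord O p q V} {ε : ZMod 2} {S S' : Idx p q → Idx p q → O.sec V}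
  {T T' : Idx p q → O.sec V} {R R' : O.sec V} {ℓ ℓ' : Idx p q → O.sec V}

lemma even_left_comm {g : O.sec V} (hg : g ∈ O.gr V 0) (s t : O.sec V) :
    s * (g * t) = g * (s * t) := by
  rw [← mul_assoc, ← (even_commute hg s).eq, mul_assoc]

/-! ### The canonical pencil relative to a volume form -/

/-- The Lie derivative adds `2r Q` to `γ`. Its divergence has factor `w(2w - 1) = w + 2w(w - 1)` and
splits accordingly between the divergence of `γ` and `θ`; this is why `(2w - 1)` and `w(w - 1)` are
the right factors. -/
lemma lb_add_lie_eq_canon (hS : IsSymbol ε S) (hℓ : ∀ a, ℓ a ∈ O.gr V (par a))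
    (Q : Idx p q → O.sec V) (f : O.sec V) (r t w : ℝ) (s : O.sec V) :
    c.lb ε S ℓ w s + ((2 * w - 1) * r) • c.lie ε Q w s + (w * (w - 1) * t) • (f * s) =
      c.canon ε S (fun a => -raise S ℓ a + (2 * r) • Q a)
        ((∑ a, raise S ℓ a * ℓ a) + (4 * r) • c.dvg ε Q + (2 * t) • f) w s := by
  rw [lb_eq_canon hS hℓ, canon_apply, canon_apply, dvg_add, dvg_smul, lie]
  simp only [add_mul, Finset.sum_add_distrib, smul_mul_assoc, ← Finset.smul_sum]
  module

/-- The vector field in the decomposition of an operator relative to a volume form. -/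
noncomputable def decQ (c : Coord O p q V) (ε : ZMod 2) (S : Idx p q → Idx p q → O.sec V)
    (T ℓ : Idx p q → O.sec V) (w : ℝ) (a : Idx p q) : O.sec V :=
  T a - (1 / 2 : ℝ) • c.dvgS ε S a + (1 / 2 * (2 * w - 1)) • raise S ℓ a

/-- The function in the decomposition of an operator relative to a volume form. -/
noncomputable def decF (c : Coord O p q V) (ε : ZMod 2) (S : Idx p q → Idx p q → O.sec V)
    (T : Idx p q → O.sec V) (R : O.sec V) (ℓ : Idx p q → O.sec V) (w : ℝ) : O.sec V :=
  R - w • c.dvg ε (c.decQ ε S T ℓ w) -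
    (1 / 2 : ℝ) • ((w * (w - 1)) • (∑ a, raise S ℓ a * ℓ a) - w • c.dvg ε (raise S ℓ))

/-- The second-order parts of both sides agree, so the difference to `lb` is of first order; `decQ`
and `decF` are what comparison of its coefficients gives. -/
lemma op_eq_lb_add_lie (hS : IsSymbol ε S) (hℓ : ∀ a, ℓ a ∈ O.gr V (par a)) (w : ℝ)
    (s : O.sec V) : c.op S T R s =
      c.lb ε S ℓ w s + c.lie ε (c.decQ ε S T ℓ w) w s + c.decF ε S T R ℓ w * s := by
  have h5 : c.dvg ε (fun a => -raise S ℓ a) = -c.dvg ε (raise S ℓ) := by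
    simp only [dvg, map_neg, smul_neg, Finset.sum_neg_distrib]
  have hQ : ∑ a, c.decQ ε S T ℓ w a * c.pd a s = (∑ a, T a * c.pd a s) -
      (1 / 2 : ℝ) • (∑ a, c.dvgS ε S a * c.pd a s) +
      (1 / 2 * (2 * w - 1)) • ∑ a, raise S ℓ a * c.pd a s := by
    simp only [decQ, add_mul, sub_mul, Finset.sum_add_distrib, Finset.sum_sub_distrib,
      smul_mul_assoc, ← Finset.smul_sum]
  rw [lb_eq_canon hS hℓ, canon_apply, lie, op, hQ, decF, h5]
  simp only [sub_mul, smul_mul_assoc, neg_mul, Finset.sum_neg_distrib]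
  module

lemma lie_add_eq_op (Q : Idx p q → O.sec V) (f : O.sec V) (w : ℝ) (s : O.sec V) :
    c.lie ε Q w s + f * s = c.op (fun _ _ => 0) Q (w • c.dvg ε Q + f) s := by
  simp only [lie, op, zero_mul, Finset.sum_const_zero, smul_zero, zero_add, add_mul,
    smul_mul_assoc, add_assoc]

lemma lie_add_unique {Q Q' : Idx p q → O.sec V} {f f' : O.sec V} {w : ℝ}
    (h : ∀ s, c.lie ε Q w s + f * s = c.lie ε Q' w s + f' * s) : Q = Q' ∧ f = f' := by
  simp only [lie_add_eq_op] at h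
  obtain ⟨-, rfl, h3⟩ := op_unique (fun _ _ => (smul_zero _).symm)
    (fun _ _ => (smul_zero _).symm) h
  exact ⟨rfl, add_left_cancel h3⟩

lemma decQ_mem (hS : IsSymbol ε S) (hT : ∀ a, T a ∈ O.gr V (ε + par a))
    (hℓ : ∀ a, ℓ a ∈ O.gr V (par a)) (w : ℝ) (a : Idx p q) :
    c.decQ ε S T ℓ w a ∈ O.gr V (ε + par a) :=
  add_mem (sub_mem (hT a) (Submodule.smul_mem _ _ (dvgS_mem hS a)))
    (Submodule.smul_mem _ _ (raise_mem hS hℓ a))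

lemma sum_raise_mem (hS : IsSymbol ε S) (hℓ : ∀ a, ℓ a ∈ O.gr V (par a)) :
    ∑ a, raise S ℓ a * ℓ a ∈ O.gr V ε :=
  Submodule.sum_mem _ fun a _ => graded_mul_mem (O.gr V) (raise_mem hS hℓ a) (hℓ a) (by
    generalize par a = x; clear * -; revert x ε; decide)

lemma decF_mem (hS : IsSymbol ε S) (hT : ∀ a, T a ∈ O.gr V (ε + par a)) (hR : R ∈ O.gr V ε)
    (hℓ : ∀ a, ℓ a ∈ O.gr V (par a)) (w : ℝ) : c.decF ε S T R ℓ w ∈ O.gr V ε :=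
  sub_mem (sub_mem hR (Submodule.smul_mem _ _ (dvg_mem (decQ_mem hS hT hℓ w))))
    (Submodule.smul_mem _ _ (sub_mem (Submodule.smul_mem _ _ (sum_raise_mem hS hℓ))
      (Submodule.smul_mem _ _ (dvg_mem (raise_mem hS hℓ)))))

/-- The three excluded weights enter here: `γ` is recovered from the first-order coefficient by
dividing by `2w - 1`, and then `θ` from the zeroth-order one by dividing by `w(w - 1)`. -/
lemma canon_unique (hS : IsSymbol ε S) {γ₁ γ₂ : Idx p q → O.sec V} {θ₁ θ₂ : O.sec V} {w : ℝ}
    (hw₀ : w ≠ 0) (hw₁ : w ≠ 1) (hw₂ : w ≠ 1 / 2)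
    (h : ∀ s, c.canon ε S γ₁ θ₁ w s = c.canon ε S γ₂ θ₂ w s) : γ₁ = γ₂ ∧ θ₁ = θ₂ := by
  obtain ⟨-, h2, h3⟩ := op_unique hS.symm hS.symm h
  have hγ : γ₁ = γ₂ := by
    funext a
    have := congrFun h2 a
    simp only [canonT] at this
    have := add_left_cancel (smul_right_injective _ (by norm_num : (1 / 2 : ℝ) ≠ 0) this)
    exact smul_right_injective _ (fun h => hw₂ (by linarith)) this
  subst hγ
  refine ⟨rfl, ?_⟩
  have := add_left_cancel (smul_right_injective _ (by norm_num : (1 / 2 : ℝ) ≠ 0) h3)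
  exact smul_right_injective _ (mul_ne_zero hw₀ (sub_ne_zero.2 hw₁)) this

/-- The operator `(f, s) ↦ Δ(fs) - Δ(f) s - (-1)^{εf} f Δ(s)` of the canonical pencil. -/
lemma canon_mul (hS : IsSymbol ε S) {γ : Idx p q → O.sec V} (hγ : ∀ a, γ a ∈ O.gr V (ε + par a))
    {θ : O.sec V} (hθ : θ ∈ O.gr V ε) (w₁ w₂ : ℝ) {i : ZMod 2} {f : O.sec V} (hf : f ∈ O.gr V i)
    (s : O.sec V) :
    c.canon ε S γ θ (w₁ + w₂) (f * s) - c.canon ε S γ θ w₁ f * s -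
      sgn (ε * i) • (f * c.canon ε S γ θ w₂ s) =
    (∑ a, ∑ b, sgn (par a * i) • (S a b * c.pd b f * c.pd a s)) +
      (∑ a, γ a * (w₂ • (c.pd a f * s) + (sgn (par a * i) * w₁) • (f * c.pd a s))) +
      (w₁ * w₂) • (θ * f * s) := by
  have hT : ∀ a, c.canonT ε S γ (w₁ + w₂) a ∈ O.gr V (ε + par a) := fun a =>
    Submodule.smul_mem _ _ (add_mem (dvgS_mem hS a) (Submodule.smul_mem _ _ (hγ a)))
  have hR : c.canonR ε γ θ (w₁ + w₂) ∈ O.gr V ε :=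
    Submodule.smul_mem _ _ (add_mem (Submodule.smul_mem _ _ (dvg_mem hγ))
      (Submodule.smul_mem _ _ hθ))
  have h0 : ∀ {r : O.sec V}, r ∈ O.gr V ε → sgn (ε * i) • (f * (r * s)) = r * f * s := by
    intro r hr
    rw [← mul_assoc, O.supercomm V _ _ _ _ hf hr, smul_mul_assoc, smul_smul, ← sgn_add,
      show ε * i + i * ε = 0 by clear * -; revert ε i; decide, sgn_zero, one_smul]
  have h1 : ∑ a, sgn (par a * i) • (γ a * (f * c.pd a s)) =
      sgn (ε * i) • (f * ∑ a, γ a * c.pd a s) := by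
    rw [Finset.mul_sum, Finset.smul_sum]
    refine Finset.sum_congr rfl fun a _ => ?_
    rw [← mul_assoc, ← mul_assoc, O.supercomm V _ _ _ _ (hγ a) hf, smul_mul_assoc, smul_smul,
      ← sgn_add]
    congr 2
    generalize par a = x; clear * -; revert x i ε; decide
  have h2 : ∑ a, γ a * (w₂ • (c.pd a f * s) + (sgn (par a * i) * w₁) • (f * c.pd a s)) =
      w₂ • ((∑ a, γ a * c.pd a f) * s) + w₁ • (sgn (ε * i) • (f * ∑ a, γ a * c.pd a s)) := by
    rw [← h1, Finset.sum_mul, Finset.smul_sum, Finset.smul_sum, ← Finset.sum_add_distrib]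
    refine Finset.sum_congr rfl fun a _ => ?_
    rw [mul_add, mul_smul_comm, mul_smul_comm, mul_assoc, smul_smul, mul_comm w₁]
  -- This is the Leibniz defect with all three operators at weight `w₁ + w₂`. Lowering the weights
  -- on the factors produces the `γ` terms with coefficients `w₂` and `w₁`. The divergence of `γ`
  -- drops out, being linear in the weight, and `w(w - 1)/2` polarises to `w₁ w₂`.
  have hm := op_mul (c := c) hS hT hR hf s
  have h3 : c.op S (c.canonT ε S γ (w₁ + w₂)) (c.canonR ε γ θ (w₁ + w₂)) =
      c.canon ε S γ θ (w₁ + w₂) := rfl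
  rw [h3] at hm
  rw [hm, h2]
  simp only [canon_apply, canonR, add_mul, smul_mul_assoc, mul_add, mul_smul_comm, smul_add]
  have hθ' := h0 hθ
  have hδ' := h0 (c.dvg_mem hγ)
  simp only [smul_comm (sgn (ε * i)), hθ', hδ']
  module

/-! ### Change of coordinates -/

/-- The transformation law of the principal symbol. -/
def SymbolTransform (c c' : Coord O p q V) (ε : ZMod 2) (S S' : Idx p q → Idx p q → O.sec V) :
    Prop :=
  ∀ a' b', S' a' b' = ∑ a, ∑ b, sgn ((par a + par a') * (ε + par a)) •
    (c.jacMat c' a a' * (S a b * c.jacMat c' b b'))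

/-- The bidifferential expression in `S` is the second-order part of the Leibniz defect and is
unaffected by conjugation with an invertible even function. Evaluating it on two coordinates of `c'`
gives the transformation law. -/
lemma symbolTransform_of_conj (hS : IsSymbol ε S) (hS' : IsSymbol ε S')
    (hT : ∀ a, T a ∈ O.gr V (ε + par a)) (hR : R ∈ O.gr V ε)
    (hT' : ∀ a, T' a ∈ O.gr V (ε + par a)) (hR' : R' ∈ O.gr V ε)
    {g : O.sec V} (hg : g ∈ O.gr V 0) (hu : IsUnit g)
    (h : ∀ s, c.op S T R (g * s) = g * c'.op S' T' R' s) : SymbolTransform c c' ε S S' := by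
  -- Obtained by comparing `op_mul` in the two charts for `f * s`, for `f` alone and for the
  -- constant 1; the contributions of the derivatives of `g` cancel.
  have key : ∀ {i : ZMod 2} {f : O.sec V}, f ∈ O.gr V i → ∀ s,
      ∑ a, ∑ b, sgn (par a * i) • (S' a b * c'.pd b f * c'.pd a s) =
      ∑ a, ∑ b, sgn (par a * i) • (S a b * c.pd b f * c.pd a s) := by
    intro i f hf s
    apply hu.mul_left_cancel
    have hgc := even_commute hg
    have e1 : g * (f * s) = f * (g * s) := by
      rw [← mul_assoc, (hgc f).eq, mul_assoc]
    have h1 := h (f * s)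
    rw [e1, op_mul hS hT hR hf, op_mul hS' hT' hR' hf, h s] at h1
    have h2 := h f
    rw [(hgc f).eq, op_mul hS hT hR hf] at h2
    have h3 := h 1
    rw [mul_one, op_one] at h3
    have h4 : sgn (ε * i) • (f * c.op S T R g) = c.op S T R g * f := by
      have := op_mem (c := c) hS hT hR hg
      rw [add_zero] at this
      rw [O.supercomm V _ _ _ _ this hf]
    have h5 : ∑ a, ∑ b, sgn (par a * i) • (S a b * c.pd b f * c.pd a (g * s)) =
        (∑ a, ∑ b, sgn (par a * i) • (S a b * c.pd b f * c.pd a g)) * s +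
        g * ∑ a, ∑ b, sgn (par a * i) • (S a b * c.pd b f * c.pd a s) := by
      simp only [Finset.sum_mul, Finset.mul_sum, ← Finset.sum_add_distrib]
      refine Finset.sum_congr rfl fun a _ => Finset.sum_congr rfl fun b _ => ?_
      rw [c.pd_mul_even a hg, mul_add, smul_add, mul_smul_comm, smul_mul_assoc,
        even_left_comm hg, ← mul_assoc (S a b * c.pd b f)]
    rw [h5] at h1
    rw [h4, h3] at h2
    have h6 : g * (c'.op S' T' R' f * s) = c.op S T R f * (g * s) + g * R' * f * s +
        (∑ a, ∑ b, sgn (par a * i) • (S a b * c.pd b f * c.pd a g)) * s - R * f * (g * s) := by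
      rw [← mul_assoc, ← h2]
      simp only [sub_mul, add_mul, mul_assoc]
    simp only [mul_sub, mul_add, h6, mul_smul_comm] at h1
    have h7 : g * (f * c'.op S' T' R' s) = f * (g * c'.op S' T' R' s) := by
      rw [← mul_assoc, (hgc f).eq, mul_assoc]
    rw [h7] at h1
    simp only [← mul_assoc] at h1 ⊢
    generalize g * ∑ a, ∑ b, sgn (par a * i) • (S' a b * c'.pd b f * c'.pd a s) = A at h1 ⊢
    generalize g * ∑ a, ∑ b, sgn (par a * i) • (S a b * c.pd b f * c.pd a s) = B at h1 ⊢
    rw [← sub_eq_zero] at h1 ⊢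
    rw [← neg_eq_zero, ← h1]
    abel
  intro a' b'
  have h1 := key (c'.coord_mem b') (c'.coord a')
  have h2 : ∑ a, ∑ b, sgn (par a * par b') • (S' a b * c'.pd b (c'.coord b') *
      c'.pd a (c'.coord a')) = sgn (par a' * par b') • S' a' b' := by
    rw [Finset.sum_eq_single a', Finset.sum_eq_single b']
    · rw [c'.pd_coord, c'.pd_coord, if_pos rfl, if_pos rfl, mul_one, mul_one]
    · intro b _ hb
      rw [c'.pd_coord, if_neg hb, mul_zero, zero_mul, smul_zero]
    · simp
    · intro a _ ha
      simp only [c'.pd_coord, if_neg ha, mul_zero, smul_zero, Finset.sum_const_zero]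
    · simp
  rw [h2] at h1
  have h3 := congrArg (fun z => sgn (par a' * par b') • z) h1
  simp only [smul_smul, sgn_mul_self, one_smul] at h3
  rw [h3, Finset.smul_sum]
  refine Finset.sum_congr rfl fun a _ => ?_
  rw [Finset.smul_sum]
  refine Finset.sum_congr rfl fun b _ => ?_
  have hm : S a b * c.jacMat c' b b' ∈ O.gr V (ε + par a + par b') :=
    graded_mul_mem (O.gr V) (hS.mem a b) (c.jacMat_mem c' b b') (by
      generalize par a = x; generalize par b = y; generalize par b' = z; clear * -
      revert x y z ε; decide)
  rw [O.supercomm V _ _ _ _ (c.jacMat_mem c' a a') hm, smul_smul, smul_smul, ← sgn_add, ← sgn_add]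
  change _ • (S a b * c.jacMat c' b b' * c.jacMat c' a a') = _
  congr 2
  generalize par a = x; generalize par a' = y; generalize par b' = z; clear * -
  revert x y z ε; decide

lemma dvg_transform (c c' : Coord O p q V) (ε : ZMod 2) (z : Idx p q → O.sec V) :
    c'.dvg ε (fun a' => ∑ a, sgn ((par a + par a') * (ε + par a)) • (c.jacMat c' a a' * z a)) =
      ∑ a, sgn (par a * (ε + 1)) • (c.pd a (z a) + c.logJac c' a * z a) := by
  have := c.divergence c' (fun a => sgn (par a * (ε + 1)) • z a)
  simp only [mul_smul_comm, map_smul, ← smul_add] at this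
  rw [← this, dvg]
  refine Finset.sum_congr rfl fun a' _ => ?_
  rw [← map_smul, Finset.smul_sum]
  congr 1
  refine Finset.sum_congr rfl fun a _ => ?_
  rw [smul_smul, smul_smul, ← sgn_add, ← sgn_add]
  congr 2
  generalize par a = x; generalize par a' = y; clear * -
  revert x y ε; decide

/-- The transformation law of the logarithmic derivatives of a volume form. -/
def LogTransform (c c' : Coord O p q V) (ℓ ℓ' : Idx p q → O.sec V) : Prop :=
  ∀ a, ℓ a = c.logJac c' a + ∑ b, c.jacMat c' a b * ℓ' b

/-- The operators `∂_b - w ℓ_b` are covariant on weight `w`: the derivative of `g` cancels the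
inhomogeneous term of `ℓ`. After raising the index with `S`, the outer derivative of `g` contributes
`w logJac` and `(1 - w) ℓ` contributes `(1 - w) logJac`; their sum is exactly the `logJac` term in
the transformation of a divergence. -/
lemma lb_transform (hS : SymbolTransform c c' ε S S') (hℓ : LogTransform c c' ℓ ℓ')
    (hℓ' : ∀ a, ℓ' a ∈ O.gr V (par a)) (w : ℝ) {g : O.sec V} (hg : g ∈ O.gr V 0)
    (hd : ∀ a, c.pd a g = w • (g * c.logJac c' a)) (s : O.sec V) :
    c.lb ε S ℓ w (g * s) = g * c'.lb ε S' ℓ' w s := by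
  have hgc := even_commute hg
  set z : Idx p q → O.sec V := fun a =>
    ∑ b, S a b * ∑ b', c.jacMat c' b b' * (c'.pd b' s - w • (ℓ' b' * s)) with hz
  have h1 : ∀ b, c.pd b (g * s) - w • (ℓ b * (g * s)) =
      g * ∑ b', c.jacMat c' b b' * (c'.pd b' s - w • (ℓ' b' * s)) := by
    intro b
    have : ∑ b', c.jacMat c' b b' * (c'.pd b' s - w • (ℓ' b' * s)) =
        c.pd b s - w • ((∑ b', c.jacMat c' b b' * ℓ' b') * s) := by
      simp only [mul_sub, Finset.sum_sub_distrib, ← c.chain_rule c', mul_smul_comm,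
        ← Finset.smul_sum, Finset.sum_mul, mul_assoc]
    rw [this, hℓ b, c.pd_mul_even b hg, hd, ← mul_assoc (_ + _), ← (hgc _).eq]
    simp only [mul_add, add_mul, mul_sub, smul_mul_assoc, mul_smul_comm, smul_add, mul_assoc]
    abel
  have h2 : ∀ a, raise S (fun b => c.pd b (g * s) - w • (ℓ b * (g * s))) a = g * z a := by
    intro a
    simp only [raise, h1]
    rw [hz, Finset.mul_sum]
    exact Finset.sum_congr rfl fun b _ => even_left_comm hg _ _
  have h3 : ∀ a', raise S' (fun b => c'.pd b s - w • (ℓ' b * s)) a' =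
      ∑ a, sgn ((par a + par a') * (ε + par a)) • (c.jacMat c' a a' * z a) := by
    intro a'
    simp only [raise, hS a', hz, Finset.sum_mul]
    rw [Finset.sum_comm]
    refine Finset.sum_congr rfl fun a _ => ?_
    rw [Finset.sum_comm]
    simp only [Finset.mul_sum, Finset.smul_sum, smul_mul_assoc, mul_assoc]
  have h4 : ∑ a', sgn (par a' * (ε + 1)) • (ℓ' a' *
      ∑ a, sgn ((par a + par a') * (ε + par a)) • (c.jacMat c' a a' * z a)) =
      ∑ a, sgn (par a * (ε + 1)) • ((∑ a', c.jacMat c' a a' * ℓ' a') * z a) := by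
    simp only [Finset.mul_sum, Finset.sum_mul, Finset.smul_sum]
    rw [Finset.sum_comm]
    refine Finset.sum_congr rfl fun a _ => Finset.sum_congr rfl fun a' _ => ?_
    rw [mul_smul_comm, ← mul_assoc, O.supercomm V _ _ _ _ (hℓ' a') (c.jacMat_mem c' a a'),
      smul_mul_assoc, smul_smul, smul_smul, ← sgn_add, ← sgn_add]
    congr 2
    generalize par a = x; generalize par a' = y; clear * -
    revert x y ε; decide
  have h5 : c'.lb ε S' ℓ' w s = (1 / 2 : ℝ) • ((∑ a, sgn (par a * (ε + 1)) •
      (c.pd a (z a) + c.logJac c' a * z a)) + (1 - w) • ∑ a, sgn (par a * (ε + 1)) •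
      ((∑ a', c.jacMat c' a a' * ℓ' a') * z a)) := by
    rw [← dvg_transform, ← h4, dvg, lb]
    simp only [h3, smul_add, Finset.sum_add_distrib, Finset.smul_sum (r := 1 - w),
      smul_comm (1 - w)]
  rw [h5, mul_smul_comm, lb]
  congr 1
  rw [Finset.smul_sum, ← Finset.sum_add_distrib, Finset.mul_sum]
  refine Finset.sum_congr rfl fun a _ => ?_
  rw [h2, hℓ a, c.pd_mul_even a hg, hd, ← mul_assoc (_ + _), ← (hgc _).eq]
  simp only [mul_add, add_mul, smul_mul_assoc, mul_smul_comm, smul_add, mul_assoc]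
  module

/-- The term `w logJac` from the derivative of `g` matches `w` times the inhomogeneous term in the
divergence of the transformed vector field. -/
lemma lie_transform {Q : Idx p q → O.sec V} (hQ : ∀ a, Q a ∈ O.gr V (ε + par a)) (w : ℝ)
    {g : O.sec V} (hg : g ∈ O.gr V 0) (hd : ∀ a, c.pd a g = w • (g * c.logJac c' a))
    (s : O.sec V) :
    c.lie ε Q w (g * s) = g * c'.lie ε (fun a' => ∑ a, Q a * c.jacMat c' a a') w s := by
  have hgc := even_commute hg
  have h1 : c'.dvg ε (fun a' => ∑ a, Q a * c.jacMat c' a a') =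
      c.dvg ε Q + ∑ a, Q a * c.logJac c' a := by
    have : (fun a' => ∑ a, Q a * c.jacMat c' a a') =
        fun a' => ∑ a, sgn ((par a + par a') * (ε + par a)) • (c.jacMat c' a a' * Q a) := by
      funext a'
      refine Finset.sum_congr rfl fun a _ => ?_
      rw [O.supercomm V _ _ _ _ (hQ a) (c.jacMat_mem c' a a'), mul_comm]
    rw [this, dvg_transform, dvg, ← Finset.sum_add_distrib]
    refine Finset.sum_congr rfl fun a _ => ?_
    rw [smul_add, O.supercomm V _ _ _ _ (c.logJac_mem c' a) (hQ a), smul_smul, ← sgn_add,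
      show par a * (ε + 1) + par a * (ε + par a) = 0 by
        generalize par a = x; clear * -; revert x ε; decide, sgn_zero, one_smul]
  have h2 : ∑ a', (∑ a, Q a * c.jacMat c' a a') * c'.pd a' s = ∑ a, Q a * c.pd a s := by
    simp only [c.chain_rule c', Finset.sum_mul, Finset.mul_sum, mul_assoc]
    exact Finset.sum_comm
  have h3 : ∑ a, Q a * c.pd a (g * s) =
      g * (∑ a, Q a * c.pd a s) + w • (g * ((∑ a, Q a * c.logJac c' a) * s)) := by
    rw [Finset.mul_sum, Finset.sum_mul, Finset.mul_sum, Finset.smul_sum, ← Finset.sum_add_distrib]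
    refine Finset.sum_congr rfl fun a _ => ?_
    rw [c.pd_mul_even a hg, hd, mul_add, ← mul_assoc (Q a) g, ← (hgc (Q a)).eq, smul_mul_assoc,
      mul_smul_comm, mul_assoc g, ← mul_assoc (Q a) g, ← (hgc (Q a)).eq, add_comm]
    simp only [mul_assoc]
  rw [lie, lie, h1, h2, h3, even_left_comm hg]
  simp only [mul_add, add_mul, mul_smul_comm, smul_add]
  abel

/-- The logarithmic derivatives which vanish in the coordinates `c`. -/
lemma exists_logTransform_zero (c c' : Coord O p q V) :
    ∃ ℓ' : Idx p q → O.sec V, LogTransform c c' (fun _ => 0) ℓ' ∧ ∀ a, ℓ' a ∈ O.gr V (par a) := by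
  refine ⟨fun b => -∑ a, c'.jacMat c b a * c.logJac c' a, fun a => ?_, fun b => neg_mem
    (Submodule.sum_mem _ fun a _ => graded_mul_mem (O.gr V) (c'.jacMat_mem c b a)
      (c.logJac_mem c' a) (by
        generalize par a = x; generalize par b = y; clear * -; revert x y; decide))⟩
  have h : ∑ b, c.jacMat c' a b * ∑ d, c'.jacMat c b d * c.logJac c' d = c.logJac c' a := by
    simp only [Finset.mul_sum, ← mul_assoc]
    rw [Finset.sum_comm]
    simp only [← Finset.sum_mul, ← Matrix.mul_apply, jacMat_mul_inv, Matrix.one_apply, ite_mul,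
      one_mul, zero_mul, Finset.sum_ite_eq, Finset.mem_univ, if_true]
  simp only [mul_neg, Finset.sum_neg_distrib, h, add_neg_cancel]

/-- A law known at the single weight `w₀` is extended to all weights. Relative to the coordinate
volume form of `c`, with `ℓ = 0`, the pencil splits into three parts, each of which transforms at
every weight. In `c'` it is therefore a canonical pencil with components `γ''`, `θ''` independent of
`w`, and `canon_unique` at `w₀` identifies them with `γ'`, `θ'`. -/
lemma canon_transform (hS : IsSymbol ε S) (hS' : IsSymbol ε S')
    (hSS' : SymbolTransform c c' ε S S') {γ γ' : Idx p q → O.sec V} {θ θ' : O.sec V}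
    (hγ : ∀ a, γ a ∈ O.gr V (ε + par a)) {w₀ : ℝ} (hw₀ : w₀ ≠ 0) (hw₁ : w₀ ≠ 1)
    (hw₂ : w₀ ≠ 1 / 2)
    (h : ∀ s, c.canon ε S γ θ w₀ (c.absPow w₀ (c.jac c') * s) =
      c.absPow w₀ (c.jac c') * c'.canon ε S' γ' θ' w₀ s) (w : ℝ) (s : O.sec V) :
    c.canon ε S γ θ w (c.absPow w (c.jac c') * s) =
      c.absPow w (c.jac c') * c'.canon ε S' γ' θ' w s := by
  obtain ⟨ℓ', hℓ, hℓ'⟩ := exists_logTransform_zero c c'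
  have hz : ∀ a : Idx p q, (fun _ => 0 : Idx p q → O.sec V) a ∈ O.gr V (par a) :=
    fun _ => zero_mem _
  have key : ∃ γ'' θ'', ∀ w s, c.canon ε S γ θ w (c.absPow w (c.jac c') * s) =
      c.absPow w (c.jac c') * c'.canon ε S' γ'' θ'' w s := by
    -- For `ℓ = 0` and `r = t = 1/2`, `lb_add_lie_eq_canon` requires `Q = γ` and `θ = 2 div γ + f`.
    set f := θ - (2 : ℝ) • c.dvg ε γ with hf
    refine ⟨_, _, fun w s => Eq.trans ?_ (congrArg _ (lb_add_lie_eq_canon (c := c') hS' hℓ'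
      (fun a' => ∑ a, γ a * c.jacMat c' a a') f (1 / 2) (1 / 2) w s))⟩
    have h1 := lb_add_lie_eq_canon (c := c) hS hz γ f (1 / 2) (1 / 2) w
      (c.absPow w (c.jac c') * s)
    have h2 : (fun a => -raise S (fun _ => (0 : O.sec V)) a + (2 * (1 / 2) : ℝ) • γ a) = γ := by
      funext a
      simp [raise]
    have h3 : ((∑ a, raise S (fun _ => (0 : O.sec V)) a * (0 : O.sec V)) +
        (4 * (1 / 2) : ℝ) • c.dvg ε γ + (2 * (1 / 2) : ℝ) • f) = θ := by
      simp only [mul_zero, Finset.sum_const_zero, hf]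
      module
    rw [h2, h3] at h1
    have hg : c.absPow w (c.jac c') ∈ O.gr V 0 :=
      c.absPow_mem (c.jac_mem c') (c.isUnit_jac c') w
    have hd := c.pd_absPow_jac c' w
    rw [← h1, lb_transform hSS' hℓ hℓ' w hg hd, lie_transform hγ w hg hd, mul_add, mul_add,
      mul_smul_comm, mul_smul_comm, even_left_comm hg f]
  obtain ⟨γ'', θ'', hk⟩ := key
  obtain ⟨rfl, rfl⟩ := canon_unique (c := c') hS' hw₀ hw₁ hw₂ (γ₁ := γ'') (γ₂ := γ') (θ₁ := θ'')
    (θ₂ := θ') fun s => (c.isUnit_absPow (c.isUnit_jac c') w₀).mul_left_cancel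
      ((hk w₀ s).symm.trans (h s))
  exact hk w s

/-! ### Logarithmic derivatives of a volume form -/

/-- The logarithmic derivatives of an even invertible function. -/
noncomputable def logDeriv (c : Coord O p q V) (r : O.sec V) (a : Idx p q) : O.sec V :=
  Ring.inverse r * c.pd a r

lemma mul_logDeriv (c : Coord O p q V) {r : O.sec V} (hu : IsUnit r) (a : Idx p q) :
    r * c.logDeriv r a = c.pd a r := by
  rw [logDeriv, ← mul_assoc, Ring.mul_inverse_cancel _ hu, one_mul]

/-- The parity of `Ring.inverse r` is not used. The component of the wrong parity becomes zero after
multiplication by the even unit `r`, since the product lies in both graded pieces. -/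
lemma logDeriv_mem {r : O.sec V} (hr : r ∈ O.gr V 0) (hu : IsUnit r) (a : Idx p q) :
    c.logDeriv r a ∈ O.gr V (par a) := by
  obtain ⟨x, hx, y, hy, hxy⟩ : ∃ x ∈ O.gr V (par a), ∃ y ∈ O.gr V (par a + 1),
      c.logDeriv r a = x + y := by
    obtain ⟨x, hx, y, hy, hxy⟩ := exists_even_add_odd (O.gr V) (c.logDeriv r a)
    rcases (show ∀ z : ZMod 2, z = 0 ∨ z = 1 by decide) (par a) with h | h
    · exact ⟨x, by rwa [h], y, by rwa [h], hxy⟩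
    · exact ⟨y, by rwa [h], x, by rwa [h], by rw [hxy, add_comm]⟩
  have h1 := mul_logDeriv c hu a
  rw [hxy, mul_add] at h1
  have hry : r * y = 0 := by
    have h2 : r * y ∈ O.gr V (par a) := by
      rw [← sub_eq_iff_eq_add'.2 h1.symm]
      refine sub_mem ?_ (graded_mul_mem (O.gr V) hr hx (zero_add _))
      have := c.pd_mem a hr
      rwa [zero_add] at this
    have h3 : r * y ∈ O.gr V (par a + 1) := graded_mul_mem (O.gr V) hr hy (zero_add _)
    exact eq_zero_of_mem_mem (O.gr V) h2 h3
  rw [hxy, (hu.mul_right_eq_zero).1 hry, add_zero]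
  exact hx

lemma pd_absPow_eq {r : O.sec V} (hr : r ∈ O.gr V 0) (hu : IsUnit r) (w : ℝ) (a : Idx p q) :
    c.pd a (c.absPow w r) = w • (c.absPow w r * c.logDeriv r a) := by
  apply hu.mul_left_cancel
  rw [c.mul_pd_absPow hr hu, mul_smul_comm, ← mul_assoc,
    (even_commute hr (c.absPow w r)).eq, mul_assoc, mul_logDeriv c hu]

lemma logTransform_logDeriv {r r' : O.sec V} (hr' : r' ∈ O.gr V 0)
    (hu : IsUnit r) (hu' : IsUnit r') (h : r = c.absPow 1 (c.jac c') * r') :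
    LogTransform c c' (c.logDeriv r) (c'.logDeriv r') := by
  intro a
  have hg : c.absPow 1 (c.jac c') ∈ O.gr V 0 :=
    c.absPow_mem (c.jac_mem c') (c.isUnit_jac c') 1
  apply hu.mul_left_cancel
  have h1 : ∀ b, c.jacMat c' a b * c'.pd b r' = r' * (c.jacMat c' a b * c'.logDeriv r' b) := by
    intro b
    rw [← mul_logDeriv c' hu' b, even_left_comm hr']
  rw [mul_logDeriv c hu, h, c.pd_mul_even a hg, c.pd_absPow_jac, one_smul, c.chain_rule c' a r']
  simp only [h1]
  rw [← Finset.mul_sum, mul_add, mul_assoc, mul_assoc, mul_assoc, even_left_comm hr',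
    (even_commute hr' (c.logJac c' a)).eq]

/-- Moving the powers of `|ρ|` to the left through each derivative adds a multiple of the
logarithmic derivative. The exponents `w - 1`, `1` and `-w` add up to zero, so nothing else of `ρ`
remains. -/
lemma laplaceBeltrami_eq {M : Supermanifold.{u, v} X p q} (c : Chart M V)
    (S : Idx p q → Idx p q → M.sec V) (ρ : VolumeForm M) (w : ℝ) (s : M.sec V) :
    laplaceBeltrami ε c S ρ w s = c.lb ε S (c.logDeriv (ρ.coeff c)) w s := by
  have hr : ρ.coeff c ∈ M.gr V 0 := ρ.even V c
  have hu : IsUnit (ρ.coeff c) := ρ.isUnit V c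
  have hm := fun w => c.absPow_mem hr hu w
  have h1 : ∀ b, c.pd b (c.absPow (-w) (ρ.coeff c) * s) = c.absPow (-w) (ρ.coeff c) *
      (c.pd b s - w • (c.logDeriv (ρ.coeff c) b * s)) := by
    intro b
    rw [c.pd_mul_even b (hm _), pd_absPow_eq hr hu, smul_mul_assoc, mul_sub, mul_smul_comm,
      mul_assoc, neg_smul]
    abel
  have h2 : ∀ a, ∑ b, S a b * (c.absPow (-w) (ρ.coeff c) *
      (c.pd b s - w • (c.logDeriv (ρ.coeff c) b * s))) = c.absPow (-w) (ρ.coeff c) *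
      raise S (fun b => c.pd b s - w • (c.logDeriv (ρ.coeff c) b * s)) a := by
    intro a
    rw [raise, Finset.mul_sum]
    refine Finset.sum_congr rfl fun b _ => ?_
    rw [← mul_assoc, ← (even_commute (hm _) _).eq, mul_assoc]
  have h3 : ∀ t, c.absPow 1 (ρ.coeff c) * (c.absPow (-w) (ρ.coeff c) * t) =
      c.absPow (1 - w) (ρ.coeff c) * t := by
    intro t
    rw [← mul_assoc, sub_eq_add_neg, c.absPow_add hr hu]
  have h4 : ∀ t, c.absPow (w - 1) (ρ.coeff c) * (c.absPow (1 - w) (ρ.coeff c) * t) = t := by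
    intro t
    rw [← mul_assoc, ← c.absPow_add hr hu, show w - 1 + (1 - w) = 0 by ring, c.absPow_zero hr hu,
      one_mul]
  simp only [laplaceBeltrami, lb, h1, h2, h3]
  rw [Finset.mul_sum]
  congr 1
  refine Finset.sum_congr rfl fun a _ => ?_
  rw [c.pd_mul_even a (hm _), pd_absPow_eq hr hu, mul_smul_comm, mul_add (c.absPow (w - 1) _), h4, smul_mul_assoc,
    mul_smul_comm, mul_assoc, h4]
  congr 1
  exact add_comm _ _

end Coord

end SuperDensity

namespace SuperDensity

/-! ### Sheaf properties -/

namespace SuperSheaf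

variable {X : Type u} [TopologicalSpace X] {O : SuperSheaf.{u, v} X} {U V : Opens X}

/-- The family may cover more than `V`; its members are intersected with `V`, and the two sections
are compared on the union, which equals `V`. -/
lemma sec_ext {ι : Type u} {U : ι → Opens X} (hV : V ≤ ⨆ i, U i) {s t : O.sec V}
    (h : ∀ i, O.res (inf_le_left : V ⊓ U i ≤ V) s = O.res inf_le_left t) : s = t := by
  have hW : ⨆ i, V ⊓ U i = V := by rw [← inf_iSup_eq]; exact inf_eq_left.2 hV
  obtain ⟨z, -, hz⟩ := O.glue (fun i => V ⊓ U i) (fun i => O.res inf_le_left s) fun i j => by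
    rw [O.res_res, O.res_res]
  have hs := hz (O.res hW.le s) fun i => O.res_res _ _ _
  have ht := hz (O.res hW.le t) fun i => (O.res_res _ _ _).trans (h i).symm
  have := congrArg (O.res hW.ge) (hs.trans ht.symm)
  rwa [O.res_res, O.res_res, O.res_refl, O.res_refl] at this

/-- The component of the wrong parity restricts to zero on every member of the cover. -/
lemma mem_gr_of_local {ι : Type u} {U : ι → Opens X} (hV : V ≤ ⨆ i, U i) {i : ZMod 2}
    {s : O.sec V} (h : ∀ j, O.res (inf_le_left : V ⊓ U j ≤ V) s ∈ O.gr (V ⊓ U j) i) :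
    s ∈ O.gr V i := by
  obtain ⟨x, hx, y, hy, rfl⟩ : ∃ x ∈ O.gr V i, ∃ y ∈ O.gr V (i + 1), s = x + y := by
    obtain ⟨x, hx, y, hy, hxy⟩ := exists_even_add_odd (O.gr V) s
    rcases (show ∀ z : ZMod 2, z = 0 ∨ z = 1 by decide) i with h | h
    · exact ⟨x, by rwa [h], y, by rwa [h], hxy⟩
    · exact ⟨y, by rwa [h], x, by rwa [h], by rw [hxy, add_comm]⟩
  have : y = 0 := by
    refine sec_ext hV fun j => ?_
    rw [map_zero]
    refine eq_zero_of_mem_mem (O.gr _) (i := i) ?_ (O.res_gr _ _ _ hy)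
    have := h j
    rw [map_add] at this
    exact ((O.gr _ i).add_mem_iff_right (O.res_gr _ _ _ hx)).1 this
  rwa [this, add_zero]

/-- The map `s ↦ (-1)^{js} s`. -/
noncomputable def signMap (O : SuperSheaf.{u, v} X) (U : Opens X) (j : ZMod 2) :
    O.sec U →ₗ[ℝ] O.sec U :=
  ∑ i, sgn (j * i) • GradedAlgebra.proj (O.gr U) i

lemma signMap_of_mem {j i : ZMod 2} {s : O.sec U} (hs : s ∈ O.gr U i) :
    O.signMap U j s = sgn (j * i) • s := by
  rw [signMap, LinearMap.sum_apply, Finset.sum_eq_single i]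
  · rw [LinearMap.smul_apply, GradedAlgebra.proj_apply, DirectSum.decompose_of_mem_same _ hs]
  · intro k _ hk
    rw [LinearMap.smul_apply, GradedAlgebra.proj_apply, DirectSum.decompose_of_mem_ne _ hs hk.symm,
      smul_zero]
  · simp

lemma signMap_mul {j : ZMod 2} {g : O.sec U} (hg : g ∈ O.gr U 0) (s : O.sec U) :
    O.signMap U j (g * s) = g * O.signMap U j s := by
  induction s using graded_induction (O.gr U) with
  | hadd a b h h' => rw [mul_add, map_add, map_add, mul_add, h, h']
  | hom i a ha =>
    rw [signMap_of_mem ha, signMap_of_mem (graded_mul_mem (O.gr U) hg ha (zero_add i)),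
      mul_smul_comm]

lemma res_signMap {j : ZMod 2} (h : U ≤ V) (s : O.sec V) :
    O.res h (O.signMap V j s) = O.signMap U j (O.res h s) := by
  induction s using graded_induction (O.gr V) with
  | hadd a b h h' => rw [map_add, map_add, map_add, map_add, h, h']
  | hom i a ha => rw [signMap_of_mem ha, signMap_of_mem (O.res_gr h i a ha), map_smul]

end SuperSheaf

/-! ### Restriction of operators in coordinates -/

namespace Coord

variable {X : Type u} [TopologicalSpace X] {O : SuperSheaf.{u, v} X} {p q : ℕ} {U V : Opens X}
  (c : Coord O p q V) {ε : ZMod 2} (S : Idx p q → Idx p q → O.sec V)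
  (T ℓ : Idx p q → O.sec V) (R : O.sec V) (h : U ≤ V)

lemma res_op (s : O.sec V) : O.res h (c.op S T R s) =
    (c.restrict h).op (fun a b => O.res h (S a b)) (fun a => O.res h (T a)) (O.res h R)
      (O.res h s) := by
  simp only [op, map_add, map_smul, map_sum, map_mul, c.res_pd]

lemma res_dvg : O.res h (c.dvg ε T) = (c.restrict h).dvg ε (fun a => O.res h (T a)) := by
  simp only [dvg, map_sum, map_smul, c.res_pd]

lemma res_dvgS (a : Idx p q) : O.res h (c.dvgS ε S a) =
    (c.restrict h).dvgS ε (fun a b => O.res h (S a b)) a := by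
  simp only [dvgS, map_sum, map_smul, c.res_pd]

lemma res_raise (a : Idx p q) : O.res h (raise S ℓ a) =
    raise (fun a b => O.res h (S a b)) (fun a => O.res h (ℓ a)) a := by
  simp only [raise, map_sum, map_mul]

lemma res_decQ (w : ℝ) (a : Idx p q) : O.res h (c.decQ ε S T ℓ w a) =
    (c.restrict h).decQ ε (fun a b => O.res h (S a b)) (fun a => O.res h (T a))
      (fun a => O.res h (ℓ a)) w a := by
  simp only [decQ, map_add, map_sub, map_smul, res_dvgS, res_raise]

lemma res_decF (w : ℝ) : O.res h (c.decF ε S T R ℓ w) =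
    (c.restrict h).decF ε (fun a b => O.res h (S a b)) (fun a => O.res h (T a)) (O.res h R)
      (fun a => O.res h (ℓ a)) w := by
  simp only [decF, map_sub, map_smul, map_sum, map_mul, res_dvg, res_decQ, res_raise]

lemma res_canon (θ : O.sec V) (w : ℝ) (s : O.sec V) : O.res h (c.canon ε S T θ w s) =
    (c.restrict h).canon ε (fun a b => O.res h (S a b)) (fun a => O.res h (T a)) (O.res h θ) w
      (O.res h s) := by
  simp only [canon, res_op, canonT, canonR, map_add, map_smul, res_dvg, res_dvgS]
  rfl

lemma res_logDeriv {r : O.sec V} (hu : IsUnit r) (a : Idx p q) :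
    O.res h (c.logDeriv r a) = (c.restrict h).logDeriv (O.res h r) a := by
  have hu' : IsUnit (O.res h r) := hu.map (O.res h)
  apply hu'.mul_left_cancel
  rw [mul_logDeriv _ hu', ← map_mul, mul_logDeriv _ hu, res_pd]

variable {c S T R} {S' : Idx p q → Idx p q → O.sec U} {T' : Idx p q → O.sec U} {R' : O.sec U}

/-- The local coefficients of an operator are chosen independently on every open set, so their
compatibility has to be proved. It follows because 1, the coordinates and their products, which
determine the coefficients, restrict to the same elements for the restricted chart. -/
lemma res_coeffs (hS : ∀ a b, S a b = sgn (par a * par b) • S b a)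
    (hS' : ∀ a b, S' a b = sgn (par a * par b) • S' b a)
    (H : ∀ s, O.res h (c.op S T R s) = (c.restrict h).op S' T' R' (O.res h s)) :
    S' = (fun a b => O.res h (S a b)) ∧ T' = (fun a => O.res h (T a)) ∧ R' = O.res h R := by
  have hR : R' = O.res h R := by
    have := H 1
    rw [op_one, map_one, op_one] at this
    exact this.symm
  have hT : T' = fun a => O.res h (T a) := by
    funext a
    have := H (c.coord a)
    rw [op_coord, res_coord, op_coord, hR, map_add, map_mul, res_coord] at this
    exact (add_right_cancel this).symm
  refine ⟨?_, hT, hR⟩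
  funext a b
  have := H (c.coord a * c.coord b)
  rw [op_coord_mul hS, map_mul, res_coord, res_coord, op_coord_mul hS', hR, hT] at this
  simp only [map_add, map_mul, map_smul, res_coord] at this
  exact (add_right_cancel (add_right_cancel this)).symm

lemma op_add (s t : O.sec V) : c.op S T R (s + t) = c.op S T R s + c.op S T R t := by
  simp only [op, map_add, mul_add, Finset.sum_add_distrib, smul_add]
  abel

lemma op_smul (r : ℝ) (s : O.sec V) : c.op S T R (r • s) = r • c.op S T R s := by
  simp only [op, map_smul, mul_smul_comm, ← Finset.smul_sum, smul_add, smul_comm r]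

end Coord

/-! ### The canonical pencil and the long bracket with given components -/

section Densities

variable {X : Type u} [TopologicalSpace X] {p q : ℕ} {M : Supermanifold.{u, v} X p q}
  {V : Opens X} {ε : ZMod 2}

/-- The product of densities. -/
noncomputable def mulDensity (M : Supermanifold.{u, v} X p q) (w₁ w₂ : ℝ) (U : Opens X) :
    Density M w₁ U →ₗ[ℝ] Density M w₂ U →ₗ[ℝ] Density M (w₁ + w₂) U :=
  LinearMap.mk₂ ℝ
    (fun ψ χ => ⟨fun V c => ψ.1 V c * χ.1 V c, fun V V' hV h c => by
      rw [map_mul, ψ.2.1 V V' hV h, χ.2.1 V V' hV h], fun V hV c c' => by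
      have hg := c.absPow_mem (c.jac_mem c') (c.isUnit_jac c') w₂
      beta_reduce
      rw [ψ.2.2 V hV c c', χ.2.2 V hV c c', c.absPow_add (c.jac_mem c') (c.isUnit_jac c'),
        mul_assoc, mul_assoc, Coord.even_left_comm hg]⟩)
    (fun _ _ _ => Subtype.ext (funext₂ fun _ _ => add_mul _ _ _))
    (fun _ _ _ => Subtype.ext (funext₂ fun _ _ => smul_mul_assoc _ _ _))
    (fun _ _ _ => Subtype.ext (funext₂ fun _ _ => mul_add _ _ _))
    (fun _ _ _ => Subtype.ext (funext₂ fun _ _ => mul_smul_comm _ _ _))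

/-- The map `ψ ↦ (-1)^{jψ} ψ` on densities. -/
noncomputable def signDensity (M : Supermanifold.{u, v} X p q) (w : ℝ) (U : Opens X) (j : ZMod 2) :
    Density M w U →ₗ[ℝ] Density M w U where
  toFun ψ := ⟨fun V c => M.signMap V.1 j (ψ.1 V c), fun V V' hV h c => by
    rw [SuperSheaf.res_signMap, ψ.2.1 V V' hV h], fun V hV c c' => by
    beta_reduce
    rw [ψ.2.2 V hV c c', SuperSheaf.signMap_mul
      (c.absPow_mem (c.jac_mem c') (c.isUnit_jac c') w)]⟩
  map_add' _ _ := Subtype.ext (funext₂ fun _ _ => map_add _ _ _)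
  map_smul' _ _ := Subtype.ext (funext₂ fun _ _ => map_smul _ _ _)

/-- The components of a canonical pencil in all systems of coordinates. -/
structure PencilData (M : Supermanifold.{u, v} X p q) (ε : ZMod 2) where
  S : ∀ V : Opens X, Chart M V → Idx p q → Idx p q → M.sec V
  γ : ∀ V : Opens X, Chart M V → Idx p q → M.sec V
  θ : ∀ V : Opens X, Chart M V → M.sec V
  symbol : ∀ V (c : Chart M V), Coord.IsSymbol ε (S V c)
  γ_mem : ∀ V (c : Chart M V) a, γ V c a ∈ M.gr V (ε + par a)
  θ_mem : ∀ V (c : Chart M V), θ V c ∈ M.gr V ε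
  S_res : ∀ (V V' : Opens X) (h : V' ≤ V) (c : Chart M V),
    S V' (c.restrict h) = fun a b => M.res h (S V c a b)
  γ_res : ∀ (V V' : Opens X) (h : V' ≤ V) (c : Chart M V),
    γ V' (c.restrict h) = fun a => M.res h (γ V c a)
  θ_res : ∀ (V V' : Opens X) (h : V' ≤ V) (c : Chart M V), θ V' (c.restrict h) = M.res h (θ V c)
  transform : ∀ (V : Opens X) (c c' : Chart M V) (w : ℝ) (s : M.sec V),
    c.canon ε (S V c) (γ V c) (θ V c) w (c.absPow w (c.jac c') * s) =
      c.absPow w (c.jac c') * c'.canon ε (S V c') (γ V c') (θ V c') w s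

namespace PencilData

variable (P : PencilData M ε)

/-- The canonical pencil. -/
noncomputable def pencil (w : ℝ) : DensityOp M w where
  app U :=
    { toFun := fun ψ => ⟨fun V c => c.canon ε (P.S V.1 c) (P.γ V.1 c) (P.θ V.1 c) w (ψ.1 V c),
        fun V V' hV h c => by
          beta_reduce
          rw [Coord.res_canon, ψ.2.1 V V' hV h, P.S_res V V' h c, P.γ_res V V' h c,
            P.θ_res V V' h c],
        fun V hV c c' => by
          beta_reduce
          rw [ψ.2.2 V hV c c', P.transform V c c']⟩
      map_add' := fun _ _ => Subtype.ext (funext₂ fun _ _ => Coord.op_add _ _)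
      map_smul' := fun _ _ => Subtype.ext (funext₂ fun _ _ => Coord.op_smul _ _) }
  app_res _ _ _ _ := rfl

lemma coeff_pencil (w : ℝ) (c : Chart M V) (ψ : Density M w V) :
    coeff c ((P.pencil w).app V ψ) =
      c.canon ε (P.S V c) (P.γ V c) (P.θ V c) w (coeff c ψ) := rfl

/-- The failure of the pencil to be a derivation. -/
noncomputable def bracketMap (w₁ w₂ : ℝ) (U : Opens X) :
    Density M w₁ U →ₗ[ℝ] Density M w₂ U →ₗ[ℝ] Density M (w₁ + w₂) U :=
  LinearMap.mk₂ ℝ (fun ψ χ => (P.pencil (w₁ + w₂)).app U (mulDensity M w₁ w₂ U ψ χ) -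
      mulDensity M w₁ w₂ U ((P.pencil w₁).app U ψ) χ -
      mulDensity M w₁ w₂ U (signDensity M w₁ U ε ψ) ((P.pencil w₂).app U χ))
    (fun _ _ _ => by simp only [map_add, LinearMap.add_apply]; abel)
    (fun _ _ _ => by simp only [map_smul, LinearMap.smul_apply, smul_sub])
    (fun _ _ _ => by simp only [map_add]; abel)
    (fun _ _ _ => by simp only [map_smul, smul_sub])

lemma bracketMap_val (w₁ w₂ : ℝ) {U : Opens X} (ψ : Density M w₁ U) (χ : Density M w₂ U)
    (V : {V : Opens X // V ≤ U}) (c : Chart M V.1) : (P.bracketMap w₁ w₂ U ψ χ).1 V c =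
      c.canon ε (P.S V c) (P.γ V c) (P.θ V c) (w₁ + w₂) (ψ.1 V c * χ.1 V c) -
      c.canon ε (P.S V c) (P.γ V c) (P.θ V c) w₁ (ψ.1 V c) * χ.1 V c -
      M.signMap V ε (ψ.1 V c) * c.canon ε (P.S V c) (P.γ V c) (P.θ V c) w₂ (χ.1 V c) := rfl

/-- The long bracket of the pencil. -/
noncomputable def bracket : LongBracket M ε where
  S := P.S
  γ := P.γ
  θ := P.θ
  parity_S V c := (P.symbol V c).mem
  parity_γ := P.γ_mem
  parity_θ := P.θ_mem
  symm V c := (P.symbol V c).symm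
  br := P.bracketMap
  br_res w₁ w₂ U U' h ψ χ := Subtype.ext <| funext₂ fun V c =>
    (P.bracketMap_val w₁ w₂ _ _ V c).trans (P.bracketMap_val w₁ w₂ ψ χ ⟨V.1, V.2.trans h⟩ c).symm
  br_eq w₁ w₂ V c ψ χ i hψ := by
    rw [← Coord.canon_mul (c := c) (P.symbol V c) (P.γ_mem V c) (P.θ_mem V c) w₁ w₂ hψ,
      ← smul_mul_assoc, ← SuperSheaf.signMap_of_mem hψ]
    exact P.bracketMap_val w₁ w₂ ψ χ ⟨V, le_rfl⟩ c

lemma isPencil_bracket : P.bracket.IsPencil P.pencil := by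
  intro w V c ψ
  rw [coeff_pencil, Coord.canon_apply]
  simp only [add_mul, Finset.sum_add_distrib, smul_mul_assoc, ← Finset.smul_sum, ← add_assoc]
  rfl

end PencilData

/-! ### The canonical pencil through an operator -/

namespace DensityOp

open Coord

variable {w₀ : ℝ} {L : DensityOp M w₀}

lemma HasCoeffs.isSymbol {c : Chart M V} {S : Idx p q → Idx p q → M.sec V} {T : Idx p q → M.sec V}
    {R : M.sec V} (h : L.HasCoeffs ε c S T R) : IsSymbol ε S := ⟨h.parity_S, h.symm⟩

lemma HasCoeffs.coeff_app {c : Chart M V} {S : Idx p q → Idx p q → M.sec V}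
    {T : Idx p q → M.sec V} {R : M.sec V} (h : L.HasCoeffs ε c S T R) (ψ : Density M w₀ V) :
    coeff c (L.app V ψ) = c.op S T R (coeff c ψ) := h.eq ψ

lemma HasCoeffs.op_eq {c : Chart M V} {S : Idx p q → Idx p q → M.sec V} {T : Idx p q → M.sec V}
    {R : M.sec V} (h : L.HasCoeffs ε c S T R) (s : M.sec V) :
    c.op S T R s = coeff c (L.app V (mkDensity c w₀ s)) := by
  rw [h.coeff_app, coeff_mkDensity]

lemma HasCoeffs.unique {c : Chart M V} {S S' : Idx p q → Idx p q → M.sec V}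
    {T T' : Idx p q → M.sec V} {R R' : M.sec V} (h : L.HasCoeffs ε c S T R)
    (h' : L.HasCoeffs ε c S' T' R') : S = S' ∧ T = T' ∧ R = R' :=
  op_unique h.symm h'.symm fun s => (h.op_eq s).trans (h'.op_eq s).symm

lemma HasCoeffs.conj {c c' : Chart M V} {S S' : Idx p q → Idx p q → M.sec V}
    {T T' : Idx p q → M.sec V} {R R' : M.sec V} (h : L.HasCoeffs ε c S T R)
    (h' : L.HasCoeffs ε c' S' T' R') (s : M.sec V) :
    c.op S T R (c.absPow w₀ (c.jac c') * s) = c.absPow w₀ (c.jac c') * c'.op S' T' R' s := by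
  rw [h'.op_eq, ← coeff_change, h.coeff_app, coeff_change c c' (mkDensity c' w₀ s),
    coeff_mkDensity]

lemma HasCoeffs.symbolTransform {c c' : Chart M V} {S S' : Idx p q → Idx p q → M.sec V}
    {T T' : Idx p q → M.sec V} {R R' : M.sec V} (h : L.HasCoeffs ε c S T R)
    (h' : L.HasCoeffs ε c' S' T' R') : SymbolTransform c c' ε S S' :=
  symbolTransform_of_conj h.isSymbol h'.isSymbol h.parity_T h.parity_R h'.parity_T h'.parity_R
    (c.absPow_mem (c.jac_mem c') (c.isUnit_jac c') w₀)
    (c.isUnit_absPow (c.isUnit_jac c') w₀) (h.conj h')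

lemma HasCoeffs.res {U : Opens X} {c : Chart M V} (hU : U ≤ V)
    {S : Idx p q → Idx p q → M.sec V} {S' : Idx p q → Idx p q → M.sec U} {T : Idx p q → M.sec V}
    {T' : Idx p q → M.sec U} {R : M.sec V} {R' : M.sec U} (h : L.HasCoeffs ε c S T R)
    (h' : L.HasCoeffs ε (c.restrict hU) S' T' R') :
    S' = (fun a b => M.res hU (S a b)) ∧ T' = (fun a => M.res hU (T a)) ∧ R' = M.res hU R := by
  refine res_coeffs (c := c) hU h.symm h'.symm fun s => ?_
  have h1 := h'.coeff_app (resDensity hU (mkDensity c w₀ s))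
  rw [L.app_res, coeff_res, coeff_res, coeff_mkDensity] at h1
  rw [h.op_eq, h1]

variable (hL : L.IsSecondOrder ε)

/-- The principal symbol in the coordinates `c`. -/
noncomputable def S₂ (c : Chart M V) : Idx p q → Idx p q → M.sec V := (hL V c).choose

/-- The first-order coefficients in the coordinates `c`. -/
noncomputable def T₁ (c : Chart M V) : Idx p q → M.sec V := (hL V c).choose_spec.choose

/-- The zeroth-order coefficient in the coordinates `c`. -/
noncomputable def R₀ (c : Chart M V) : M.sec V := (hL V c).choose_spec.choose_spec.choose

lemma hasCoeffs (c : Chart M V) : L.HasCoeffs ε c (S₂ hL c) (T₁ hL c) (R₀ hL c) :=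
  (hL V c).choose_spec.choose_spec.choose_spec

/-- The components `γ^a` of the canonical pencil through `L`. -/
noncomputable def pencilγ (c : Chart M V) (a : Idx p q) : M.sec V :=
  (2 / (2 * w₀ - 1)) • (T₁ hL c a - (1 / 2 : ℝ) • c.dvgS ε (S₂ hL c) a)

/-- The component `θ` of the canonical pencil through `L`. -/
noncomputable def pencilθ (c : Chart M V) : M.sec V :=
  (2 / (w₀ * (w₀ - 1))) • (R₀ hL c - (w₀ / 2) • c.dvg ε (pencilγ hL c))

/-- `pencilγ` and `pencilθ` are the solutions of `canonT = T` and `canonR = R` at weight `w₀`. -/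
lemma canon_pencil (hw₀ : w₀ ≠ 0) (hw₁ : w₀ ≠ 1) (hw₂ : w₀ ≠ 1 / 2) (c : Chart M V) :
    c.canon ε (S₂ hL c) (pencilγ hL c) (pencilθ hL c) w₀ =
      c.op (S₂ hL c) (T₁ hL c) (R₀ hL c) := by
  have h2 : 2 * w₀ - 1 ≠ 0 := fun h => hw₂ (by linarith)
  have h1 : w₀ * (w₀ - 1) ≠ 0 := mul_ne_zero hw₀ (sub_ne_zero.2 hw₁)
  have hT : c.canonT ε (S₂ hL c) (pencilγ hL c) w₀ = T₁ hL c := by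
    funext a
    rw [canonT, pencilγ, smul_smul, mul_div_cancel₀ _ h2]
    module
  have hR : c.canonR ε (pencilγ hL c) (pencilθ hL c) w₀ = R₀ hL c := by
    rw [canonR, pencilθ, smul_smul, mul_div_cancel₀ _ h1]
    module
  rw [canon, hT, hR]

/-- The components of the canonical pencil through `L`. -/
noncomputable def pencilData (hw₀ : w₀ ≠ 0) (hw₁ : w₀ ≠ 1) (hw₂ : w₀ ≠ 1 / 2) :
    PencilData M ε where
  S _ c := S₂ hL c
  γ _ c := pencilγ hL c
  θ _ c := pencilθ hL c
  symbol _ c := (hasCoeffs hL c).isSymbol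
  γ_mem _ c a := Submodule.smul_mem _ _ (sub_mem ((hasCoeffs hL c).parity_T a)
    (Submodule.smul_mem _ _ (dvgS_mem (hasCoeffs hL c).isSymbol a)))
  θ_mem _ c := Submodule.smul_mem _ _ (sub_mem (hasCoeffs hL c).parity_R
    (Submodule.smul_mem _ _ (dvg_mem fun a => Submodule.smul_mem _ _
      (sub_mem ((hasCoeffs hL c).parity_T a)
        (Submodule.smul_mem _ _ (dvgS_mem (hasCoeffs hL c).isSymbol a))))))
  S_res _ _ h c := ((hasCoeffs hL c).res h (hasCoeffs hL (c.restrict h))).1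
  γ_res _ _ h c := by
    obtain ⟨h1, h2, -⟩ := (hasCoeffs hL c).res h (hasCoeffs hL (c.restrict h))
    funext a
    rw [pencilγ, pencilγ, h1, h2, map_smul, map_sub, map_smul, res_dvgS]
  θ_res _ _ h c := by
    obtain ⟨h1, h2, h3⟩ := (hasCoeffs hL c).res h (hasCoeffs hL (c.restrict h))
    rw [pencilθ, pencilθ, h3, map_smul, map_sub, map_smul, res_dvg]
    congr 4
    funext a
    rw [pencilγ, pencilγ, h1, h2, map_smul, map_sub, map_smul, res_dvgS]
  transform _ c c' := canon_transform (hasCoeffs hL c).isSymbol (hasCoeffs hL c').isSymbol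
    ((hasCoeffs hL c).symbolTransform (hasCoeffs hL c'))
    (fun a => Submodule.smul_mem _ _ (sub_mem ((hasCoeffs hL c).parity_T a)
      (Submodule.smul_mem _ _ (dvgS_mem (hasCoeffs hL c).isSymbol a)))) hw₀ hw₁ hw₂ (by
    rw [canon_pencil hL hw₀ hw₁ hw₂, canon_pencil hL hw₀ hw₁ hw₂]
    exact (hasCoeffs hL c).conj (hasCoeffs hL c'))

lemma pencil_apply_self (hw₀ : w₀ ≠ 0) (hw₁ : w₀ ≠ 1) (hw₂ : w₀ ≠ 1 / 2) :
    (pencilData hL hw₀ hw₁ hw₂).pencil w₀ = L := by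
  refine densityOp_ext fun V c ψ => ?_
  rw [PencilData.coeff_pencil, (hasCoeffs hL c).coeff_app]
  exact congrFun (canon_pencil hL hw₀ hw₁ hw₂ c) _

end DensityOp

end Densities

end SuperDensity

namespace SuperDensity

open Coord DensityOp

variable {X : Type u} [TopologicalSpace X] {p q : ℕ} {M : Supermanifold.{u, v} X p q}
  {V : Opens X} {ε : ZMod 2} {w₀ : ℝ} {L : DensityOp M w₀}

/-! ### Uniqueness of the canonical pencil -/

lemma LongBracket.IsPencil.coeff_app {B : LongBracket M ε} {Δ : ∀ w : ℝ, DensityOp M w}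
    (h : B.IsPencil Δ) (w : ℝ) (c : Chart M V) (ψ : Density M w V) :
    SuperDensity.coeff c ((Δ w).app V ψ) =
      c.canon ε (B.S V c) (B.γ V c) (B.θ V c) w (SuperDensity.coeff c ψ) := by
  rw [h, canon_apply]
  simp only [add_mul, Finset.sum_add_distrib, smul_mul_assoc, ← Finset.smul_sum, ← add_assoc]
  rfl

/-- The components of a canonical pencil through `L`. -/
lemma LongBracket.IsPencil.eq_of_canon {B : LongBracket M ε} {Δ : ∀ w : ℝ, DensityOp M w}
    (h : B.IsPencil Δ) (hΔ : Δ w₀ = L) (hw₀ : w₀ ≠ 0) (hw₁ : w₀ ≠ 1) (hw₂ : w₀ ≠ 1 / 2)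
    {c : Chart M V} {S : Idx p q → Idx p q → M.sec V} {T : Idx p q → M.sec V} {R : M.sec V}
    (hc : L.HasCoeffs ε c S T R) {γ : Idx p q → M.sec V} {θ : M.sec V}
    (hγ : ∀ s, c.canon ε S γ θ w₀ s = c.op S T R s) :
    B.S V c = S ∧ B.γ V c = γ ∧ B.θ V c = θ := by
  have h1 : ∀ s, c.canon ε (B.S V c) (B.γ V c) (B.θ V c) w₀ s = c.op S T R s := by
    intro s
    rw [hc.op_eq, ← hΔ, h.coeff_app, coeff_mkDensity]
  have hS : B.S V c = S := (op_unique (B.symm V c) hc.symm h1).1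
  rw [hS] at h1
  exact ⟨hS, canon_unique hc.isSymbol hw₀ hw₁ hw₂ fun s => (h1 s).trans (hγ s).symm⟩

lemma existsUnique_pencil (hL : L.IsSecondOrder ε) (hw₀ : w₀ ≠ 0) (hw₁ : w₀ ≠ 1)
    (hw₂ : w₀ ≠ 1 / 2) :
    ∃! Δ : ∀ w : ℝ, DensityOp M w, IsCanonicalPencil ε Δ ∧ Δ w₀ = L := by
  set P := pencilData hL hw₀ hw₁ hw₂ with hP
  refine ⟨P.pencil, ⟨⟨P.bracket, P.isPencil_bracket⟩, pencil_apply_self hL hw₀ hw₁ hw₂⟩, ?_⟩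
  rintro Δ ⟨⟨B, hB⟩, hΔ⟩
  funext w
  refine densityOp_ext fun V c ψ => ?_
  obtain ⟨h1, h2, h3⟩ := hB.eq_of_canon hΔ hw₀ hw₁ hw₂ (hasCoeffs hL c)
    fun s => congrFun (canon_pencil hL hw₀ hw₁ hw₂ c) s
  rw [hB.coeff_app, h1, h2, h3]
  exact (P.coeff_pencil w c ψ).symm

/-! ### The decomposition relative to a volume form -/

namespace VolumeForm

variable (ρ : VolumeForm M)

/-- The logarithmic derivatives of a volume form. -/
noncomputable def log (c : Chart M V) : Idx p q → M.sec V := c.logDeriv (ρ.coeff c)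

lemma log_mem (c : Chart M V) (a : Idx p q) : ρ.log c a ∈ M.gr V (par a) :=
  logDeriv_mem (ρ.even V c) (ρ.isUnit V c) a

lemma logTransform (c c' : Chart M V) : LogTransform c c' (ρ.log c) (ρ.log c') :=
  logTransform_logDeriv (ρ.even V c') (ρ.isUnit V c) (ρ.isUnit V c')
    (ρ.density.2.2 V le_top c c')

lemma res_log {U : Opens X} (h : U ≤ V) (c : Chart M V) :
    ρ.log (c.restrict h) = fun a => M.res h (ρ.log c a) := by
  funext a
  have hu : IsUnit (ρ.coeff c) := ρ.isUnit V c
  rw [log, log, res_logDeriv c h hu]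
  congr 1
  exact (ρ.density.2.1 V U le_top h c).symm

end VolumeForm

lemma isCombination_iff {w : ℝ} {A : DensityOp M w} {ρ : VolumeForm M} {r : ℝ}
    {Q : VectorField M ε} {s : ℝ} {f : M.gr ⊤ ε} : IsCombination A L ε ρ r Q s f ↔
      ∀ (V : Opens X) (c : Chart M V) (S : Idx p q → Idx p q → M.sec V) (T : Idx p q → M.sec V)
      (R : M.sec V), L.HasCoeffs ε c S T R → ∀ ψ : Density M w V,
      coeff c (A.app V ψ) = c.lb ε S (ρ.log c) w (coeff c ψ) +
        r • c.lie ε (Q.coeff V c) w (coeff c ψ) +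
        s • (M.res le_top (f : M.sec ⊤) * coeff c ψ) := by
  simp only [IsCombination, laplaceBeltrami_eq]
  rfl

/-- The components of the decomposition in the coordinates `c`. -/
lemma isCombination_one_iff {ρ : VolumeForm M} {Q : VectorField M ε} {f : M.gr ⊤ ε} :
    IsCombination L L ε ρ 1 Q 1 f ↔
      ∀ (V : Opens X) (c : Chart M V) (S : Idx p q → Idx p q → M.sec V) (T : Idx p q → M.sec V)
      (R : M.sec V), L.HasCoeffs ε c S T R →
      Q.coeff V c = c.decQ ε S T (ρ.log c) w₀ ∧
      M.res le_top (f : M.sec ⊤) = c.decF ε S T R (ρ.log c) w₀ := by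
  rw [isCombination_iff]
  refine forall_congr' fun V => forall_congr' fun c => forall_congr' fun S => forall_congr' fun T =>
    forall_congr' fun R => forall_congr' fun hc => ?_
  have h1 := op_eq_lb_add_lie (c := c) (T := T) (R := R) hc.isSymbol (ρ.log_mem c) w₀
  simp only [one_smul, hc.coeff_app, h1]
  refine ⟨fun h => ?_, fun h ψ => by rw [h.1, h.2]⟩
  refine lie_add_unique (c := c) (ε := ε) (w := w₀) fun s => ?_
  have := h (mkDensity c w₀ s)
  rw [coeff_mkDensity, add_assoc, add_assoc] at this
  exact (add_left_cancel this).symm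

/-- Both `L` and its Laplace–Beltrami part are conjugated by the same power of the Jacobian, hence
so is the remaining first-order operator. `lie_transform` rewrites it in the chart `c'`, and
uniqueness of the form "Lie derivative plus function" gives both laws. -/
lemma HasCoeffs.dec_transform {c c' : Chart M V} {S S' : Idx p q → Idx p q → M.sec V}
    {T T' : Idx p q → M.sec V} {R R' : M.sec V} (h : L.HasCoeffs ε c S T R)
    (h' : L.HasCoeffs ε c' S' T' R') (ρ : VolumeForm M) :
    c'.decQ ε S' T' (ρ.log c') w₀ =
      (fun a' => ∑ a, c.decQ ε S T (ρ.log c) w₀ a * c.jacMat c' a a') ∧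
    c'.decF ε S' T' R' (ρ.log c') w₀ = c.decF ε S T R (ρ.log c) w₀ := by
  have hg : c.absPow w₀ (c.jac c') ∈ M.gr V 0 := c.absPow_mem (c.jac_mem c') (c.isUnit_jac c') w₀
  have hd := c.pd_absPow_jac c' w₀
  refine lie_add_unique (c := c') (ε := ε) (w := w₀) fun s => ?_
  apply (c.isUnit_absPow (c.isUnit_jac c') w₀).mul_left_cancel
  have h1 := h.conj h' s
  rw [op_eq_lb_add_lie h.isSymbol (ρ.log_mem c) w₀, op_eq_lb_add_lie h'.isSymbol (ρ.log_mem c') w₀,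
    lb_transform (h.symbolTransform h') (ρ.logTransform c c') (ρ.log_mem c') w₀ hg hd,
    lie_transform (decQ_mem h.isSymbol h.parity_T (ρ.log_mem c) w₀) w₀ hg hd,
    even_left_comm hg, ← mul_add, ← mul_add] at h1
  have h2 := (c.isUnit_absPow (c.isUnit_jac c') w₀).mul_left_cancel h1
  rw [add_assoc, add_assoc] at h2
  rw [add_left_cancel h2]

/-- The vector field in the decomposition of `L`. -/
noncomputable def decField (hL : L.IsSecondOrder ε) (ρ : VolumeForm M) : VectorField M ε where
  coeff _ c := c.decQ ε (S₂ hL c) (T₁ hL c) (ρ.log c) w₀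
  parity _ c := decQ_mem (hasCoeffs hL c).isSymbol (hasCoeffs hL c).parity_T (ρ.log_mem c) w₀
  coeff_res _ _ h c a := by
    obtain ⟨h1, h2, -⟩ := (hasCoeffs hL c).res h (hasCoeffs hL (c.restrict h))
    rw [res_decQ, h1, h2, ρ.res_log]
  transform _ c c' a' :=
    congrFun (HasCoeffs.dec_transform (hasCoeffs hL c) (hasCoeffs hL c') ρ).1 a'

/-- The local functions do not depend on the chart and are compatible with restriction, so they glue
to a function on all of the space. -/
lemma exists_decF (hL : L.IsSecondOrder ε) (ρ : VolumeForm M) :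
    ∃ f : M.gr ⊤ ε, ∀ (V : Opens X) (c : Chart M V), M.res le_top (f : M.sec ⊤) =
      c.decF ε (S₂ hL c) (T₁ hL c) (R₀ hL c) (ρ.log c) w₀ := by
  let F {V : Opens X} (c : Chart M V) : M.sec V :=
    c.decF ε (S₂ hL c) (T₁ hL c) (R₀ hL c) (ρ.log c) w₀
  have hres : ∀ {U V : Opens X} (h : U ≤ V) (c : Chart M V), M.res h (F c) = F (c.restrict h) := by
    intro U V h c
    obtain ⟨h1, h2, h3⟩ := (hasCoeffs hL c).res h (hasCoeffs hL (c.restrict h))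
    change M.res h (c.decF ε _ _ _ _ w₀) = (c.restrict h).decF ε _ _ _ _ w₀
    rw [res_decF, h1, h2, h3, ρ.res_log]
  have hchart : ∀ {V : Opens X} (c c' : Chart M V), F c = F c' := fun c c' =>
    (HasCoeffs.dec_transform (hasCoeffs hL c') (hasCoeffs hL c) ρ).2
  have hmem : ∀ {V : Opens X} (c : Chart M V), F c ∈ M.gr V ε := fun c =>
    decF_mem (hasCoeffs hL c).isSymbol (hasCoeffs hL c).parity_T (hasCoeffs hL c).parity_R
      (ρ.log_mem c) w₀
  choose W hW hc using M.exists_coord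
  have hcov : (⊤ : Opens X) ≤ ⨆ x, W x := fun x _ => Opens.mem_iSup.2 ⟨x, hW x⟩
  let C : ∀ x, Chart M (W x) := fun x => (hc x).some
  obtain ⟨t, ht, -⟩ := M.glue W (fun x => F (C x)) fun x y => by
    rw [hres, hres]
    exact hchart _ _
  have hloc : ∀ x, M.res (le_top : W x ≤ ⊤) (M.res hcov t) = F (C x) := fun x => by
    rw [M.res_res]
    exact ht x
  -- An arbitrary chart need not belong to the chosen cover; on each intersection with a member of
  -- the cover, independence of the chart applies.
  have hall : ∀ (V : Opens X) (c : Chart M V),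
      M.res (le_top : V ≤ ⊤) (M.res hcov t) = F c := by
    intro V c
    refine SuperSheaf.sec_ext (le_top.trans hcov) fun x => ?_
    have h1 := congrArg (M.res (inf_le_right : V ⊓ W x ≤ W x)) (hloc x)
    rw [M.res_res] at h1
    rw [M.res_res, h1, hres, hres]
    exact hchart _ _
  refine ⟨⟨M.res hcov t, SuperSheaf.mem_gr_of_local hcov fun x => ?_⟩, hall⟩
  have h1 := hall _ ((C x).restrict (inf_le_right : ⊤ ⊓ W x ≤ W x))
  rw [h1]
  exact hmem _

lemma existsUnique_combination (hL : L.IsSecondOrder ε) (ρ : VolumeForm M) :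
    ∃! Qf : VectorField M ε × M.gr ⊤ ε, IsCombination L L ε ρ 1 Qf.1 1 Qf.2 := by
  obtain ⟨f, hf⟩ := exists_decF hL ρ
  have key : IsCombination L L ε ρ 1 (decField hL ρ) 1 f :=
    isCombination_one_iff.2 fun V c S T R h => by
      obtain ⟨rfl, rfl, rfl⟩ := h.unique (hasCoeffs hL c)
      exact ⟨rfl, hf V c⟩
  refine ⟨(decField hL ρ, f), key, ?_⟩
  rintro ⟨Q, f'⟩ h
  have h1 := isCombination_one_iff.1 h
  refine Prod.ext ?_ ?_
  · ext V c a
    exact congrFun (h1 V c _ _ _ (hasCoeffs hL c)).1 a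
  · choose W hW hc using M.exists_coord
    refine Subtype.ext (SuperSheaf.sec_ext (U := W)
      (fun x _ => Opens.mem_iSup.2 ⟨x, hW x⟩) fun x => ?_)
    let c : Chart M (⊤ ⊓ W x) := (hc x).some.restrict inf_le_right
    exact (h1 _ c _ _ _ (hasCoeffs hL c)).2.trans (hf _ c).symm

/-- With `r = (2w₀ - 1)⁻¹` and `t = (w₀(w₀ - 1))⁻¹` both factors in `lb_add_lie_eq_canon` become 1
at `w₀`, so that canonical pencil takes the value `L` there. Its components must be those of `Δ`,
and reading the identity at weight `w` gives the formula. -/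
lemma isCombination_pencil (hw₀ : w₀ ≠ 0) (hw₁ : w₀ ≠ 1) (hw₂ : w₀ ≠ 1 / 2) {ρ : VolumeForm M}
    {Q : VectorField M ε} {f : M.gr ⊤ ε} (h : IsCombination L L ε ρ 1 Q 1 f)
    {Δ : ∀ w : ℝ, DensityOp M w} (hΔ : IsCanonicalPencil ε Δ) (hL : Δ w₀ = L) (w : ℝ) :
    IsCombination (Δ w) L ε ρ ((2 * w - 1) / (2 * w₀ - 1)) Q
      (w * (w - 1) / (w₀ * (w₀ - 1))) f := by
  obtain ⟨B, hB⟩ := hΔ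
  have h2 : 2 * w₀ - 1 ≠ 0 := fun h => hw₂ (by linarith)
  have h1 : w₀ * (w₀ - 1) ≠ 0 := mul_ne_zero hw₀ (sub_ne_zero.2 hw₁)
  refine isCombination_iff.2 fun V c S T R hc ψ => ?_
  obtain ⟨hQ, hf⟩ := isCombination_one_iff.1 h V c S T R hc
  have key := lb_add_lie_eq_canon (c := c) hc.isSymbol (ρ.log_mem c) (Q.coeff V c)
    (M.res le_top (f : M.sec ⊤)) (2 * w₀ - 1)⁻¹ (w₀ * (w₀ - 1))⁻¹
  obtain ⟨e1, e2, e3⟩ := hB.eq_of_canon hL hw₀ hw₁ hw₂ hc fun s => by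
    rw [← key, mul_inv_cancel₀ h2, mul_inv_cancel₀ h1, one_smul, one_smul, hQ, hf,
      ← op_eq_lb_add_lie hc.isSymbol (ρ.log_mem c)]
  rw [hB.coeff_app, e1, e2, e3, ← key, div_eq_mul_inv, div_eq_mul_inv]

end SuperDensity

open SuperDensity in
theorem mainTheorem8 {X : Type u} [TopologicalSpace X] [T2Space X] [SecondCountableTopology X]
    {p q : ℕ} (M : Supermanifold.{u, v} X p q) (ε : ZMod 2) (w₀ : ℝ)
    (hw₀ : w₀ ≠ 0) (hw₁ : w₀ ≠ 1) (hw₂ : w₀ ≠ 1 / 2)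
    (L : DensityOp M w₀) (hL : L.IsSecondOrder ε) :
    (∃! Δ : ∀ w : ℝ, DensityOp M w, IsCanonicalPencil ε Δ ∧ Δ w₀ = L) ∧
    ∀ ρ : VolumeForm M,
      (∃! Qf : VectorField M ε × M.gr ⊤ ε, IsCombination L L ε ρ 1 Qf.1 1 Qf.2) ∧
      ∀ (Q : VectorField M ε) (f : M.gr ⊤ ε), IsCombination L L ε ρ 1 Q 1 f →
        ∀ Δ : ∀ w : ℝ, DensityOp M w, IsCanonicalPencil ε Δ → Δ w₀ = L →
          ∀ w : ℝ, IsCombination (Δ w) L ε ρ ((2 * w - 1) / (2 * w₀ - 1)) Q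
            (w * (w - 1) / (w₀ * (w₀ - 1))) f := by
  exact ⟨existsUnique_pencil hL hw₀ hw₁ hw₂, fun ρ => ⟨existsUnique_combination hL ρ,
    fun _ _ h _ hΔ hΔL w => isCombination_pencil hw₀ hw₁ hw₂ h hΔ hΔL w⟩⟩
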